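/- **Setting.** Let $a,b\ge 1$, $\sigma\ge 0$, $d\in\mathbb N$, $\Sigma=\mathrm{diag}(1^{-a},2^{-a},\dots,d^{-a})$, and let $W^*\in\mathbb R^d$ satisfy the source condition $\Sigma_{ii}(W^*_i)^2=i^{-b}$ for all $i\le d$. Samples $(x_t,y_t)$, $t=1,2,\dots$, are i.i.d. copies of $(x,y)$ with $x\sim\mathcal N(0,\Sigma)$, $y=\langle W^*,x\rangle+\epsilon$, and $\epsilon\sim\mathcal N(0,\sigma^2)$ independent of $x$. The validation loss is $R(W)=\mathbb E(\langle W,x\rangle-y)^2$, the expected excess validation loss of a random output $\hat W$ is $\mathbb E R(\hat W)-R(W^*)$, and the stochastic gradient at $W$ is $g_t(W)=(\langle x_t,W\rangle-y_t)\,x_t$. For a horizon $T\ge 2$ put $K=\lfloor T/\log_2T\rfloor$; an initial stepsize $s$ gives the piecewise constant schedule $s_t=s/4^{\,l-1}$ for $K(l-1)\le t\le Kl-1$. *Vanilla SGD* with initial stepsize $\eta$: $W_0=0$ and $W_t=W_{t-1}-\eta_t\,g_t(W_{t-1})$ for $1\le t\le T$. *Accelerated SGD* with momentum $1-\beta$,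 $\beta\in(0,1]$, and initial stepsizes $\eta,\gamma$: $W_0=V_0=0$ and, for $1\le t\le T$, $$U_{t-1}=\tfrac1{1+\beta}W_{t-1}+\tfrac{\beta}{1+\beta}V_{t-1},\quad W_t=U_{t-1}-\eta_t\,g_t(U_{t-1}),\quad V_t=\beta U_{t-1}+(1-\beta)V_{t-1}-\gamma_t\,g_t(U_{t-1}).$$ Write $L=\log T$ if $a,b>1$, and $L=(1+\log d)\log T$ if $a=1$ or $b=1$. **Theorem.** Let $a\ge1$. (1) There is $\eta_1>0$, depending only on $a$, such that for all $b\ge1$, $\sigma\ge0$ and $\eta_0>0$ there are $C>0$ and $p\in\mathbb N$ with the following property. For all $d$, all $W^*$ as above, all $T\ge2$ and all $\eta$ with $\eta_0\le\eta\,\mathrm{tr}\,\Sigma\le\eta_1$, the loss $R(W_T)$ of the vanilla SGD output is integrable and its expected excess validation loss is at most $$C L^p\left(T^{1/a-1}+T^{1/a-b/a}\right).$$ (2) For every $\rho\ge1$ there is $\eta_1>0$, depending only on $a$ and $\rho$, such that for all $b\ge1$, $\sigma\ge0$ and $\eta_0>0$ there are $C>0$ and $p\in\mathbb N$ with the following property.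 For all $d$, all $W^*$ as above, all $T\ge2$, all $\beta\in(0,1]$ with $\beta T\ge C(\log T)^p$ (for fixed $\beta$: all sufficiently large $T$), all $\eta$ with $\eta_0\le\eta\,\mathrm{tr}\,\Sigma\le\eta_1$, and all $\gamma$ with $\rho^{-1}\eta\,\beta^{-1+1/a}\le\gamma\le\rho\,\eta\,\beta^{-1+1/a}$, the loss $R(W_T)$ of the accelerated SGD output is integrable and its expected excess validation loss is at most $$C L^p\left(T^{1/a-1}\beta^{1/a^2-1/a}+T^{1/a-b/a}\beta^{(1/a^2-1/a)(1-b)}\right).$$ (3) If $a\le b$, then for all $T\ge1$ and $\beta\in(0,1]$ the first (variance) term dominates both rates, i.e. $T^{1/a-b/a}\le T^{1/a-1}$ and $T^{1/a-b/a}\beta^{(1/a^2-1/a)(1-b)}\le T^{1/a-1}\beta^{1/a^2-1/a}$; moreover $\beta^{1/a^2-1/a}\ge1$ (strictly if $a>1$ and $\beta<1$), and $$\beta^{1/a^2-1/a}\left(T^{1/a-1}+T^{1/a-b/a}\right)\le 2\left(T^{1/a-1}\beta^{1/a^2-1/a}+T^{1/a-b/a}\beta^{(1/a^2-1/a)(1-b)}\right),$$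 so in this regime momentum makes the bound worse. -/

import Mathlib

open MeasureTheory ProbabilityTheory
open scoped NNReal

noncomputable section

namespace AccSGD

/-! ### The regression problem -/

/-- The parameter space `ℝ^d` with its Euclidean structure. -/
abbrev Param (d : ℕ) : Type := EuclideanSpace ℝ (Fin d)

/-- A sample `(x, y)`: covariate and response. -/
abbrev Sample (d : ℕ) : Type := Param d × ℝ

/-- The diagonal covariance matrix with entries `1^{-a}, 2^{-a}, …, d^{-a}`
(the index `i : Fin d` stands for the `(i+1)`-st coordinate). -/
def covariance (a : ℝ) (d : ℕ) : Matrix (Fin d) (Fin d) ℝ :=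
  Matrix.diagonal fun i => ((i : ℝ) + 1) ^ (-a)

theorem covariance_posSemidef (a : ℝ) (d : ℕ) : (covariance a d).PosSemidef := by
  refine Matrix.PosSemidef.diagonal fun i => ?_
  exact Real.rpow_nonneg (by positivity) _

/-- The source condition: `Σ_ii (W*_i)² = i^{-b}`. -/
def SourceCondition (a b : ℝ) {d : ℕ} (Wstar : Param d) : Prop :=
  ∀ i : Fin d, covariance a d i i * Wstar i ^ 2 = ((i : ℝ) + 1) ^ (-b)

/-- The law of one sample `(x, y)`: `x ~ N(0, Σ)` and `y = ⟨W*, x⟩ + ε` with `ε ~ N(0, σ²)`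
independent of `x`. -/
def dataLaw (a : ℝ) (σ : ℝ≥0) {d : ℕ} (Wstar : Param d) : Measure (Sample d) :=
  ((multivariateGaussian 0 (covariance a d)).prod (gaussianReal 0 (σ ^ 2))).map
    fun z => (z.1, inner ℝ Wstar z.1 + z.2)

instance dataLaw_isProbabilityMeasure (a : ℝ) (σ : ℝ≥0) {d : ℕ} (Wstar : Param d) :
    IsProbabilityMeasure (dataLaw a σ Wstar) :=
  Measure.isProbabilityMeasure_map (by fun_prop)

/-- The law of an i.i.d. stream of samples `ξ_0, ξ_1, ξ_2, …`. -/
def streamLaw (a : ℝ) (σ : ℝ≥0) {d : ℕ} (Wstar : Param d) : Measure (ℕ → Sample d) :=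
  Measure.infinitePi fun _ => dataLaw a σ Wstar

/-- The validation loss `R(W) = E (⟨W, x⟩ - y)²` on a fresh sample. -/
def validationLoss (a : ℝ) (σ : ℝ≥0) {d : ℕ} (Wstar W : Param d) : ℝ :=
  ∫ z, (inner ℝ W z.1 - z.2) ^ 2 ∂(dataLaw a σ Wstar)

/-- The stochastic gradient `(⟨x, W⟩ - y) x`. -/
def stochGrad {d : ℕ} (W : Param d) (z : Sample d) : Param d :=
  (inner ℝ z.1 W - z.2) • z.1

/-! ### The algorithms -/

/-- The length `K = ⌊T / log₂ T⌋` of one phase of the stepsize schedule. -/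
def phaseLength (T : ℕ) : ℕ := ⌊(T : ℝ) / Real.logb 2 T⌋₊

/-- The piecewise constant schedule with horizon `T` and initial stepsize `s₀`: the value is
`s₀ / 4^{l-1}` for `K (l-1) ≤ t ≤ K l - 1`. -/
def schedule (s₀ : ℝ) (T t : ℕ) : ℝ := s₀ / 4 ^ (t / phaseLength T)

/-- Vanilla SGD started at `0`, with stepsizes `δ t` and samples `ξ t`, `t = 1, 2, …`. -/
def sgd {d : ℕ} (δ : ℕ → ℝ) (ξ : ℕ → Sample d) : ℕ → Param d
  | 0 => 0
  | t + 1 => sgd δ ξ t - δ (t + 1) • stochGrad (sgd δ ξ t) (ξ (t + 1))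

/-- The averaged point `U = W / (1+β) + β V / (1+β)` of a pair `(W, V)`. -/
def midpointU {d : ℕ} (β : ℝ) (s : Param d × Param d) : Param d :=
  (1 / (1 + β)) • s.1 + (β / (1 + β)) • s.2

/-- The pairs `(W_t, V_t)` of accelerated SGD with momentum `1 - β`, started at `(0, 0)`, with
stepsizes `δ t`, `γ t` and samples `ξ t`, `t = 1, 2, …`. -/
def asgdState {d : ℕ} (β : ℝ) (δ γ : ℕ → ℝ) (ξ : ℕ → Sample d) : ℕ → Param d × Param d
  | 0 => (0, 0)
  | t + 1 =>
    let s := asgdState β δ γ ξ t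
    let U := midpointU β s
    let g := stochGrad U (ξ (t + 1))
    (U - δ (t + 1) • g, β • U + (1 - β) • s.2 - γ (t + 1) • g)

/-- The iterate `W_t` of accelerated SGD. -/
def asgd {d : ℕ} (β : ℝ) (δ γ : ℕ → ℝ) (ξ : ℕ → Sample d) (t : ℕ) : Param d :=
  (asgdState β δ γ ξ t).1

/-! ### The rates -/

/-- `T^{1/a-1} + T^{1/a-b/a}`. -/
def sgdRate (a b : ℝ) (T : ℕ) : ℝ :=
  (T : ℝ) ^ (1 / a - 1) + (T : ℝ) ^ (1 / a - b / a)

/-- `T^{1/a-1} β^{1/a²-1/a} + T^{1/a-b/a} β^{(1/a²-1/a)(1-b)}`. -/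
def asgdRate (a b β : ℝ) (T : ℕ) : ℝ :=
  (T : ℝ) ^ (1 / a - 1) * β ^ (1 / a ^ 2 - 1 / a) +
    (T : ℝ) ^ (1 / a - b / a) * β ^ ((1 / a ^ 2 - 1 / a) * (1 - b))

open scoped Classical in
/-- The logarithm whose powers the rates leave out: `log T` if `a, b > 1`; if `a = 1` or `b = 1`,
where the trace of `Σ` or the norm `∑ i^{-b}` of `W*` grows like `log d`, it is
`(1 + log d) log T`. -/
def logFactor (a b : ℝ) (d T : ℕ) : ℝ :=
  if 1 < a ∧ 1 < b then Real.log T else (1 + Real.log d) * Real.log T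

end AccSGD

end

/-!
The covariance is diagonal, so the mean dynamics of accelerated SGD decouples into two-dimensional
linear recursions (`modeStep`), one for each coordinate. The coordinates interact only through the
gradient noise: the fourth moments of a Gaussian covariate give the noise along coordinate `i` the
variance `λ_i (f + σ²) + λ_i² E u_i²`, where `u` is the error of the midpoint and `f = ∑ λ_j E
u_j²` its excess loss (`hasMean_sub_stochGrad_sq`). Since every sample is independent of the past,
the second moments of the iteration obey an exact recursion, encoded as the functional
`modeMoment` (`hasMean_modeCoord_sq`), and the expected loss of the output is a finite sum of such
moments (`hasMean_validationLoss_asgd`). Everything after that is deterministic.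

A single mode has a fast regime `e ≥ β / 16` and a slow regime, where `e` is the mean of the two
stepsizes times the eigenvalue. In the fast regime the sum of the energies along a trajectory has
a closed form (`fastPotential`), because a linear recursion of order two has an explicit quadratic
Lyapunov function (`arEnergy`). It shows contraction at rate `β` and, more precisely, that the
noise sustains an error of order `gain` only; a second quadratic form excludes transient growth
(`FastRegime.fastEnergy_iterate_le`). In the slow regime the sum of squares `slowEnergy` contracts
at rate `e`. A mode crosses from the first regime to the second as the stepsizes decay, and its
second moments remain bounded throughout (`ModeSetup.moment_midpoint_le`).

The gains sum to a small constant: this is what the smallness of `η tr Σ` and the scaling `γ ≈ η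
β^{-1+1/a}` are for (`StepSizes.sum_gain_le`). Hence the feedback of the multiplicative noise is
subcritical and the excess loss is bounded uniformly in time (`CoreSetup.risk_le`). With this
bound on the noise, the modes can be treated one at a time (`CoreSetup.risk_last_le`). Let `D = (η
+ γ) / 2`. A mode with `D λ_i` above `ε ≈ (log T)² / T` forgets its initial error and ends with
noise of order `ε`; a mode below it keeps its initial error, which gives the bias, and accumulates
noise `T (D λ_i)²`. Truncated power sums (`sum_min_rpow_le`) turn these contributions into the two
terms of the rate (`StepSizes.sum_min_sq_le`, `StepSizes.sum_tail_le`).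

Vanilla SGD is the case `β = 1`, `γ = η`, in which all three sequences coincide
(`asgdState_one_eq`). For the finitely many horizons too short for the phase argument the uniform
bound of the loss suffices, since without momentum it needs no contraction (`sgd_rate`).
-/

noncomputable section

namespace AccSGD

/-! ### A single mode of the mean dynamics -/

/-- The mean dynamics of accelerated SGD along one eigenvector of the covariance, with eigenvalue
`λ`. If `w`, `v` are the errors of `W`, `V` along it and `u = (w + β v) / (1 + β)` is that of the
midpoint, the state is the pair `(q, p)` with `q = (w + v) / 2` and `p = q - u`. The parameters are
`r = (1 - β) / (1 + β)`, `e = (δ + γ) λ / 2` and `g = (γ - δ) λ / 2`. Gradient noise acts on the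
state in the direction `(e, r g)`. -/
def modeStep (r e g : ℝ) (s : ℝ × ℝ) : ℝ × ℝ :=
  (s.1 - e * (s.1 - s.2), r * (s.2 - g * (s.1 - s.2)))

/-- The Lyapunov function of a mode with `e ≤ β / 16`, in which `p` decays faster than `q` moves. -/
def slowEnergy (s : ℝ × ℝ) : ℝ := s.1 ^ 2 + s.2 ^ 2

theorem slowEnergy_modeStep_le {β r e g : ℝ} (hβ0 : 0 < β) (hβ1 : β ≤ 1) (hr0 : 0 ≤ r)
    (hr : r ≤ 1 - β) (hg : |g| ≤ e) (he : e ≤ β / 16) (s : ℝ × ℝ) :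
    slowEnergy (modeStep r e g s) ≤ (1 - e / 2) * slowEnergy s := by
  obtain ⟨q, p⟩ := s
  obtain ⟨hg1, hg2⟩ := abs_le.mp hg
  have he0 : 0 ≤ e := (abs_nonneg g).trans hg
  simp only [slowEnergy, modeStep]
  have hr1 : r ≤ 1 := by linarith
  have h1 : (q - e * (q - p)) ^ 2 ≤ (1 - e) * q ^ 2 + e * p ^ 2 := by
    nlinarith [mul_nonneg (mul_nonneg he0 (by linarith : 0 ≤ 1 - e)) (sq_nonneg (q - p))]
  have hg3 : g ^ 2 ≤ e ^ 2 := sq_le_sq' hg1 hg2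
  have hge : g ^ 2 ≤ e / 16 := by nlinarith
  have hcross : |g * (1 + g)| ≤ e * (17 / 16) := by
    rw [abs_mul]
    exact mul_le_mul hg (by rw [abs_le]; constructor <;> linarith) (abs_nonneg _) he0
  have h2 : (p - g * (q - p)) ^ 2 ≤ (e / 2) * q ^ 2 + (1 + 7 * e) * p ^ 2 := by
    have h3 : (p - g * (q - p)) ^ 2 = (1 + g) ^ 2 * p ^ 2 - 2 * (g * (1 + g)) * (p * q)
        + g ^ 2 * q ^ 2 := by ring
    have h4 : -(2 * (g * (1 + g)) * (p * q)) ≤ e * (q ^ 2 / 4 + 3 / 2 * 4 * p ^ 2 * (13/16)) := by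
      have h5 : -(2 * (g * (1 + g)) * (p * q)) ≤ |2 * (g * (1 + g)) * (p * q)| := neg_le_abs _
      rw [abs_mul, abs_mul, abs_two] at h5
      have h6 : 2 * |g * (1 + g)| * |p * q| ≤ 2 * (e * (17 / 16)) * |p * q| := by
        gcongr
      have h7 : (17 / 8) * |p * q| ≤ q ^ 2 / 4 + 3 / 2 * 4 * p ^ 2 * (13/16) := by
        rw [abs_mul]
        nlinarith [sq_nonneg (|q| / 2 - 17 / 8 * |p|), sq_abs p, sq_abs q, sq_nonneg p]
      nlinarith
    have h8 : (1 + g) ^ 2 ≤ 1 + 17 / 8 * e := by nlinarith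
    rw [h3]
    nlinarith [mul_le_mul_of_nonneg_right h8 (sq_nonneg p),
      mul_le_mul_of_nonneg_right hge (sq_nonneg q), mul_nonneg he0 (sq_nonneg q),
      mul_nonneg he0 (sq_nonneg p)]
  have h9 : (r * (p - g * (q - p))) ^ 2 ≤ (1 - β) * ((e / 2) * q ^ 2 + (1 + 7 * e) * p ^ 2) := by
    rw [mul_pow]
    have : r ^ 2 ≤ 1 - β := by nlinarith
    exact mul_le_mul this h2 (sq_nonneg _) (by linarith)
  have h10 : (1 - β) * (1 + 7 * e) + e ≤ 1 - e / 2 := by nlinarith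
  have h11 : (1 - β) * (e / 2) ≤ e / 2 := by nlinarith
  nlinarith [mul_le_mul_of_nonneg_right h10 (sq_nonneg p),
    mul_le_mul_of_nonneg_right h11 (sq_nonneg q)]

theorem slowEnergy_noise_le {r e g : ℝ} (hr0 : 0 ≤ r) (hr : r ≤ 1) (hg : |g| ≤ e) :
    slowEnergy (e, r * g) ≤ 2 * e ^ 2 := by
  obtain ⟨hg1, hg2⟩ := abs_le.mp hg
  have hg3 : g ^ 2 ≤ e ^ 2 := sq_le_sq' hg1 hg2
  have : r ^ 2 ≤ 1 := by nlinarith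
  simp only [slowEnergy]
  nlinarith [mul_le_mul this hg3 (sq_nonneg _) zero_le_one]

/-- The trace of the linear map `modeStep r e g`. -/
def modeTrace (r e g : ℝ) : ℝ := 1 - e + r + r * g
/-- The determinant of the linear map `modeStep r e g`. -/
def modeDet (r e g : ℝ) : ℝ := r * (1 - e + g)

/-- A Lyapunov function of the recursion `y_{k+2} = τ y_{k+1} - Δ y_k`, where `τ` and `Δ` are the
trace and the determinant of a mode, in the variables `n₀ = y_k` and `n₁ = y_{k+1} - τ y_k`. It is
the sum `∑_{j ≥ k} y_j²` of a stable recursion in closed form; the factor `e (1 - r)` of the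
denominator is `1 + Δ - τ`. -/
def arEnergy (r e g n₀ n₁ : ℝ) : ℝ :=
  (n₀ ^ 2 + n₁ ^ 2 + modeTrace r e g * (n₀ + n₁) ^ 2 / (e * (1 - r))) /
    ((1 - modeDet r e g) * (1 + modeDet r e g + modeTrace r e g))

/-- One step of the recursion lowers `arEnergy` by exactly the square of the entry left behind. -/
theorem arEnergy_sub_shift {r e g : ℝ} (he : e ≠ 0) (hr : 1 - r ≠ 0)
    (hD : 1 - modeDet r e g ≠ 0) (hS : 1 + modeDet r e g + modeTrace r e g ≠ 0) (n₀ n₁ : ℝ) :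
    arEnergy r e g (n₁ + modeTrace r e g * n₀) (-modeDet r e g * n₀) =
      arEnergy r e g n₀ n₁ - n₀ ^ 2 := by
  have hω : 1 + modeDet r e g - modeTrace r e g = e * (1 - r) := by
    simp only [modeDet, modeTrace]; ring
  have hω0 : 1 + modeDet r e g - modeTrace r e g ≠ 0 := by rw [hω]; exact mul_ne_zero he hr
  rw [arEnergy, arEnergy, ← hω]
  generalize modeDet r e g = D at *
  generalize modeTrace r e g = τ at *
  field_simp
  ring

/-- The energy `u² + (β / e) q²` of a mode with `e ≥ β / 16`. -/
def fastEnergy (β e : ℝ) (s : ℝ × ℝ) : ℝ := (s.1 - s.2) ^ 2 + β / e * s.1 ^ 2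

/-- The total `fastEnergy` along the mean trajectory of a mode: by the Cayley-Hamilton theorem both
`u` and `q` satisfy the recursion behind `arEnergy`. -/
def fastPotential (β r e g : ℝ) (s : ℝ × ℝ) : ℝ :=
  arEnergy r e g (s.1 - s.2) ((1 - r) * s.1 - (s.1 - s.2)) +
    β / e * arEnergy r e g s.1 (s.1 - e * (s.1 - s.2) - modeTrace r e g * s.1)

/-- The assumptions on the parameters of a mode with `e ≥ β / 16`. Since `e - g = δ λ`, the
quantities bounded by `x_le` and `h_le` are `δ λ` and `(δ + β γ) λ / (1 + β)`. -/
structure FastRegime (β r e g : ℝ) : Prop where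
  β_pos : 0 < β
  β_le : β ≤ 1
  r_eq : r * (1 + β) = 1 - β
  abs_g_le : |g| ≤ e
  le_e : β / 16 ≤ e
  β_mul_e_le : β * e ≤ 1 / 2
  x_le : e - g ≤ 1 / 2
  h_le : e - r * g ≤ 1 / 2

namespace FastRegime
variable {β r e g : ℝ} (H : FastRegime β r e g)
include H

theorem e_pos : 0 < e := by have := H.β_pos; have := H.le_e; linarith
theorem r_nonneg : 0 ≤ r := by
  have := H.β_pos; have := H.β_le; have := H.r_eq
  by_contra h; push Not at h; nlinarith
theorem le_one_sub_r : β ≤ 1 - r := by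
  have := H.β_pos; have := H.β_le; have := H.r_eq; have := H.r_nonneg; nlinarith
theorem one_sub_r_le : 1 - r ≤ 2 * β := by
  have := H.β_pos; have := H.β_le; have := H.r_eq; have := H.r_nonneg; nlinarith
theorem g_le : g ≤ e := (abs_le.mp H.abs_g_le).2
theorem neg_e_le : -e ≤ g := (abs_le.mp H.abs_g_le).1
theorem h_nonneg : 0 ≤ e - r * g := by
  have := H.r_nonneg; have := H.le_one_sub_r; have := H.β_pos; have := H.g_le; have := H.e_pos
  nlinarith
theorem half_le_trace : 1 / 2 ≤ modeTrace r e g := by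
  have := H.h_le; have := H.r_nonneg; simp only [modeTrace]; linarith
theorem trace_le : modeTrace r e g ≤ 2 := by
  have := H.h_nonneg; have := H.le_one_sub_r; have := H.β_pos; simp only [modeTrace]; linarith
theorem le_one_sub_det : (β + (e - g)) / 3 ≤ 1 - modeDet r e g := by
  have := H.g_le; have := H.x_le; have h1 := H.β_pos; have := H.β_le
  have h3 : (1 - modeDet r e g) * (1 + β) = 2 * β + (1 - β) * (e - g) := by
    simp only [modeDet]; linear_combination (-(1 - e + g)) * H.r_eq
  have h4 : (β + (e - g)) / 3 * (1 + β) ≤ (1 - modeDet r e g) * (1 + β) := by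
    rw [h3]; nlinarith
  exact le_of_mul_le_mul_right h4 (by linarith)
theorem det_nonneg : 0 ≤ modeDet r e g :=
  mul_nonneg H.r_nonneg (by have := H.x_le; linarith)
theorem β_add_x_pos : 0 < β + (e - g) := by have := H.β_pos; have := H.g_le; linarith
theorem le_denom : (β + (e - g)) / 3 ≤
    (1 - modeDet r e g) * (1 + modeDet r e g + modeTrace r e g) := by
  have h1 := H.le_one_sub_det; have := H.det_nonneg; have := H.half_le_trace
  have := H.β_add_x_pos
  nlinarith

theorem arEnergy_nonneg (n₀ n₁ : ℝ) : 0 ≤ arEnergy r e g n₀ n₁ := by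
  have h1 := H.le_denom; have h2 := H.β_add_x_pos; have h3 := H.half_le_trace
  have h4 := H.e_pos; have h5 := H.le_one_sub_r; have h6 := H.β_pos
  have : 0 < e * (1 - r) := mul_pos h4 (by linarith)
  refine div_nonneg ?_ (by linarith)
  have : 0 ≤ modeTrace r e g := by linarith
  positivity

theorem arEnergy_le {n₀ n₁ X : ℝ}
    (h : n₀ ^ 2 + n₁ ^ 2 + 2 * (n₀ + n₁) ^ 2 / (e * β) ≤ X) :
    arEnergy r e g n₀ n₁ ≤ 3 * X / (β + (e - g)) := by
  have h1 := H.le_denom; have h2 := H.β_add_x_pos; have h3 := H.half_le_trace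
  have h4 := H.e_pos; have h5 := H.le_one_sub_r; have h6 := H.β_pos; have h7 := H.trace_le
  have h8 : n₀ ^ 2 + n₁ ^ 2 + modeTrace r e g * (n₀ + n₁) ^ 2 / (e * (1 - r)) ≤ X := by
    refine le_trans ?_ h
    gcongr
  have hX : 0 ≤ X := le_trans (by positivity) h
  calc arEnergy r e g n₀ n₁ ≤ X / ((β + (e - g)) / 3) := by
        rw [arEnergy]; gcongr
    _ = 3 * X / (β + (e - g)) := by field_simp

theorem fastPotential_nonneg (s : ℝ × ℝ) : 0 ≤ fastPotential β r e g s := by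
  have := H.e_pos; have := H.β_pos
  exact add_nonneg (H.arEnergy_nonneg _ _) (mul_nonneg (by positivity) (H.arEnergy_nonneg _ _))

/-- The potential telescopes the energies along the trajectory. -/
theorem fastPotential_modeStep (s : ℝ × ℝ) :
    fastPotential β r e g (modeStep r e g s) = fastPotential β r e g s - fastEnergy β e s := by
  obtain ⟨q, p⟩ := s
  have h1 := H.le_denom; have h2 := H.β_add_x_pos; have h3 := H.half_le_trace
  have h4 := H.e_pos; have h5 := H.le_one_sub_r; have h6 := H.β_pos; have h7 := H.le_one_sub_det
  have h8 := H.det_nonneg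
  have hr : 1 - r ≠ 0 := by linarith
  have hD : 1 - modeDet r e g ≠ 0 := by linarith
  have hS : 1 + modeDet r e g + modeTrace r e g ≠ 0 := by linarith
  have e1 := arEnergy_sub_shift h4.ne' hr hD hS (q - p) ((1 - r) * q - (q - p))
  have e2 := arEnergy_sub_shift h4.ne' hr hD hS q (q - e * (q - p) - modeTrace r e g * q)
  simp only [fastPotential, modeStep, fastEnergy]
  rw [show q - e * (q - p) - r * (p - g * (q - p)) =
      (1 - r) * q - (q - p) + modeTrace r e g * (q - p) by simp only [modeTrace]; ring,
    show (1 - r) * (q - e * (q - p)) - ((1 - r) * q - (q - p) + modeTrace r e g * (q - p)) =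
      -modeDet r e g * (q - p) by simp only [modeTrace, modeDet]; ring, e1,
    show q - e * (q - p) - e * ((1 - r) * q - (q - p) + modeTrace r e g * (q - p)) -
      modeTrace r e g * (q - e * (q - p)) = -modeDet r e g * q by
        simp only [modeTrace, modeDet]; ring]
  rw [show q - e * (q - p) - modeTrace r e g * q + modeTrace r e g * q = q - e * (q - p) by ring]
    at e2
  rw [e2]; ring

theorem β_div_e_le : β / e ≤ 16 := by
  have := H.e_pos; have := H.le_e
  rw [div_le_iff₀ H.e_pos]; linarith

theorem β_sq_le : β ^ 2 ≤ 1 / 2 * (β / e) := by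
  have h1 := H.e_pos; have h2 := H.β_mul_e_le; have h3 := H.β_pos
  rw [mul_div_assoc', le_div_iff₀ h1]; nlinarith

theorem h_sq_le : (e - r * g) ^ 2 ≤ 2 * (e - g) ^ 2 + 8 * (β * e) ^ 2 := by
  have h1 := H.h_nonneg; have h2 := H.one_sub_r_le; have h3 := H.g_le; have h4 := H.neg_e_le
  have h5 := H.le_one_sub_r; have h6 := H.β_pos; have h7 := H.e_pos
  have h8 : e - r * g ≤ (e - g) + 2 * (β * e) := by
    nlinarith [mul_le_mul_of_nonneg_right h2 (by linarith : 0 ≤ e + g)]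
  have : (e - r * g) ^ 2 ≤ ((e - g) + 2 * (β * e)) ^ 2 := by gcongr
  nlinarith [sq_nonneg ((e - g) - 2 * (β * e))]

theorem one_sub_r_sq_le : (1 - r) ^ 2 ≤ 4 * β ^ 2 := by
  have h2 := H.one_sub_r_le; have h5 := H.le_one_sub_r; have h6 := H.β_pos
  nlinarith

set_option maxHeartbeats 800000 in
theorem fastPotential_le (s : ℝ × ℝ) :
    fastPotential β r e g s ≤ 5000 / β * fastEnergy β e s := by
  obtain ⟨q, p⟩ := s
  have he := H.e_pos; have hβ := H.β_pos; have hx := H.β_add_x_pos; have hb2 := H.β_sq_le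
  have hr2 := H.one_sub_r_sq_le; have hβe := H.β_mul_e_le; have hβd := H.β_div_e_le
  have hh := H.h_sq_le; have hg1 := H.g_le; have hg2 := H.neg_e_le
  simp only [fastPotential, fastEnergy]
  generalize hu : q - p = u
  set k := β / e with hk
  have hk0 : 0 < k := div_pos hβ he
  have hke : k * e = β := by rw [hk]; field_simp
  set N := u ^ 2 + k * q ^ 2 with hN
  have hkq : 0 ≤ k * q ^ 2 := by positivity
  have hN0 : 0 ≤ N := by positivity
  have hkN : k * q ^ 2 ≤ N := by nlinarith [sq_nonneg u]
  have huN : u ^ 2 ≤ N := by linarith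
  have hr2q : (1 - r) ^ 2 * q ^ 2 ≤ 4 * β ^ 2 * q ^ 2 := by gcongr
  have hb2q : β ^ 2 * q ^ 2 ≤ 1 / 2 * (k * q ^ 2) := by
    rw [← mul_assoc]; gcongr
  have hβk : β ^ 2 / (e * β) = k := by rw [hk]; field_simp
  -- the `u` component
  have h1 : arEnergy r e g u ((1 - r) * q - u) ≤ 3 * (12 * N) / (β + (e - g)) := by
    apply H.arEnergy_le
    rw [show u + ((1 - r) * q - u) = (1 - r) * q by ring]
    have h2 : 2 * ((1 - r) * q) ^ 2 / (e * β) ≤ 8 * (k * q ^ 2) := by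
      calc 2 * ((1 - r) * q) ^ 2 / (e * β) ≤ 2 * (4 * β ^ 2 * q ^ 2) / (e * β) := by
            rw [mul_pow]; gcongr
        _ = 8 * (β ^ 2 / (e * β) * q ^ 2) := by ring
        _ = 8 * (k * q ^ 2) := by rw [hβk]
    have h3 : ((1 - r) * q - u) ^ 2 ≤ 2 * ((1 - r) ^ 2 * q ^ 2) + 2 * u ^ 2 := by
      rw [← mul_pow]; linarith [sq_nonneg ((1 - r) * q + u)]
    linarith
  have h1' : 3 * (12 * N) / (β + (e - g)) ≤ 36 / β * N := by
    rw [div_mul_eq_mul_div, show 3 * (12 * N) = 36 * N by ring]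
    gcongr; linarith
  -- the `q` component
  set m := ((1 - r) + (e - r * g)) * q - e * u with hm
  have h4 : arEnergy r e g q (q - e * u - modeTrace r e g * q) ≤
      3 * (3 * q ^ 2 + 2 * m ^ 2 + 2 * m ^ 2 / (e * β)) / (β + (e - g)) := by
    apply H.arEnergy_le
    rw [show q + (q - e * u - modeTrace r e g * q) = m by simp only [modeTrace, hm]; ring,
      show q - e * u - modeTrace r e g * q = m - q by simp only [modeTrace, hm]; ring]
    nlinarith [sq_nonneg (m + q)]
  have h5 : m ^ 2 / e ^ 2 ≤ 204 * ((β + (e - g)) / β) * N := by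
    have h6 : m ^ 2 ≤ 3 * ((1 - r) ^ 2 * q ^ 2) + 3 * ((e - r * g) ^ 2 * q ^ 2) +
        3 * (e ^ 2 * u ^ 2) := by
      have h0 (A B C : ℝ) : (A + B - C) ^ 2 ≤ 3 * A ^ 2 + 3 * B ^ 2 + 3 * C ^ 2 := by
        nlinarith [sq_nonneg (A - B), sq_nonneg (A + C), sq_nonneg (B + C)]
      rw [hm, add_mul, ← mul_pow, ← mul_pow, ← mul_pow]
      exact h0 _ _ _
    have h7 : (e - r * g) ^ 2 * q ^ 2 ≤ (4 * e * (e - g) + 8 * (β * e) ^ 2) * q ^ 2 := by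
      have : (e - g) ^ 2 ≤ 2 * e * (e - g) := by
        rw [pow_two]; exact mul_le_mul_of_nonneg_right (by linarith) (by linarith)
      gcongr; linarith
    have h8 : m ^ 2 ≤ e ^ 2 * (12 * k ^ 2 * q ^ 2 + 12 * (e - g) / e * q ^ 2 + 24 * β ^ 2 * q ^ 2
        + 3 * u ^ 2) := by
      have : e ^ 2 * (12 * k ^ 2 * q ^ 2 + 12 * (e - g) / e * q ^ 2 + 24 * β ^ 2 * q ^ 2
        + 3 * u ^ 2) = 12 * (k * e) ^ 2 * q ^ 2 + 12 * e * (e - g) * q ^ 2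
          + 24 * (β * e) ^ 2 * q ^ 2 + 3 * (e ^ 2 * u ^ 2) := by field_simp
      rw [this, hke]; linarith
    have h9 : m ^ 2 / e ^ 2 ≤ 12 * k ^ 2 * q ^ 2 + 12 * (e - g) / e * q ^ 2 + 24 * β ^ 2 * q ^ 2
        + 3 * u ^ 2 := by
      rw [div_le_iff₀ (by positivity)]; linarith
    have h10 : k ^ 2 * q ^ 2 ≤ 16 * (k * q ^ 2) := by
      rw [pow_two k, mul_assoc]; gcongr
    have h11 : 12 * (e - g) / e * q ^ 2 = 12 * ((e - g) / β) * (k * q ^ 2) := by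
      rw [hk]; field_simp
    have h12 : (e - g) / β * (k * q ^ 2) ≤ (e - g) / β * N :=
      mul_le_mul_of_nonneg_left hkN (div_nonneg (by linarith) hβ.le)
    have h13 : (β + (e - g)) / β = 1 + (e - g) / β := by field_simp
    have h14 : 0 ≤ (e - g) / β * N := mul_nonneg (div_nonneg (by linarith) hβ.le) hN0
    rw [h13]; linarith
  have h15 : k * (3 * (3 * q ^ 2 + 2 * m ^ 2 + 2 * m ^ 2 / (e * β)) / (β + (e - g))) ≤
      1900 / β * N := by
    have h16 : k * (3 * q ^ 2 + 2 * m ^ 2 + 2 * m ^ 2 / (e * β)) ≤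
        3 * (k * q ^ 2) + 3 * (m ^ 2 / e ^ 2) := by
      have : k * (3 * q ^ 2 + 2 * m ^ 2 + 2 * m ^ 2 / (e * β)) =
        3 * (k * q ^ 2) + (2 * (β * e) + 2) * (m ^ 2 / e ^ 2) := by
        rw [hk]; field_simp; ring
      rw [this]
      have h0 : 0 ≤ m ^ 2 / e ^ 2 := by positivity
      have : (2 * (β * e) + 2) * (m ^ 2 / e ^ 2) ≤ 3 * (m ^ 2 / e ^ 2) := by gcongr; linarith
      linarith
    have h17 : 1 ≤ (β + (e - g)) / β := by rw [le_div_iff₀ hβ]; linarith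
    have h18 : k * (3 * q ^ 2 + 2 * m ^ 2 + 2 * m ^ 2 / (e * β)) ≤
        615 * ((β + (e - g)) / β) * N := by
      have := mul_le_mul_of_nonneg_right h17 hN0
      linarith
    calc k * (3 * (3 * q ^ 2 + 2 * m ^ 2 + 2 * m ^ 2 / (e * β)) / (β + (e - g)))
        = 3 * (k * (3 * q ^ 2 + 2 * m ^ 2 + 2 * m ^ 2 / (e * β))) / (β + (e - g)) := by ring
      _ ≤ 3 * (615 * ((β + (e - g)) / β) * N) / (β + (e - g)) := by gcongr
      _ = 1845 / β * N := by field_simp; ring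
      _ ≤ 1900 / β * N := by gcongr; norm_num
  have h19 := mul_le_mul_of_nonneg_left h4 hk0.le
  calc _ ≤ 36 / β * N + 1900 / β * N := by linarith
    _ = 1936 / β * N := by ring
    _ ≤ 5000 / β * N := by gcongr; norm_num

/-- The total energy that one unit of gradient noise ever contributes. Since it does not see the
slow contraction rate `β`, it can be summed over the modes. -/
theorem fastPotential_noise_le :
    fastPotential β r e g (e, r * g) ≤ 1000 * ((e - g) + β * e / (β + (e - g))) := by
  have he := H.e_pos; have hβ := H.β_pos; have hx := H.β_add_x_pos
  have hr2 := H.one_sub_r_sq_le; have hβe := H.β_mul_e_le; have hle := H.le_e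
  have hh := H.h_sq_le; have hg1 := H.g_le
  have hr0 := H.r_nonneg; have hr1 := H.le_one_sub_r
  simp only [fastPotential]
  have hβe0 : 0 < β * e := mul_pos hβ he
  have h0 : 2 * ((1 - r) * e) ^ 2 / (e * β) ≤ 8 * (β * e) := by
    rw [div_le_iff₀ (by positivity), mul_pow]; nlinarith
  have h1 : arEnergy r e g (e - r * g) ((1 - r) * e - (e - r * g)) ≤
      3 * (6 * (e - g) ^ 2 + 24 * (β * e)) / (β + (e - g)) := by
    apply H.arEnergy_le
    rw [show e - r * g + ((1 - r) * e - (e - r * g)) = (1 - r) * e by ring]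
    have h2 : ((1 - r) * e - (e - r * g)) ^ 2 ≤ 2 * ((1 - r) ^ 2 * e ^ 2) +
      2 * (e - r * g) ^ 2 := by nlinarith [sq_nonneg ((1 - r) * e + (e - r * g))]
    have h3 : (1 - r) ^ 2 * e ^ 2 ≤ 4 * β ^ 2 * e ^ 2 := by gcongr
    nlinarith
  have h4 : arEnergy r e g e (e - e * (e - r * g) - modeTrace r e g * e) ≤
      3 * (2 * e ^ 2 + 8 * (β * e)) / (β + (e - g)) := by
    apply H.arEnergy_le
    rw [show e + (e - e * (e - r * g) - modeTrace r e g * e) = (1 - r) * e by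
        simp only [modeTrace]; ring,
      show e - e * (e - r * g) - modeTrace r e g * e = - (r * e) by simp only [modeTrace]; ring]
    have : r ^ 2 * e ^ 2 ≤ 1 * e ^ 2 := by gcongr; nlinarith
    nlinarith
  have h5 : β / e * (3 * (2 * e ^ 2 + 8 * (β * e)) / (β + (e - g))) ≤
      390 * (β * e / (β + (e - g))) := by
    calc β / e * (3 * (2 * e ^ 2 + 8 * (β * e)) / (β + (e - g)))
        = (6 * (β * e) + 24 * (β * β)) / (β + (e - g)) := by field_simp; ring
      _ ≤ 390 * (β * e) / (β + (e - g)) := by gcongr; nlinarith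
      _ = _ := by rw [mul_div_assoc]
  have h6 : 3 * (6 * (e - g) ^ 2 + 24 * (β * e)) / (β + (e - g)) ≤
      18 * (e - g) + 72 * (β * e / (β + (e - g))) := by
    rw [div_le_iff₀ hx, add_mul, mul_assoc 72, div_mul_cancel₀ _ hx.ne']
    nlinarith
  have h7 := mul_le_mul_of_nonneg_left h4 (div_nonneg hβ.le he.le)
  have h8 : 0 ≤ β * e / (β + (e - g)) := by positivity
  linarith

/-- There is no transient growth: the energy stays bounded by a multiple, independent of `β`, of
its initial value. -/
theorem fastEnergy_iterate_le (s : ℝ × ℝ) (k : ℕ) :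
    fastEnergy β e ((modeStep r e g)^[k] s) ≤ 12 * fastEnergy β e s := by
  have he := H.e_pos; have hβ := H.β_pos
  have hr1 := H.le_one_sub_r; have hr2 := H.one_sub_r_le; have hτ := H.half_le_trace
  have hτ2 := H.trace_le; have hβe := H.β_mul_e_le
  have hdet := H.le_one_sub_det; have hx := H.β_add_x_pos
  -- the form `(1 + Δ - τ) (q₁² + q²) + τ (q₁ - q)²` in consecutive values of `q`, divided by `e²`;
  -- one step lowers it by `(1 - Δ) (q₂ - q)² / e²`
  set B : ℝ × ℝ → ℝ := fun s =>
    (1 - r) / e * ((modeStep r e g s).1 ^ 2 + s.1 ^ 2) + modeTrace r e g * (s.1 - s.2) ^ 2 with hB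
  have hmono : ∀ s, B (modeStep r e g s) ≤ B s := by
    intro s
    have : B (modeStep r e g s) = B s - (1 - modeDet r e g) *
        (((modeStep r e g s).1 - (modeStep r e g s).2) + (s.1 - s.2)) ^ 2 := by
      simp only [hB, modeStep, modeTrace, modeDet]
      field_simp
      ring
    rw [this]
    have : 0 ≤ (1 - modeDet r e g) *
        (((modeStep r e g s).1 - (modeStep r e g s).2) + (s.1 - s.2)) ^ 2 :=
      mul_nonneg (by linarith) (sq_nonneg _)
    linarith
  have hiter : B ((modeStep r e g)^[k] s) ≤ B s := by
    induction k with
    | zero => simp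
    | succ k ih => rw [Function.iterate_succ_apply']; exact (hmono _).trans ih
  have hlow : ∀ s, fastEnergy β e s ≤ 2 * B s := by
    rintro ⟨q, p⟩
    simp only [hB, fastEnergy]
    have h1 : β / e * q ^ 2 ≤ (1 - r) / e * ((modeStep r e g (q, p)).1 ^ 2 + q ^ 2) := by
      have : β / e ≤ (1 - r) / e := by gcongr
      have h0 : 0 ≤ β / e := by positivity
      exact mul_le_mul this (by nlinarith [sq_nonneg (modeStep r e g (q, p)).1]) (sq_nonneg _)
        (by linarith)
    have h2 : 1 / 2 * (q - p) ^ 2 ≤ modeTrace r e g * (q - p) ^ 2 := by gcongr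
    have h0 : 0 ≤ β / e * q ^ 2 := by positivity
    linarith
  have hup : B s ≤ 6 * fastEnergy β e s := by
    obtain ⟨q, p⟩ := s
    simp only [hB, fastEnergy, modeStep]
    generalize q - p = u
    have h1 : (1 - r) / e * ((q - e * u) ^ 2 + q ^ 2) ≤
        2 * β / e * (3 * q ^ 2 + 2 * e ^ 2 * u ^ 2) := by
      apply mul_le_mul (by gcongr) (by nlinarith [sq_nonneg (q + e * u)]) (by positivity)
        (by positivity)
    have h2 : 2 * β / e * (3 * q ^ 2 + 2 * e ^ 2 * u ^ 2) =
        6 * (β / e * q ^ 2) + 4 * (β * e) * u ^ 2 := by field_simp; ring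
    have h3 : modeTrace r e g * u ^ 2 ≤ 2 * u ^ 2 := by gcongr
    have h4 : β * e * u ^ 2 ≤ 1 / 2 * u ^ 2 := by gcongr
    have h0 : 0 ≤ β / e * q ^ 2 := by positivity
    nlinarith [sq_nonneg u]
  linarith [hlow ((modeStep r e g)^[k] s)]

theorem fastEnergy_nonneg (s : ℝ × ℝ) : 0 ≤ fastEnergy β e s := by
  have he := H.e_pos; have hβ := H.β_pos
  simp only [fastEnergy]; positivity

theorem fastEnergy_le_fastPotential (s : ℝ × ℝ) :
    fastEnergy β e s ≤ fastPotential β r e g s := by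
  have h1 := H.fastPotential_modeStep s
  have h2 := H.fastPotential_nonneg (modeStep r e g s)
  linarith

theorem sum_fastEnergy_iterate_le (s : ℝ × ℝ) (k : ℕ) :
    ∑ j ∈ Finset.range k, fastEnergy β e ((modeStep r e g)^[j] s) ≤ fastPotential β r e g s := by
  have : ∑ j ∈ Finset.range k, fastEnergy β e ((modeStep r e g)^[j] s) =
      fastPotential β r e g s - fastPotential β r e g ((modeStep r e g)^[k] s) := by
    induction k with
    | zero => simp
    | succ k ih =>
      rw [Finset.sum_range_succ, ih, Function.iterate_succ_apply', H.fastPotential_modeStep]; ring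
  rw [this]
  linarith [H.fastPotential_nonneg ((modeStep r e g)^[k] s)]

/-- The energy contracts at rate `β`. -/
theorem fastEnergy_iterate_le_pow (s : ℝ × ℝ) (k : ℕ) :
    fastEnergy β e ((modeStep r e g)^[k] s) ≤
      (1 - β / 5000) ^ k * (5000 / β) * fastEnergy β e s := by
  have hβ := H.β_pos; have hβ1 := H.β_le
  have hstep : ∀ s, fastPotential β r e g (modeStep r e g s) ≤
      (1 - β / 5000) * fastPotential β r e g s := by
    intro s
    have h1 := H.fastPotential_le s
    have h2 : β / 5000 * fastPotential β r e g s ≤ fastEnergy β e s := by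
      calc β / 5000 * fastPotential β r e g s ≤ β / 5000 * (5000 / β * fastEnergy β e s) := by
            gcongr
        _ = fastEnergy β e s := by field_simp
    rw [H.fastPotential_modeStep]; linarith
  have h0 : 0 ≤ 1 - β / 5000 := by linarith
  have hiter : fastPotential β r e g ((modeStep r e g)^[k] s) ≤
      (1 - β / 5000) ^ k * fastPotential β r e g s := by
    induction k with
    | zero => simp
    | succ k ih =>
      rw [Function.iterate_succ_apply', pow_succ']
      calc _ ≤ _ := hstep _
        _ ≤ (1 - β / 5000) * ((1 - β / 5000) ^ k * fastPotential β r e g s) := by gcongr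
        _ = _ := by ring
  calc _ ≤ _ := H.fastEnergy_le_fastPotential _
    _ ≤ _ := hiter
    _ ≤ (1 - β / 5000) ^ k * (5000 / β * fastEnergy β e s) := by
        gcongr; exact H.fastPotential_le s
    _ = _ := by ring

end FastRegime

/-! ### Second moments of a single mode -/

/-- The expectation of a quadratic form `Q` of the state of a mode at time `t`, as a function of
`Q`: the initial state is `(1, 0)` with second moment `m₀`, and step `t` applies `modeStep` with
parameters `e t`, `g t` and adds centred noise of variance `n t` in the direction `(e t, r g t)`.
Working with the functional avoids the covariance matrix of the state. -/
def modeMoment (r : ℝ) (e g n : ℕ → ℝ) (m₀ : ℝ) : ℕ → (ℝ × ℝ → ℝ) → ℝ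
  | 0, Q => m₀ * Q (1, 0)
  | t + 1, Q => modeMoment r e g n m₀ t (fun s => Q (modeStep r (e t) (g t) s)) +
      n t * Q (e t, r * g t)

section
variable {r : ℝ} {e g n : ℕ → ℝ} {m₀ : ℝ}

theorem modeMoment_mono (hm : 0 ≤ m₀) (hn : ∀ t, 0 ≤ n t) (t : ℕ) {Q Q' : ℝ × ℝ → ℝ}
    (h : ∀ s, Q s ≤ Q' s) : modeMoment r e g n m₀ t Q ≤ modeMoment r e g n m₀ t Q' := by
  induction t generalizing Q Q' with
  | zero => exact mul_le_mul_of_nonneg_left (h _) hm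
  | succ t ih => exact add_le_add (ih fun s => h _) (mul_le_mul_of_nonneg_left (h _) (hn t))

theorem modeMoment_const_mul (t : ℕ) (c : ℝ) (Q : ℝ × ℝ → ℝ) :
    modeMoment r e g n m₀ t (fun s => c * Q s) = c * modeMoment r e g n m₀ t Q := by
  induction t generalizing Q with
  | zero => simp only [modeMoment]; ring
  | succ t ih => simp only [modeMoment]; rw [ih]; ring

theorem modeMoment_nonneg (hm : 0 ≤ m₀) (hn : ∀ t, 0 ≤ n t) (t : ℕ) {Q : ℝ × ℝ → ℝ}
    (h : ∀ s, 0 ≤ Q s) : 0 ≤ modeMoment r e g n m₀ t Q := by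
  have h1 := modeMoment_mono (r := r) (e := e) (g := g) hm hn t (Q := fun s => 0 * Q s)
    (by simpa using h)
  rwa [modeMoment_const_mul, zero_mul] at h1

theorem modeMoment_le_mul (hm : 0 ≤ m₀) (hn : ∀ t, 0 ≤ n t) (t : ℕ) {Q Q' : ℝ × ℝ → ℝ} {c : ℝ}
    (h : ∀ s, Q s ≤ c * Q' s) :
    modeMoment r e g n m₀ t Q ≤ c * modeMoment r e g n m₀ t Q' := by
  rw [← modeMoment_const_mul]; exact modeMoment_mono hm hn t h

/-- The moment at time `t` depends on the noise before `t` only, which makes strong induction on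
time possible. -/
theorem modeMoment_congr {n' : ℕ → ℝ} (t : ℕ) (h : ∀ s < t, n s = n' s) (Q : ℝ × ℝ → ℝ) :
    modeMoment r e g n m₀ t Q = modeMoment r e g n' m₀ t Q := by
  induction t generalizing Q with
  | zero => rfl
  | succ t ih =>
    simp only [modeMoment]
    rw [ih (fun s hs => h s (hs.trans t.lt_succ_self)), h t t.lt_succ_self]

/-- Duhamel's formula over `k` steps with constant parameters. -/
theorem modeMoment_add_le {E G nbar : ℝ} (hn' : ∀ t, n t ≤ nbar)
    (t k : ℕ) (hE : ∀ j < k, e (t + j) = E) (hG : ∀ j < k, g (t + j) = G)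
    {Q : ℝ × ℝ → ℝ} (hQ : ∀ s, 0 ≤ Q s) :
    modeMoment r e g n m₀ (t + k) Q ≤
      modeMoment r e g n m₀ t (fun s => Q ((modeStep r E G)^[k] s)) +
        nbar * ∑ j ∈ Finset.range k, Q ((modeStep r E G)^[j] (E, r * G)) := by
  induction k generalizing Q with
  | zero => simp
  | succ k ih =>
    rw [← add_assoc, modeMoment, hE k k.lt_succ_self, hG k k.lt_succ_self]
    have h1 := ih (fun j hj => hE j (hj.trans k.lt_succ_self))
      (fun j hj => hG j (hj.trans k.lt_succ_self)) (Q := fun s => Q (modeStep r E G s))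
      (fun s => hQ _)
    rw [Finset.sum_range_succ']
    simp only [Function.iterate_succ_apply', Function.iterate_zero, id_eq]
    have h2 : n (t + k) * Q (E, r * G) ≤ nbar * Q (E, r * G) :=
      mul_le_mul_of_nonneg_right (hn' _) (hQ _)
    linarith

end

/-- A mode with initial parameters `e₀`, `g₀`, which are divided by `4` after each phase of length
`K`, and with noise of variance at most `nbar`. -/
structure ModeSetup (β r e₀ g₀ : ℝ) (K : ℕ) (n : ℕ → ℝ) (m₀ nbar : ℝ) : Prop where
  β_pos : 0 < β
  β_le : β ≤ 1
  r_eq : r * (1 + β) = 1 - β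
  e_pos : 0 < e₀
  abs_g_le : |g₀| ≤ e₀
  β_mul_e_le : β * e₀ ≤ 1 / 2
  x_le : e₀ - g₀ ≤ 1 / 2
  h_le : e₀ - r * g₀ ≤ 1 / 2
  K_pos : 0 < K
  m_nonneg : 0 ≤ m₀
  n_nonneg : ∀ t, 0 ≤ n t
  n_le : ∀ t, n t ≤ nbar

/-- The parameter in force at the step from time `t` to `t + 1`, which uses the stepsize with index
`t + 1`. Phase `l` thus starts from the state at time `l K - 1`, or `0` for `l = 0`. -/
def phased (K : ℕ) (e₀ : ℝ) (t : ℕ) : ℝ := e₀ / 4 ^ ((t + 1) / K)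

/-- The moments of a mode under the piecewise constant schedule. -/
def scheduledMoment (r e₀ g₀ : ℝ) (K : ℕ) (n : ℕ → ℝ) (m₀ : ℝ) : ℕ → (ℝ × ℝ → ℝ) → ℝ :=
  modeMoment r (phased K e₀) (phased K g₀) n m₀

/-- The square of the midpoint error `u = q - p`. -/
def midpointSq (s : ℝ × ℝ) : ℝ := (s.1 - s.2) ^ 2

/-- The variance of the midpoint error which stationary gradient noise of unit variance sustains, up
to a constant: `e - g = δ λ` is the share of plain SGD, the other term that of the momentum. -/
def gain (β e g : ℝ) : ℝ := (e - g) + β * e / (β + (e - g))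

theorem div_four_pow_le {x : ℝ} (hx : 0 ≤ x) (l : ℕ) : x / 4 ^ l ≤ x :=
  div_le_self hx (one_le_pow₀ (by norm_num))

theorem div_four_pow_anti {x : ℝ} (hx : 0 ≤ x) {k l : ℕ} (h : k ≤ l) : x / 4 ^ l ≤ x / 4 ^ k :=
  div_le_div_of_nonneg_left hx (by positivity) (pow_le_pow_right₀ (by norm_num) h)

namespace ModeSetup
variable {β r e₀ g₀ : ℝ} {K : ℕ} {n : ℕ → ℝ} {m₀ nbar : ℝ}
  (H : ModeSetup β r e₀ g₀ K n m₀ nbar)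
include H

theorem r_nonneg : 0 ≤ r := by
  have := H.β_pos; have := H.β_le; have := H.r_eq
  by_contra h; push Not at h; nlinarith
theorem r_le : r ≤ 1 - β := by
  have := H.β_pos; have := H.β_le; have := H.r_eq; have := H.r_nonneg; nlinarith
theorem x_nonneg : 0 ≤ e₀ - g₀ := by have := (abs_le.mp H.abs_g_le).2; linarith
theorem h_nonneg : 0 ≤ e₀ - r * g₀ := by
  have := H.r_nonneg; have := H.r_le; have := H.β_pos; have := (abs_le.mp H.abs_g_le).2
  have := H.e_pos
  nlinarith
theorem nbar_nonneg : 0 ≤ nbar := (H.n_nonneg 0).trans (H.n_le 0)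
theorem abs_g_div_le (l : ℕ) : |g₀ / 4 ^ l| ≤ e₀ / 4 ^ l := by
  rw [abs_div, abs_of_pos (by positivity : (0:ℝ) < 4 ^ l)]
  have := H.abs_g_le
  gcongr

theorem gain_nonneg : 0 ≤ gain β e₀ g₀ := by
  have := H.x_nonneg; have := H.β_pos; have := H.e_pos
  unfold gain; positivity

theorem gain_div_le (l : ℕ) : gain β (e₀ / 4 ^ l) (g₀ / 4 ^ l) ≤ gain β e₀ g₀ := by
  have hx := H.x_nonneg; have hβ := H.β_pos; have he := H.e_pos
  unfold gain
  rw [← sub_div]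
  have h4 : (1:ℝ) ≤ 4 ^ l := one_le_pow₀ (by norm_num)
  apply add_le_add (div_four_pow_le hx l)
  have h1 : β * (e₀ / 4 ^ l) / (β + (e₀ - g₀) / 4 ^ l) = β * e₀ / (β * 4 ^ l + (e₀ - g₀)) := by
    field_simp
  rw [h1]
  gcongr
  nlinarith

theorem fastRegime {l : ℕ} (h : β / 16 ≤ e₀ / 4 ^ l) :
    FastRegime β r (e₀ / 4 ^ l) (g₀ / 4 ^ l) where
  β_pos := H.β_pos
  β_le := H.β_le
  r_eq := H.r_eq
  abs_g_le := H.abs_g_div_le l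
  le_e := h
  β_mul_e_le := by
    have := H.β_mul_e_le
    have := mul_le_mul_of_nonneg_left (div_four_pow_le H.e_pos.le l) H.β_pos.le
    linarith
  x_le := by
    have := H.x_le
    rw [← sub_div]
    linarith [div_four_pow_le H.x_nonneg l]
  h_le := by
    have := H.h_le
    rw [← mul_div_assoc, ← sub_div]
    linarith [div_four_pow_le H.h_nonneg l]

/-- Within a phase with `e ≥ β / 16`, the energy that is present contracts, and noise contributes
at most the potential of one noise vector. -/
theorem moment_fast_le {l : ℕ} (h : β / 16 ≤ e₀ / 4 ^ l) (t k : ℕ)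
    (hph : ∀ j < k, (t + j + 1) / K = l) :
    scheduledMoment r e₀ g₀ K n m₀ (t + k) (fastEnergy β (e₀ / 4 ^ l)) ≤
      min 12 ((1 - β / 5000) ^ k * (5000 / β)) *
        scheduledMoment r e₀ g₀ K n m₀ t (fastEnergy β (e₀ / 4 ^ l)) +
      1000 * gain β e₀ g₀ * nbar := by
  have F := H.fastRegime h
  have h1 := modeMoment_add_le (r := r) (e := phased K e₀) (g := phased K g₀) (m₀ := m₀)
    (E := e₀ / 4 ^ l) (G := g₀ / 4 ^ l) H.n_le t k
    (fun j hj => by rw [phased, hph j hj]) (fun j hj => by rw [phased, hph j hj])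
    (Q := fastEnergy β (e₀ / 4 ^ l)) F.fastEnergy_nonneg
  refine h1.trans (add_le_add ?_ ?_)
  · rcases min_cases (12 : ℝ) ((1 - β / 5000) ^ k * (5000 / β)) with ⟨h2, -⟩ | ⟨h2, -⟩
    · rw [h2]
      exact modeMoment_le_mul H.m_nonneg H.n_nonneg t fun s => F.fastEnergy_iterate_le s k
    · rw [h2]
      exact modeMoment_le_mul H.m_nonneg H.n_nonneg t fun s => F.fastEnergy_iterate_le_pow s k
  · rw [mul_comm nbar]
    refine mul_le_mul_of_nonneg_right ?_ H.nbar_nonneg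
    calc _ ≤ _ := F.sum_fastEnergy_iterate_le _ _
      _ ≤ _ := F.fastPotential_noise_le
      _ ≤ 1000 * gain β e₀ g₀ := by
        have := H.gain_div_le l
        unfold gain at *; linarith

theorem moment_succ_slow_le {t : ℕ} (h : phased K e₀ t ≤ β / 16) :
    scheduledMoment r e₀ g₀ K n m₀ (t + 1) slowEnergy ≤
      (1 - phased K e₀ t / 2) * scheduledMoment r e₀ g₀ K n m₀ t slowEnergy +
        2 * phased K e₀ t ^ 2 * nbar := by
  have hr1 : r ≤ 1 := by have := H.r_le; have := H.β_pos; linarith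
  rw [scheduledMoment, modeMoment]
  apply add_le_add
  · exact modeMoment_le_mul H.m_nonneg H.n_nonneg t fun s =>
      slowEnergy_modeStep_le H.β_pos H.β_le H.r_nonneg H.r_le (H.abs_g_div_le _) h s
  · have h1 := slowEnergy_noise_le H.r_nonneg hr1 (H.abs_g_div_le ((t + 1) / K))
    have h2 : 0 ≤ slowEnergy (phased K e₀ t, r * phased K g₀ t) := by
      unfold slowEnergy; positivity
    rw [mul_comm (2 * _)]
    exact mul_le_mul (H.n_le t) h1 h2 H.nbar_nonneg

theorem moment_slow_nonneg (t : ℕ) : 0 ≤ scheduledMoment r e₀ g₀ K n m₀ t slowEnergy :=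
  modeMoment_nonneg H.m_nonneg H.n_nonneg t fun s => by unfold slowEnergy; positivity

theorem phased_nonneg (t : ℕ) : 0 ≤ phased K e₀ t := by
  have := H.e_pos; unfold phased; positivity

theorem phased_anti {s t : ℕ} (h : s ≤ t) : phased K e₀ t ≤ phased K e₀ s :=
  div_four_pow_anti H.e_pos.le (Nat.div_le_div_right (by omega))

/-- The noise of all later phases together is at most of the order of the first stepsize, because
contraction balances it. -/
theorem moment_slow_le {t₀ t : ℕ} (h : phased K e₀ t₀ ≤ β / 16) (ht : t₀ ≤ t) :
    scheduledMoment r e₀ g₀ K n m₀ t slowEnergy ≤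
      scheduledMoment r e₀ g₀ K n m₀ t₀ slowEnergy + 4 * phased K e₀ t₀ * nbar := by
  induction t, ht using Nat.le_induction with
  | base =>
    have := H.phased_nonneg t₀; have := H.nbar_nonneg
    have : 0 ≤ 4 * phased K e₀ t₀ * nbar := by positivity
    linarith
  | succ t ht ih =>
    have h1 := H.phased_anti ht
    have h2 := H.moment_succ_slow_le (h1.trans h)
    have h3 := H.phased_nonneg t
    have h4 := H.nbar_nonneg
    have h5 := H.moment_slow_nonneg t₀
    have h6 := H.β_le
    have h7 : (1 - phased K e₀ t / 2) * scheduledMoment r e₀ g₀ K n m₀ t slowEnergy ≤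
      (1 - phased K e₀ t / 2) * (scheduledMoment r e₀ g₀ K n m₀ t₀ slowEnergy +
        4 * phased K e₀ t₀ * nbar) := mul_le_mul_of_nonneg_left ih (by linarith)
    have h8 := mul_nonneg h3 h5
    have h9 : phased K e₀ t ^ 2 * nbar ≤ phased K e₀ t * phased K e₀ t₀ * nbar := by
      rw [pow_two]; gcongr
    linarith

/-- For very small `e₀` the noise is simply added up. -/
theorem moment_slow_le_add (h : e₀ ≤ β / 16) (t : ℕ) :
    scheduledMoment r e₀ g₀ K n m₀ t slowEnergy ≤ m₀ + 2 * t * e₀ ^ 2 * nbar := by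
  induction t with
  | zero => simp [scheduledMoment, modeMoment, slowEnergy]
  | succ t ih =>
    have h0 : phased K e₀ t ≤ e₀ := div_four_pow_le H.e_pos.le _
    have h2 := H.moment_succ_slow_le (h0.trans h)
    have h3 := H.phased_nonneg t
    have h4 := H.nbar_nonneg
    have h5 := H.moment_slow_nonneg t
    have h8 := mul_nonneg h3 h5
    have h9 : phased K e₀ t ^ 2 * nbar ≤ e₀ ^ 2 * nbar := by gcongr
    push_cast
    linarith

theorem moment_slow_contract {l : ℕ} (h : e₀ / 4 ^ l ≤ β / 16) (t k : ℕ)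
    (hph : ∀ j < k, (t + j + 1) / K = l) :
    scheduledMoment r e₀ g₀ K n m₀ (t + k) slowEnergy ≤
      (1 - e₀ / 4 ^ l / 2) ^ k * scheduledMoment r e₀ g₀ K n m₀ t slowEnergy +
        4 * (e₀ / 4 ^ l) * nbar := by
  have he : 0 ≤ e₀ / 4 ^ l := by have := H.e_pos; positivity
  have hn := H.nbar_nonneg
  induction k with
  | zero => simp; positivity
  | succ k ih =>
    have h0 : phased K e₀ (t + k) = e₀ / 4 ^ l := by rw [phased, hph k k.lt_succ_self]
    have h2 := H.moment_succ_slow_le (t := t + k) (by rw [h0]; exact h)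
    rw [h0] at h2
    have h3 := ih fun j hj => hph j (hj.trans k.lt_succ_self)
    have h6 := H.β_le
    have h4 := mul_le_mul_of_nonneg_left h3 (by linarith : 0 ≤ 1 - e₀ / 4 ^ l / 2)
    rw [← add_assoc, pow_succ']
    linarith

end ModeSetup

theorem phase_start_add {K l k j : ℕ} (hK : 0 < K) (hk : l * K - 1 + k ≤ (l + 1) * K - 1)
    (hj : j < k) : (l * K - 1 + j + 1) / K = l := by
  rw [Nat.div_eq_iff hK]
  have : (l + 1) * K = l * K + K := by ring
  rcases Nat.eq_zero_or_pos (l * K) with h | h <;> constructor <;> omega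

namespace ModeSetup
variable {β r e₀ g₀ : ℝ} {K : ℕ} {n : ℕ → ℝ} {m₀ nbar : ℝ}
  (H : ModeSetup β r e₀ g₀ K n m₀ nbar)
  (hc : e₀ ≤ β / 16 ∨ (1 - β / 5000) ^ (K - 1) * (5000 / β) ≤ 1 / 8)
include H hc

/-- The energy at the start and at the end of a phase with `e > β / 16` stays bounded, although its
weight `β / e` grows by the factor `4` from one phase to the next: each phase contracts by more. -/
theorem fast_phase_start_le (l : ℕ) :
    (β / 16 < e₀ / 4 ^ l → scheduledMoment r e₀ g₀ K n m₀ (l * K - 1)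
      (fastEnergy β (e₀ / 4 ^ l)) ≤ 17 * m₀ + 8000 * gain β e₀ g₀ * nbar) ∧
    (β / 16 < e₀ / 4 ^ l → scheduledMoment r e₀ g₀ K n m₀ ((l + 1) * K - 1)
      (fastEnergy β (e₀ / 4 ^ (l + 1))) ≤ 17 * m₀ + 8000 * gain β e₀ g₀ * nbar) := by
  have hm := H.m_nonneg; have hn := H.nbar_nonneg; have hκ := H.gain_nonneg; have hβ := H.β_pos
  have he := H.e_pos; have hβ1 := H.β_le
  have hκn : 0 ≤ gain β e₀ g₀ * nbar := mul_nonneg hκ hn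
  have step : ∀ l, β / 16 < e₀ / 4 ^ l → scheduledMoment r e₀ g₀ K n m₀ (l * K - 1)
      (fastEnergy β (e₀ / 4 ^ l)) ≤ 17 * m₀ + 8000 * gain β e₀ g₀ * nbar →
      scheduledMoment r e₀ g₀ K n m₀ ((l + 1) * K - 1)
      (fastEnergy β (e₀ / 4 ^ (l + 1))) ≤ 17 * m₀ + 8000 * gain β e₀ g₀ * nbar := by
    intro l hl ih
    have F := H.fastRegime hl.le
    have hc' : (1 - β / 5000) ^ (K - 1) * (5000 / β) ≤ 1 / 8 := by
      refine hc.resolve_left fun h => ?_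
      have := div_four_pow_le he.le l
      linarith
    obtain ⟨k, hk, hkK⟩ : ∃ k, l * K - 1 + k = (l + 1) * K - 1 ∧ K - 1 ≤ k := by
      refine ⟨(l + 1) * K - 1 - (l * K - 1), ?_, ?_⟩ <;>
      · have : (l + 1) * K = l * K + K := by ring
        omega
    have h1 := H.moment_fast_le hl.le (l * K - 1) k
      (fun j hj => phase_start_add H.K_pos hk.le hj)
    rw [hk] at h1
    have h2 : (1 - β / 5000) ^ k * (5000 / β) ≤ 1 / 8 := by
      refine le_trans ?_ hc'
      gcongr ?_ * _
      exact pow_le_pow_of_le_one (by linarith) (by linarith) hkK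
    have h3 : min 12 ((1 - β / 5000) ^ k * (5000 / β)) ≤ 1 / 8 := (min_le_right _ _).trans h2
    have h4 : 0 ≤ scheduledMoment r e₀ g₀ K n m₀ (l * K - 1) (fastEnergy β (e₀ / 4 ^ l)) :=
      modeMoment_nonneg hm H.n_nonneg _ F.fastEnergy_nonneg
    have h5 := mul_le_mul_of_nonneg_right h3 h4
    have h6 : scheduledMoment r e₀ g₀ K n m₀ ((l + 1) * K - 1) (fastEnergy β (e₀ / 4 ^ (l + 1)))
      ≤ 4 * scheduledMoment r e₀ g₀ K n m₀ ((l + 1) * K - 1) (fastEnergy β (e₀ / 4 ^ l)) := by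
      refine modeMoment_le_mul hm H.n_nonneg _ fun s => ?_
      have : β / (e₀ / 4 ^ (l + 1)) = 4 * (β / (e₀ / 4 ^ l)) := by
        rw [pow_succ]; field_simp
      simp only [fastEnergy, this]
      nlinarith [sq_nonneg (s.1 - s.2)]
    linarith
  have base : ∀ l, β / 16 < e₀ / 4 ^ l → scheduledMoment r e₀ g₀ K n m₀ (l * K - 1)
      (fastEnergy β (e₀ / 4 ^ l)) ≤ 17 * m₀ + 8000 * gain β e₀ g₀ * nbar := by
    intro l
    induction l with
    | zero =>
      intro hl
      have h1 : β / e₀ ≤ 16 := by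
        rw [div_le_iff₀ he]; simp at hl; linarith
      have h2 : m₀ * (β / e₀) ≤ m₀ * 16 := by gcongr
      simp [scheduledMoment, modeMoment, fastEnergy]
      linarith
    | succ l ih =>
      intro hl
      have h1 : β / 16 < e₀ / 4 ^ l := hl.trans_le (div_four_pow_anti he.le l.le_succ)
      exact step l h1 (ih h1)
  exact ⟨base l, fun h => step l h (base l h)⟩

/-- Once `e ≤ β / 16`, the slow energy is bounded by its value at the start of the first such
phase plus the noise added since. -/
theorem moment_slow_bound {t : ℕ} (h : phased K e₀ t ≤ β / 16) :
    scheduledMoment r e₀ g₀ K n m₀ t slowEnergy ≤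
      34 * m₀ + 17000 * gain β e₀ g₀ * nbar := by
  have hm := H.m_nonneg; have hn := H.nbar_nonneg; have hκ := H.gain_nonneg; have hβ := H.β_pos
  have he := H.e_pos; have hx := H.x_nonneg
  have hκn : 0 ≤ gain β e₀ g₀ * nbar := mul_nonneg hκ hn
  classical
  have hex : ∃ l, e₀ / 4 ^ l ≤ β / 16 := ⟨_, h⟩
  set l := Nat.find hex with hl
  have hls : e₀ / 4 ^ l ≤ β / 16 := Nat.find_spec hex
  have hlt : l ≤ (t + 1) / K := Nat.find_min' hex h
  have htl : l * K ≤ t + 1 := (Nat.le_div_iff_mul_le H.K_pos).mp hlt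
  have hstart : scheduledMoment r e₀ g₀ K n m₀ (l * K - 1) slowEnergy ≤
      34 * m₀ + 16000 * gain β e₀ g₀ * nbar := by
    rcases Nat.eq_zero_or_pos l with h0 | h0
    · rw [h0]; simp [scheduledMoment, modeMoment, slowEnergy]; linarith
    · obtain ⟨k, hk⟩ : ∃ k, l = k + 1 := ⟨l - 1, by omega⟩
      have h1 : β / 16 < e₀ / 4 ^ k := not_le.mp (Nat.find_min hex (by omega))
      have h2 := (H.fast_phase_start_le hc k).2 h1
      rw [← hk] at h2
      have h3 : scheduledMoment r e₀ g₀ K n m₀ (l * K - 1) slowEnergy ≤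
          2 * scheduledMoment r e₀ g₀ K n m₀ (l * K - 1) (fastEnergy β (e₀ / 4 ^ l)) := by
        refine modeMoment_le_mul hm H.n_nonneg _ fun s => ?_
        have h4 : 16 ≤ β / (e₀ / 4 ^ l) := by
          rw [le_div_iff₀ (by positivity)]; linarith
        have h5 := mul_le_mul_of_nonneg_right h4 (sq_nonneg s.1)
        simp only [slowEnergy, fastEnergy]
        nlinarith [sq_nonneg (2 * s.1 - s.2), sq_nonneg s.1]
      linarith
  have hph : phased K e₀ (l * K - 1) ≤ e₀ / 4 ^ l := by
    rcases Nat.eq_zero_or_pos l with h0 | h0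
    · have := div_four_pow_le he.le ((0 * K - 1 + 1) / K)
      rw [h0]; simpa [phased] using this
    · rw [phased, show l * K - 1 + 1 = l * K from
        Nat.sub_add_cancel (Nat.mul_pos h0 H.K_pos), Nat.mul_div_cancel _ H.K_pos]
  have h1 := H.moment_slow_le (t₀ := l * K - 1) (hph.trans hls) (by omega : l * K - 1 ≤ t)
  have h2 : e₀ / 4 ^ l ≤ 2 * gain β e₀ g₀ := by
    refine le_trans ?_ (mul_le_mul_of_nonneg_left (H.gain_div_le l) zero_le_two)
    have hg := abs_le.mp (H.abs_g_div_le l)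
    have hel : 0 < e₀ / 4 ^ l := by positivity
    unfold gain
    generalize e₀ / 4 ^ l = E at *
    generalize g₀ / 4 ^ l = G at *
    have h3 : E / 2 ≤ β * E / (β + (E - G)) := by
      rw [le_div_iff₀ (by linarith)]; nlinarith
    linarith
  have h3 : phased K e₀ (l * K - 1) * nbar ≤ 2 * gain β e₀ g₀ * nbar := by
    gcongr; exact hph.trans h2
  linarith

/-- The second moment of the midpoint error of a mode, uniformly in time. -/
theorem moment_midpoint_le (t : ℕ) :
    scheduledMoment r e₀ g₀ K n m₀ t midpointSq ≤ 100000 * (m₀ + gain β e₀ g₀ * nbar) := by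
  have hm := H.m_nonneg; have hn := H.nbar_nonneg; have hκ := H.gain_nonneg; have hβ := H.β_pos
  have he := H.e_pos
  have hκn : 0 ≤ gain β e₀ g₀ * nbar := mul_nonneg hκ hn
  rcases le_or_gt (phased K e₀ t) (β / 16) with h | h
  · have h1 := H.moment_slow_bound hc h
    have h2 : scheduledMoment r e₀ g₀ K n m₀ t midpointSq ≤
        2 * scheduledMoment r e₀ g₀ K n m₀ t slowEnergy :=
      modeMoment_le_mul hm H.n_nonneg _ fun s => by
        simp only [midpointSq, slowEnergy]; nlinarith [sq_nonneg (s.1 + s.2)]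
    linarith
  · rw [phased] at h
    have hls : (t + 1) / K * K ≤ t + 1 := Nat.div_mul_le_self _ _
    have hlt : t + 1 < ((t + 1) / K + 1) * K := by
      rw [mul_comm]; exact Nat.lt_mul_div_succ _ H.K_pos
    generalize (t + 1) / K = l at h hls hlt
    obtain ⟨k, rfl⟩ : ∃ k, t = l * K - 1 + k := ⟨t - (l * K - 1), by omega⟩
    have F := H.fastRegime (l := l) h.le
    have h1 := H.moment_fast_le (l := l) h.le (l * K - 1) k
      (fun j hj => phase_start_add H.K_pos (by omega) hj)
    have h2 := (H.fast_phase_start_le hc l).1 h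
    have h4 : 0 ≤ scheduledMoment r e₀ g₀ K n m₀ (l * K - 1) (fastEnergy β (e₀ / 4 ^ l)) :=
      modeMoment_nonneg hm H.n_nonneg _ F.fastEnergy_nonneg
    have h5 := mul_le_mul_of_nonneg_right
      (min_le_left 12 ((1 - β / 5000) ^ k * (5000 / β))) h4
    have h6 : scheduledMoment r e₀ g₀ K n m₀ (l * K - 1 + k) midpointSq ≤
        scheduledMoment r e₀ g₀ K n m₀ (l * K - 1 + k) (fastEnergy β (e₀ / 4 ^ l)) :=
      modeMoment_mono hm H.n_nonneg _ fun s => by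
        have := F.e_pos
        simp only [midpointSq, fastEnergy]
        have : 0 ≤ β / (e₀ / 4 ^ l) * s.1 ^ 2 := by positivity
        linarith
    linarith

end ModeSetup

/-! ### Power sums and phase lengths -/

/-- Comparison of `(x + 1) ^ (-a)` with the integral of the power over `[x, x + 1]`. -/
theorem rpow_neg_le_telescope {a x : ℝ} (ha : 1 < a) (hx : 0 < x) :
    (x + 1) ^ (-a) ≤ (x ^ (1 - a) - (x + 1) ^ (1 - a)) / (a - 1) := by
  have hx1 : 0 < x + 1 := by linarith
  have h1 : 1 + (a - 1) / (x + 1) ≤ (x / (x + 1)) ^ (1 - a) := by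
    rw [Real.rpow_def_of_pos (by positivity)]
    have h2 := Real.add_one_le_exp (Real.log (x / (x + 1)) * (1 - a))
    have h3 := Real.one_sub_inv_le_log_of_pos (show 0 < (x + 1) / x by positivity)
    have h4 : Real.log ((x + 1) / x) = -Real.log (x / (x + 1)) := by
      rw [← Real.log_inv, inv_div]
    have h5 : 1 - ((x + 1) / x)⁻¹ = 1 / (x + 1) := by field_simp; ring
    rw [h4, h5] at h3
    have h6 := mul_le_mul_of_nonneg_left h3 (by linarith : 0 ≤ a - 1)
    have h7 : (a - 1) * (1 / (x + 1)) = (a - 1) / (x + 1) := by ring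
    linarith
  have h8 : x ^ (1 - a) = (x + 1) ^ (1 - a) * (x / (x + 1)) ^ (1 - a) := by
    rw [← Real.mul_rpow hx1.le (by positivity)]; congr 1; field_simp
  have h9 : (x + 1) ^ (-a) = (x + 1) ^ (1 - a) * (1 / (x + 1)) := by
    rw [show 1 - a = -a + 1 by ring, Real.rpow_add_one hx1.ne']; field_simp
  have h10 := mul_le_mul_of_nonneg_left h1 (Real.rpow_nonneg hx1.le (1 - a))
  rw [le_div_iff₀ (by linarith), h8, h9]
  have : (a - 1) / (x + 1) = (1 / (x + 1)) * (a - 1) := by ring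
  rw [this] at h10
  linarith

theorem sum_Ico_rpow_neg_le {a : ℝ} (ha : 1 < a) {m : ℕ} (hm : 1 ≤ m) (d : ℕ) :
    ∑ i ∈ Finset.Ico m d, ((i : ℝ) + 1) ^ (-a) ≤ (m : ℝ) ^ (1 - a) / (a - 1) := by
  have hm0 : (0 : ℝ) < m := by exact_mod_cast hm
  have key : ∀ d, m ≤ d → ∑ i ∈ Finset.Ico m d, ((i : ℝ) + 1) ^ (-a) ≤
      ((m : ℝ) ^ (1 - a) - (d : ℝ) ^ (1 - a)) / (a - 1) := by
    intro d hd
    induction d, hd using Nat.le_induction with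
    | base => simp
    | succ d hd ih =>
      rw [Finset.sum_Ico_succ_top hd]
      have h1 := rpow_neg_le_telescope ha (x := d) (by exact_mod_cast lt_of_lt_of_le hm hd)
      push_cast
      calc _ ≤ _ := add_le_add ih h1
        _ = _ := by ring
  have h0 : 0 < a - 1 := by linarith
  rcases le_total m d with h | h
  · refine (key d h).trans ?_
    gcongr
    have : (0 : ℝ) ≤ (d : ℝ) ^ (1 - a) := by positivity
    linarith
  · rw [Finset.Ico_eq_empty_of_le h, Finset.sum_empty]; positivity

theorem sum_rpow_neg_le {a : ℝ} (ha : 1 < a) (d : ℕ) :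
    ∑ i : Fin d, ((i : ℝ) + 1) ^ (-a) ≤ 1 + 1 / (a - 1) := by
  rw [Fin.sum_univ_eq_sum_range (fun i : ℕ => ((i : ℝ) + 1) ^ (-a)) d]
  have h0 : 0 < a - 1 := by linarith
  rcases Nat.eq_zero_or_pos d with rfl | hd
  · simp; positivity
  · rw [Finset.sum_range_eq_add_Ico _ hd]
    have := sum_Ico_rpow_neg_le ha le_rfl d
    simpa using this

theorem sum_rpow_neg_le_log {a : ℝ} (ha : 1 ≤ a) (d : ℕ) :
    ∑ i : Fin d, ((i : ℝ) + 1) ^ (-a) ≤ 1 + Real.log d := by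
  have h1 := harmonic_le_one_add_log d
  refine le_trans ?_ h1
  rw [harmonic, ← Fin.sum_univ_eq_sum_range (fun i : ℕ => ((i + 1 : ℕ) : ℚ)⁻¹) d]
  push_cast
  refine Finset.sum_le_sum fun i _ => ?_
  rw [← Real.rpow_neg_one]
  exact Real.rpow_le_rpow_of_exponent_le (by linarith [(Nat.cast_nonneg i.1 : (0:ℝ) ≤ i.1)])
    (by linarith)

/-- The constant of `sum_min_rpow_le`, which needs `1 < a`. At `a = 1` the value is `2`, because
`1 / 0 = 0`, and has no meaning. -/
def truncConst (a : ℝ) : ℝ := 2 + 2 ^ (a - 1) / (a - 1) + 1 / (a - 1)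

theorem truncConst_nonneg {a : ℝ} (ha : 1 ≤ a) : 0 ≤ truncConst a := by
  have : 0 ≤ a - 1 := by linarith
  unfold truncConst; positivity

/-- About `(D / θ) ^ (1 / a)` terms of the sum are cut off at `θ`, and the tail beyond them has the
same size `θ ^ (1 - 1 / a) * D ^ (1 / a)`. -/
theorem sum_min_rpow_le {a : ℝ} (ha : 1 < a) {θ D : ℝ} (hθ : 0 < θ) (hD : 0 < D) (d : ℕ) :
    ∑ i : Fin d, min θ (D * ((i : ℝ) + 1) ^ (-a)) ≤
      truncConst a * (θ ^ (1 - 1 / a) * D ^ (1 / a)) := by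
  have h0 : 0 < a - 1 := by linarith
  have ha0 : 0 < a := by linarith
  have hinv : 0 < 1 / a := by positivity
  have hinv1 : 1 / a ≤ 1 := by rw [div_le_one ha0]; exact ha.le
  set X := θ ^ (1 - 1 / a) * D ^ (1 / a) with hX
  have hX0 : 0 < X := by positivity
  -- the two entries of the minimum are equal at `i + 1 = M`
  set M := (D / θ) ^ (1 / a) with hM
  have hM0 : 0 < M := by positivity
  have hθM : θ * M = X := by
    rw [hM, hX, Real.div_rpow hD.le hθ.le, Real.rpow_sub hθ, Real.rpow_one]; field_simp
  have hMa : M ^ a = D / θ := by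
    rw [hM, ← Real.rpow_mul (by positivity), one_div_mul_cancel ha0.ne', Real.rpow_one]
  have hDM : D * M ^ (1 - a) = X := by
    rw [Real.rpow_sub hM0, Real.rpow_one, hMa, ← hθM]; field_simp
  rcases lt_or_ge M 1 with h | h
  · have h1 : D < θ := by
      by_contra hc
      push Not at hc
      have : 1 ≤ M := Real.one_le_rpow (by rw [one_le_div hθ]; exact hc) hinv.le
      linarith
    have h2 : D ≤ X := by
      calc D = D ^ (1 - 1 / a) * D ^ (1 / a) := by
            rw [← Real.rpow_add hD]; simp
        _ ≤ X := by
          rw [hX]; gcongr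
    calc ∑ i : Fin d, min θ (D * ((i : ℝ) + 1) ^ (-a))
        ≤ ∑ i : Fin d, D * ((i : ℝ) + 1) ^ (-a) := Finset.sum_le_sum fun i _ => min_le_right _ _
      _ = D * ∑ i : Fin d, ((i : ℝ) + 1) ^ (-a) := by rw [Finset.mul_sum]
      _ ≤ X * (1 + 1 / (a - 1)) := by
          gcongr
          exact sum_rpow_neg_le ha d
      _ ≤ truncConst a * X := by
          rw [mul_comm]; gcongr; unfold truncConst
          have : 0 ≤ 2 ^ (a - 1) / (a - 1) := by positivity
          linarith
  · set m := ⌊M⌋₊ with hm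
    have hm1 : 1 ≤ m := Nat.le_floor (by simpa using h)
    have hmM : (m : ℝ) ≤ M := Nat.floor_le hM0.le
    have hMm : M / 2 ≤ m := by
      have := Nat.lt_floor_add_one M
      have : (1 : ℝ) ≤ m := by exact_mod_cast hm1
      linarith
    rw [Fin.sum_univ_eq_sum_range (fun i : ℕ => min θ (D * ((i : ℝ) + 1) ^ (-a))) d]
    have hsub : Finset.range d ⊆ Finset.range m ∪ Finset.Ico m d := by
      intro i hi; simp at hi ⊢; omega
    have hnn : ∀ i : ℕ, 0 ≤ min θ (D * ((i : ℝ) + 1) ^ (-a)) := fun i => by positivity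
    calc ∑ i ∈ Finset.range d, min θ (D * ((i : ℝ) + 1) ^ (-a))
        ≤ ∑ i ∈ Finset.range m ∪ Finset.Ico m d, min θ (D * ((i : ℝ) + 1) ^ (-a)) :=
          Finset.sum_le_sum_of_subset_of_nonneg hsub fun i _ _ => hnn i
      _ ≤ ∑ i ∈ Finset.range m, min θ (D * ((i : ℝ) + 1) ^ (-a)) +
          ∑ i ∈ Finset.Ico m d, min θ (D * ((i : ℝ) + 1) ^ (-a)) := by
          rw [← Finset.sum_union_inter]
          have : 0 ≤ ∑ i ∈ Finset.range m ∩ Finset.Ico m d, min θ (D * ((i : ℝ) + 1) ^ (-a)) :=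
            Finset.sum_nonneg fun i _ => hnn i
          linarith
      _ ≤ ∑ i ∈ Finset.range m, θ + ∑ i ∈ Finset.Ico m d, D * ((i : ℝ) + 1) ^ (-a) :=
          add_le_add (Finset.sum_le_sum fun i _ => min_le_left _ _)
            (Finset.sum_le_sum fun i _ => min_le_right _ _)
      _ ≤ X + 2 ^ (a - 1) / (a - 1) * X := by
          apply add_le_add
          · rw [Finset.sum_const, Finset.card_range, nsmul_eq_mul, ← hθM, mul_comm θ]; gcongr
          · rw [← Finset.mul_sum]
            have h1 : (m : ℝ) ^ (1 - a) ≤ (M / 2) ^ (1 - a) :=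
              Real.rpow_le_rpow_of_nonpos (by positivity) hMm (by linarith)
            have h2 : (M / 2) ^ (1 - a) = 2 ^ (a - 1) * M ^ (1 - a) := by
              rw [Real.div_rpow hM0.le (by norm_num), show a - 1 = -(1 - a) by ring,
                Real.rpow_neg (by norm_num)]
              field_simp
            calc D * ∑ i ∈ Finset.Ico m d, ((i : ℝ) + 1) ^ (-a)
                ≤ D * ((m : ℝ) ^ (1 - a) / (a - 1)) := by
                  gcongr; exact sum_Ico_rpow_neg_le ha hm1 d
              _ ≤ D * (2 ^ (a - 1) * M ^ (1 - a) / (a - 1)) := by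
                  gcongr; rw [← h2]; exact h1
              _ = 2 ^ (a - 1) / (a - 1) * (D * M ^ (1 - a)) := by ring
              _ = _ := by rw [hDM]
      _ ≤ truncConst a * X := by
          have h3 : 0 ≤ 1 / (a - 1) * X := by positivity
          unfold truncConst; nlinarith

theorem one_le_logb_two {T : ℕ} (hT : 2 ≤ T) : 1 ≤ Real.logb 2 T := by
  rw [Real.le_logb_iff_rpow_le (by norm_num) (by positivity)]
  simpa using (by exact_mod_cast hT : (2:ℝ) ≤ T)

theorem logb_two_le {T : ℕ} (hT : 2 ≤ T) : Real.logb 2 T ≤ T := by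
  rw [Real.logb_le_iff_le_rpow (by norm_num) (by positivity), Real.rpow_natCast]
  exact_mod_cast T.lt_two_pow_self.le

theorem phaseLength_pos {T : ℕ} (hT : 2 ≤ T) : 0 < phaseLength T := by
  have h1 := one_le_logb_two hT
  refine Nat.floor_pos.mpr ?_
  rw [one_le_div (by linarith)]
  exact logb_two_le hT

theorem phaseLength_mul_logb_le {T : ℕ} (hT : 2 ≤ T) : phaseLength T * Real.logb 2 T ≤ T := by
  have h1 := one_le_logb_two hT
  rw [← le_div_iff₀ (by linarith)]
  exact Nat.floor_le (by positivity)

theorem phaseLength_le {T : ℕ} (hT : 2 ≤ T) : (phaseLength T : ℝ) ≤ T := by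
  have h1 := one_le_logb_two hT
  have h2 := phaseLength_mul_logb_le hT
  have : (0 : ℝ) ≤ phaseLength T := Nat.cast_nonneg _
  nlinarith

theorem log_two_le_log {T : ℕ} (hT : 2 ≤ T) : 1 / 2 ≤ Real.log T := by
  have h1 : Real.log 2 ≤ Real.log T := Real.log_le_log (by norm_num) (by exact_mod_cast hT)
  have := Real.log_two_gt_d9
  linarith

/-- A schedule has at most about `4 log T` phases. -/
theorem le_phaseLength {T : ℕ} (hT : 2 ≤ T) : T ≤ 4 * Real.log T * phaseLength T := by
  have h1 := one_le_logb_two hT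
  have h2 := log_two_le_log hT
  have h3 : (T : ℝ) / Real.logb 2 T < phaseLength T + 1 := Nat.lt_floor_add_one _
  have h4 : (1 : ℝ) ≤ phaseLength T := by exact_mod_cast phaseLength_pos hT
  have h5 : Real.logb 2 T ≤ 2 * Real.log T := by
    rw [Real.logb, div_le_iff₀ (Real.log_pos (by norm_num))]
    have := Real.log_two_gt_d9
    nlinarith
  rw [div_lt_iff₀ (by linarith)] at h3
  nlinarith

/-- There are at least `log₂ T` complete phases. -/
theorem mul_phaseLength_le {T l : ℕ} (hT : 2 ≤ T) (h : (4 : ℝ) ^ l ≤ (T : ℝ) ^ 2) :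
    l * phaseLength T ≤ T := by
  have h1 := one_le_logb_two hT
  have h2 := phaseLength_mul_logb_le hT
  have h3 : (l : ℝ) ≤ Real.logb 2 T := by
    rw [Real.le_logb_iff_rpow_le (by norm_num) (by positivity), Real.rpow_natCast]
    refine le_of_sq_le_sq ?_ (by positivity)
    rw [← pow_mul, mul_comm l 2, pow_mul]; norm_num; exact h
  have h4 : (l : ℝ) * phaseLength T ≤ T := by
    have : (0 : ℝ) ≤ phaseLength T := Nat.cast_nonneg _
    nlinarith
  exact_mod_cast h4

/-- The stepsizes end up of order `T⁻²`. -/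
theorem sq_le_four_pow_div_phaseLength {T : ℕ} (hT : 2 ≤ T) :
    (T : ℝ) ^ 2 ≤ 4 * 4 ^ (T / phaseLength T) := by
  have hK := phaseLength_pos hT
  by_contra hc
  push Not at hc
  set l := T / phaseLength T with hl
  have h1 : T < phaseLength T * (l + 1) := Nat.lt_mul_div_succ T hK
  have h2 := mul_phaseLength_le (l := l + 1) hT (by rw [pow_succ]; linarith)
  rw [mul_comm] at h2
  omega

/-! ### The coupled modes -/

/-- One phase of length `K ≳ log T / β` contracts the fast energy below any constant. -/
theorem contraction_of_le {β : ℝ} {T : ℕ} (hβ : 0 < β) (hβ1 : β ≤ 1) (hT : 2 ≤ T)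
    (hK : 200000 * Real.log T ≤ β * phaseLength T) :
    (1 - β / 5000) ^ (phaseLength T - 1) * (5000 / β) ≤ 1 / 8 := by
  have hlog := log_two_le_log hT
  have hKT := phaseLength_le hT
  set K := phaseLength T with hKdef
  have hT0 : (0 : ℝ) < T := by positivity
  have hK1 : (1 : ℝ) ≤ K := by exact_mod_cast phaseLength_pos hT
  have h1 : 1 / β ≤ T := by
    rw [div_le_iff₀ hβ]; nlinarith
  have hK2 : (K : ℝ) / 2 ≤ ((K - 1 : ℕ) : ℝ) := by
    rw [Nat.cast_sub (phaseLength_pos hT)]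
    have : (2 : ℝ) ≤ K := by nlinarith
    push_cast; linarith
  have h2 : (1 - β / 5000) ^ (K - 1) ≤ Real.exp (-(20 * Real.log T)) := by
    calc (1 - β / 5000) ^ (K - 1) ≤ Real.exp (-(β / 5000)) ^ (K - 1) := by
          gcongr
          · linarith
          · exact Real.one_sub_le_exp_neg _
      _ = Real.exp (-(β / 5000) * ((K - 1 : ℕ) : ℝ)) := by
          rw [← Real.exp_nat_mul]; ring_nf
      _ ≤ Real.exp (-(20 * Real.log T)) := by
          apply Real.exp_le_exp.mpr
          have := mul_le_mul_of_nonneg_left hK2 (by positivity : 0 ≤ β / 5000)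
          linarith
  have h3 : Real.exp (-(20 * Real.log T)) = ((T : ℝ) ^ 20)⁻¹ := by
    rw [Real.exp_neg, show (20 : ℝ) * Real.log T = ((20 : ℕ) : ℝ) * Real.log T by norm_num,
      Real.exp_nat_mul, Real.exp_log hT0]
  have hT2 : (2 : ℝ) ≤ T := by exact_mod_cast hT
  calc (1 - β / 5000) ^ (K - 1) * (5000 / β) ≤ ((T : ℝ) ^ 20)⁻¹ * (5000 * T) := by
        rw [← h3]
        have h5 : 5000 / β ≤ 5000 * T := by rw [← mul_one_div]; gcongr
        gcongr
    _ = 5000 * ((T : ℝ) ^ 19)⁻¹ := by field_simp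
    _ ≤ 5000 * ((2 : ℝ) ^ 19)⁻¹ := by gcongr
    _ ≤ 1 / 8 := by norm_num

namespace ModeSetup
variable {β r e₀ g₀ : ℝ} {T : ℕ} {n : ℕ → ℝ} {m₀ nbar : ℝ}
  (H : ModeSetup β r e₀ g₀ (phaseLength T) n m₀ nbar)
include H

/-- A mode that moves by at least `log T / K` per step forgets its initial value: in the phase in
which its rate has dropped to that order it still contracts by the factor `1 / T`, and the noise
added from then on is of the order of the rate. -/
theorem moment_head_le (hT : 2 ≤ T) (hK : 200000 * Real.log T ≤ β * phaseLength T)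
    (he : 4 * Real.log T / phaseLength T ≤ e₀) :
    scheduledMoment r e₀ g₀ (phaseLength T) n m₀ (T - 1) slowEnergy ≤
      1 / T * (34 * m₀ + 17000 * gain β e₀ g₀ * nbar) +
        32 * (4 * Real.log T / phaseLength T) * nbar := by
  have hcon := contraction_of_le H.β_pos H.β_le hT hK
  have hlog := log_two_le_log hT
  have hKT := phaseLength_le hT
  have hKpos := phaseLength_pos hT
  set K := phaseLength T with hKdef
  set ε := 4 * Real.log T / K with hε
  have hT0 : (0 : ℝ) < T := by positivity
  have hK1 : (1 : ℝ) ≤ K := by exact_mod_cast hKpos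
  have hK2 : (K : ℝ) / 2 ≤ ((K - 1 : ℕ) : ℝ) := by
    rw [Nat.cast_sub hKpos]
    have : (2 : ℝ) ≤ K := by nlinarith [H.β_le, H.β_pos]
    push_cast; linarith
  have hε0 : 0 < ε := by positivity
  have hεK : ε * K = 4 * Real.log T := by rw [hε]; field_simp
  have hεβ : 4 * ε ≤ β / 16 := by
    have : 4 * ε * K ≤ β / 16 * K := by nlinarith
    exact le_of_mul_le_mul_right this (by linarith)
  have hn := H.nbar_nonneg
  have hm := H.m_nonneg
  have hκ := H.gain_nonneg
  -- the phase in which the rate of this mode is of the order of `log T / K`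
  obtain ⟨l, hl1, hl2⟩ : ∃ l : ℕ, ε ≤ e₀ / 4 ^ l ∧ e₀ / 4 ^ (l + 1) < ε := by
    obtain ⟨l, h1, h2⟩ := exists_nat_pow_near (x := e₀ / ε) (y := 4)
      (by rw [le_div_iff₀ hε0]; linarith) (by norm_num)
    refine ⟨l, ?_, ?_⟩
    · rw [le_div_iff₀ hε0] at h1
      rw [le_div_iff₀ (by positivity)]; linarith
    · rw [div_lt_iff₀ hε0] at h2
      rw [div_lt_iff₀ (by positivity)]; linarith
  have hl3 : e₀ / 4 ^ l ≤ 4 * ε := by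
    have : e₀ / 4 ^ l = 4 * (e₀ / 4 ^ (l + 1)) := by rw [pow_succ]; field_simp
    linarith
  have hls : e₀ / 4 ^ l ≤ β / 16 := hl3.trans hεβ
  have hlT : (l + 1) * K ≤ T := by
    apply mul_phaseLength_le hT
    rw [le_div_iff₀ (by positivity)] at hl1
    have h1 : β * ((K : ℝ) * e₀) ≤ K * (1 / 2) := by nlinarith [H.β_mul_e_le]
    have h2 : 1 ≤ β * T := by nlinarith [H.β_pos]
    have h3 : (K : ℝ) * e₀ ≤ T ^ 2 / 2 := by
      have h4 : β * ((K : ℝ) * e₀) ≤ β * (T ^ 2 / 2) := by nlinarith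
      exact le_of_mul_le_mul_left h4 H.β_pos
    have h5 : 4 * Real.log T * 4 ^ l ≤ K * e₀ := by rw [← hεK]; nlinarith
    rw [pow_succ]
    have : (0 : ℝ) < 4 ^ l := by positivity
    nlinarith
  have hph : phased K e₀ (l * K - 1) ≤ e₀ / 4 ^ l := by
    rcases Nat.eq_zero_or_pos l with h0 | h0
    · have := div_four_pow_le H.e_pos.le ((0 * K - 1 + 1) / K)
      rw [h0]; simpa [phased] using this
    · rw [phased, show l * K - 1 + 1 = l * K from
        Nat.sub_add_cancel (Nat.mul_pos h0 H.K_pos), Nat.mul_div_cancel _ H.K_pos]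
  have h1 := H.moment_slow_bound (Or.inr hcon) (t := l * K - 1) (hph.trans hls)
  obtain ⟨k, hk, hkK⟩ : ∃ k, l * K - 1 + k = (l + 1) * K - 1 ∧ K - 1 ≤ k := by
    refine ⟨(l + 1) * K - 1 - (l * K - 1), ?_, ?_⟩ <;>
    · have : (l + 1) * K = l * K + K := by ring
      omega
  have h2 := H.moment_slow_contract hls (l * K - 1) k
    (fun j hj => phase_start_add H.K_pos hk.le hj)
  rw [hk] at h2
  have hph' : phased K e₀ ((l + 1) * K - 1) = e₀ / 4 ^ (l + 1) := by
    rw [phased, show (l + 1) * K - 1 + 1 = (l + 1) * K from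
      Nat.sub_add_cancel (Nat.mul_pos l.succ_pos H.K_pos), Nat.mul_div_cancel _ H.K_pos]
  have h3 := H.moment_slow_le (t₀ := (l + 1) * K - 1) (t := T - 1)
    (by rw [hph']; linarith [hεβ]) (by omega)
  rw [hph'] at h3
  have h4 : (1 - e₀ / 4 ^ l / 2) ^ k ≤ 1 / T := by
    have h5 : 0 ≤ 1 - e₀ / 4 ^ l / 2 := by linarith [H.β_le]
    have h6 : 0 ≤ e₀ / 4 ^ l := by linarith
    have hkK' : ((K - 1 : ℕ) : ℝ) ≤ k := by exact_mod_cast hkK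
    calc (1 - e₀ / 4 ^ l / 2) ^ k ≤ Real.exp (-(e₀ / 4 ^ l / 2)) ^ k := by
          gcongr
          exact Real.one_sub_le_exp_neg _
      _ = Real.exp (-(e₀ / 4 ^ l / 2) * k) := by rw [← Real.exp_nat_mul]; ring_nf
      _ ≤ Real.exp (-Real.log T) := by
          apply Real.exp_le_exp.mpr
          have h7 : ε / 2 * (K / 2) ≤ e₀ / 4 ^ l / 2 * k := by
            apply mul_le_mul <;> linarith
          nlinarith
      _ = 1 / T := by rw [Real.exp_neg, Real.exp_log hT0, one_div]
  have h5 : (1 - e₀ / 4 ^ l / 2) ^ k *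
      scheduledMoment r e₀ g₀ K n m₀ (l * K - 1) slowEnergy ≤
      1 / T * (34 * m₀ + 17000 * gain β e₀ g₀ * nbar) :=
    mul_le_mul h4 h1 (H.moment_slow_nonneg _) (by positivity)
  have h6 : e₀ / 4 ^ l * nbar ≤ 4 * ε * nbar := by gcongr
  have h7 : e₀ / 4 ^ (l + 1) * nbar ≤ ε * nbar := by gcongr
  have h8 : 0 ≤ ε * nbar := by positivity
  linarith

theorem moment_midpoint_le_slow (t : ℕ) :
    scheduledMoment r e₀ g₀ (phaseLength T) n m₀ t midpointSq ≤
      2 * scheduledMoment r e₀ g₀ (phaseLength T) n m₀ t slowEnergy :=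
  modeMoment_le_mul H.m_nonneg H.n_nonneg _ fun s => by
    simp only [midpointSq, slowEnergy]; nlinarith [sq_nonneg (s.1 + s.2)]

end ModeSetup

/-- The second moments of all modes together. Mode `i` has eigenvalue `lam i`, initial second moment
`m i` and noise variance `n t i`, and `n_eq` expresses `n` through the moments themselves, as the
fourth moments of Gaussian covariates dictate: multiplicative noise of intensity
`∑ j, lam j * E u_j² + σ2`. The assumption `gain_le` keeps this feedback subcritical. -/
structure CoreSetup (d : ℕ) (β r D G σ2 : ℝ) (K : ℕ) (lam m : Fin d → ℝ)
    (n : ℕ → Fin d → ℝ) : Prop where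
  β_pos : 0 < β
  β_le : β ≤ 1
  r_eq : r * (1 + β) = 1 - β
  D_pos : 0 < D
  abs_G_le : |G| ≤ D
  lam_pos : ∀ i, 0 < lam i
  lam_le : ∀ i, lam i ≤ 1
  β_mul_D_le : β * D ≤ 1 / 2
  x_le : D - G ≤ 1 / 2
  h_le : D - r * G ≤ 1 / 2
  K_pos : 0 < K
  m_nonneg : ∀ i, 0 ≤ m i
  σ2_nonneg : 0 ≤ σ2
  n_eq : ∀ t i, n t i = (∑ j, lam j * scheduledMoment r (D * lam j) (G * lam j) K
    (fun s => n s j) (m j) t midpointSq + σ2) / lam i +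
      scheduledMoment r (D * lam i) (G * lam i) K (fun s => n s i) (m i) t midpointSq
  gain_le : ∑ i, gain β (D * lam i) (G * lam i) ≤ 1 / 400000

namespace CoreSetup
variable {d : ℕ} {β r D G σ2 : ℝ} {K : ℕ} {lam m : Fin d → ℝ} {n : ℕ → Fin d → ℝ}
  (H : CoreSetup d β r D G σ2 K lam m n)

/-- `E u_i²`, the second moment of the midpoint error of mode `i` at time `t`. The setup is an
argument only to fix the parameters, here and in the definitions below. -/
def modeRisk (_ : CoreSetup d β r D G σ2 K lam m n) (t : ℕ) (i : Fin d) : ℝ :=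
  scheduledMoment r (D * lam i) (G * lam i) K (fun s => n s i) (m i) t midpointSq

/-- The excess loss of the midpoint at time `t`. -/
def risk (_ : CoreSetup d β r D G σ2 K lam m n) (t : ℕ) : ℝ :=
  ∑ i, lam i * scheduledMoment r (D * lam i) (G * lam i) K (fun s => n s i) (m i) t midpointSq

/-- An upper bound of `2 * risk t + σ2`, and so of `lam i * n t i`, for all `t`. -/
def noiseLevel (_ : CoreSetup d β r D G σ2 K lam m n) : ℝ :=
  2 * (200000 * ∑ i, lam i * m i + σ2) + σ2

include H

theorem n_nonneg_and_modeRisk_nonneg (t : ℕ) : (∀ i, 0 ≤ n t i) ∧ ∀ i, 0 ≤ H.modeRisk t i := by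
  induction t using Nat.strong_induction_on with
  | _ t ih =>
    have h2 : ∀ i, 0 ≤ H.modeRisk t i := by
      intro i
      have h3 := modeMoment_congr (r := r) (e := phased K (D * lam i)) (g := phased K (G * lam i))
        (m₀ := m i) (n := fun s => n s i) (n' := fun s => if s < t then n s i else 0) t
        (fun s hs => by simp [hs]) midpointSq
      rw [modeRisk, scheduledMoment, h3]
      refine modeMoment_nonneg (H.m_nonneg i) (fun s => ?_) t fun s => sq_nonneg _
      split_ifs with h
      · exact (ih s h).1 i
      · exact le_rfl
    refine ⟨fun i => ?_, h2⟩
    rw [H.n_eq]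
    refine add_nonneg (div_nonneg (add_nonneg (Finset.sum_nonneg fun j _ => ?_) H.σ2_nonneg)
      (H.lam_pos i).le) (h2 i)
    exact mul_nonneg (H.lam_pos j).le (h2 j)

theorem n_nonneg (t : ℕ) (i : Fin d) : 0 ≤ n t i := (H.n_nonneg_and_modeRisk_nonneg t).1 i

theorem modeRisk_nonneg (t : ℕ) (i : Fin d) : 0 ≤ H.modeRisk t i :=
  (H.n_nonneg_and_modeRisk_nonneg t).2 i

theorem risk_nonneg (t : ℕ) : 0 ≤ H.risk t :=
  Finset.sum_nonneg fun i _ => mul_nonneg (H.lam_pos i).le (H.modeRisk_nonneg t i)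

theorem n_le_risk (t : ℕ) (i : Fin d) : n t i ≤ (2 * H.risk t + σ2) / lam i := by
  have hl := H.lam_pos i
  have h1 : lam i * H.modeRisk t i ≤ H.risk t :=
    Finset.single_le_sum (f := fun i => lam i * H.modeRisk t i)
      (fun j _ => mul_nonneg (H.lam_pos j).le (H.modeRisk_nonneg t j)) (Finset.mem_univ i)
  have h2 : n t i = (H.risk t + σ2) / lam i + H.modeRisk t i := H.n_eq t i
  rw [h2, div_add' _ _ _ hl.ne']
  exact div_le_div_of_nonneg_right (by linarith) hl.le

theorem modeSetup {n' : ℕ → ℝ} {nbar : ℝ} (i : Fin d) (h0 : ∀ t, 0 ≤ n' t)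
    (h1 : ∀ t, n' t ≤ nbar) :
    ModeSetup β r (D * lam i) (G * lam i) K n' (m i) nbar where
  β_pos := H.β_pos
  β_le := H.β_le
  r_eq := H.r_eq
  e_pos := mul_pos H.D_pos (H.lam_pos i)
  abs_g_le := by
    rw [abs_mul, abs_of_pos (H.lam_pos i)]
    exact mul_le_mul_of_nonneg_right H.abs_G_le (H.lam_pos i).le
  β_mul_e_le := by
    have := mul_le_mul_of_nonneg_left (H.lam_le i) (mul_pos H.β_pos H.D_pos).le
    linarith [H.β_mul_D_le]
  x_le := by
    have h : 0 ≤ D - G := by linarith [(abs_le.mp H.abs_G_le).2]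
    have := mul_le_mul_of_nonneg_left (H.lam_le i) h
    linarith [H.x_le]
  h_le := by
    have := H.lam_le i; have := (H.lam_pos i).le; have := H.h_le
    rw [show D * lam i - r * (G * lam i) = (D - r * G) * lam i by ring]
    nlinarith
  K_pos := H.K_pos
  m_nonneg := H.m_nonneg i
  n_nonneg := h0
  n_le := h1

theorem noiseLevel_nonneg : 0 ≤ H.noiseLevel := by
  have : 0 ≤ ∑ i, lam i * m i :=
    Finset.sum_nonneg fun i _ => mul_nonneg (H.lam_pos i).le (H.m_nonneg i)
  have := H.σ2_nonneg
  unfold noiseLevel; positivity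

theorem gain_nonneg (i : Fin d) : 0 ≤ gain β (D * lam i) (G * lam i) :=
  (H.modeSetup (n' := fun _ => 0) (nbar := 0) i (fun _ => le_rfl) (fun _ => le_rfl)).gain_nonneg

/-- The excess loss is bounded uniformly in time. The noise before time `t` is controlled by the
loss before `t`, and feeds back into the loss with a factor smaller than one, by `gain_le`. Without
modes in the fast regime no contraction is needed. -/
theorem risk_le
    (hc : (∀ i, D * lam i ≤ β / 16) ∨ (1 - β / 5000) ^ (K - 1) * (5000 / β) ≤ 1 / 8) (t : ℕ) :
    H.risk t ≤ 200000 * ∑ i, lam i * m i + σ2 := by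
  induction t using Nat.strong_induction_on with
  | _ t ih =>
    have hσ := H.σ2_nonneg
    have hS : 0 ≤ ∑ i, lam i * m i :=
      Finset.sum_nonneg fun i _ => mul_nonneg (H.lam_pos i).le (H.m_nonneg i)
    have hN := H.noiseLevel_nonneg
    have h1 : ∀ i, lam i * H.modeRisk t i ≤
        100000 * (lam i * m i + gain β (D * lam i) (G * lam i) * H.noiseLevel) := by
      intro i
      have hl := H.lam_pos i
      have h3 := modeMoment_congr (r := r) (e := phased K (D * lam i)) (g := phased K (G * lam i))
        (m₀ := m i) (n := fun s => n s i) (n' := fun s => if s < t then n s i else 0) t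
        (fun s hs => by simp [hs]) midpointSq
      have hs := H.modeSetup (n' := fun s => if s < t then n s i else 0)
        (nbar := H.noiseLevel / lam i) i (fun s => by
          split_ifs; exacts [H.n_nonneg s i, le_rfl]) (fun s => by
          split_ifs with h
          · refine (H.n_le_risk s i).trans ?_
            have := ih s h
            gcongr
            unfold noiseLevel; linarith
          · positivity)
      have h4 := hs.moment_midpoint_le (hc.imp_left fun h => h i) t
      rw [modeRisk, scheduledMoment, h3]
      rw [scheduledMoment] at h4
      calc _ ≤ lam i * _ := mul_le_mul_of_nonneg_left h4 hl.le
        _ = _ := by field_simp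
    have h2 : H.risk t ≤ 100000 * (∑ i, lam i * m i +
        (∑ i, gain β (D * lam i) (G * lam i)) * H.noiseLevel) := by
      rw [Finset.sum_mul, ← Finset.sum_add_distrib, Finset.mul_sum]
      exact Finset.sum_le_sum fun i _ => h1 i
    have h5 := mul_le_mul_of_nonneg_right H.gain_le hN
    have h6 : H.noiseLevel = 2 * (200000 * ∑ i, lam i * m i + σ2) + σ2 := rfl
    linarith

theorem n_le
    (hc : (∀ i, D * lam i ≤ β / 16) ∨ (1 - β / 5000) ^ (K - 1) * (5000 / β) ≤ 1 / 8) (t : ℕ)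
    (i : Fin d) : n t i ≤ H.noiseLevel / lam i := by
  have hl := H.lam_pos i
  refine (H.n_le_risk t i).trans ?_
  have := H.risk_le hc t
  gcongr
  unfold noiseLevel; linarith

end CoreSetup

/-- The loss at the last step: modes below the threshold `ε ≈ log T / K` keep their initial error
and collect noise all the time, modes above it have forgotten the error and carry noise `ε`. -/
theorem CoreSetup.risk_last_le {d : ℕ} {β r D G σ2 : ℝ} {T : ℕ} {lam m : Fin d → ℝ}
    {n : ℕ → Fin d → ℝ} (H : CoreSetup d β r D G σ2 (phaseLength T) lam m n) (hT : 2 ≤ T)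
    (hK : 200000 * Real.log T ≤ β * phaseLength T) {ε : ℝ}
    (hε : ε = 4 * Real.log T / phaseLength T) :
    H.risk (T - 1) ≤ 2 * ∑ i, (if D * lam i < ε then lam i * m i else 0) +
      68 * T * H.noiseLevel * ∑ i, min ε (D * lam i) ^ 2 + 1 / T * H.noiseLevel := by
  have hcon := contraction_of_le H.β_pos H.β_le hT hK
  have hlog := log_two_le_log hT
  have hKT := phaseLength_le hT
  have hKpos := phaseLength_pos hT
  have hN := H.noiseLevel_nonneg
  have hT0 : (0 : ℝ) < T := by positivity
  have hK1 : (1 : ℝ) ≤ phaseLength T := by exact_mod_cast hKpos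
  have hε0 : 0 < ε := by rw [hε]; positivity
  have hεK : ε * phaseLength T = 4 * Real.log T := by rw [hε]; field_simp
  have hεβ : ε ≤ β / 16 := by
    have : ε * phaseLength T ≤ β / 16 * phaseLength T := by nlinarith
    exact le_of_mul_le_mul_right this (by linarith)
  have hεT : ε ≤ T * ε ^ 2 := by
    have : 1 ≤ T * ε := by nlinarith
    nlinarith
  have key : ∀ i, lam i * H.modeRisk (T - 1) i ≤
      2 * (if D * lam i < ε then lam i * m i else 0) +
      68 * T * H.noiseLevel * min ε (D * lam i) ^ 2 +
      1 / T * (68 * (lam i * m i) + 34000 * gain β (D * lam i) (G * lam i) * H.noiseLevel) := by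
    intro i
    have hl := H.lam_pos i
    have hD := H.D_pos
    have hκ := H.gain_nonneg i
    have hm := H.m_nonneg i
    have hs := H.modeSetup (n' := fun s => n s i) (nbar := H.noiseLevel / lam i) i
      (fun s => H.n_nonneg s i) (fun s => H.n_le (Or.inr hcon) s i)
    have h1 := hs.moment_midpoint_le_slow (T - 1)
    have h2 : lam i * H.modeRisk (T - 1) i ≤ lam i * _ := mul_le_mul_of_nonneg_left h1 hl.le
    have hr : 0 ≤ 1 / (T : ℝ) * (68 * (lam i * m i) +
        34000 * gain β (D * lam i) (G * lam i) * H.noiseLevel) := by positivity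
    split_ifs with h
    · have h3 := hs.moment_slow_le_add (h.le.trans hεβ) (T - 1)
      have h4 : lam i * (2 * scheduledMoment r (D * lam i) (G * lam i) (phaseLength T)
          (fun s => n s i) (m i) (T - 1) slowEnergy) ≤ lam i * (2 * (m i + 2 * T *
            (D * lam i) ^ 2 * (H.noiseLevel / lam i))) := by
        gcongr
        refine h3.trans ?_
        gcongr
        exact Nat.sub_le _ _
      have h5 : lam i * (2 * (m i + 2 * T * (D * lam i) ^ 2 * (H.noiseLevel / lam i))) =
          2 * (lam i * m i) + 4 * T * H.noiseLevel * (D * lam i) ^ 2 := by field_simp; ring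
      rw [min_eq_right h.le]
      have h6 : 0 ≤ T * H.noiseLevel * (D * lam i) ^ 2 := by positivity
      linarith
    · push Not at h
      have h3 := hs.moment_head_le hT hK (by rw [← hε]; exact h)
      rw [← hε] at h3
      have h4 := mul_le_mul_of_nonneg_left (mul_le_mul_of_nonneg_left h3 zero_le_two) hl.le
      have h5 : lam i * (2 * (1 / T * (34 * m i + 17000 * gain β (D * lam i) (G * lam i) *
          (H.noiseLevel / lam i)) + 32 * ε * (H.noiseLevel / lam i))) =
          1 / T * (68 * (lam i * m i) + 34000 * gain β (D * lam i) (G * lam i) * H.noiseLevel) +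
            64 * ε * H.noiseLevel := by field_simp; ring
      rw [min_eq_left h]
      have h6 := mul_le_mul_of_nonneg_right hεT hN
      have h7 : 0 ≤ ε * H.noiseLevel := by positivity
      linarith
  have h1 : H.risk (T - 1) ≤ 2 * ∑ i, (if D * lam i < ε then lam i * m i else 0) +
      68 * T * H.noiseLevel * ∑ i, min ε (D * lam i) ^ 2 +
      1 / T * (68 * ∑ i, lam i * m i + 34000 * (∑ i, gain β (D * lam i) (G * lam i)) *
        H.noiseLevel) := by
    calc H.risk (T - 1) ≤ _ := Finset.sum_le_sum fun i _ => key i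
      _ = _ := by
        rw [Finset.sum_add_distrib, Finset.sum_add_distrib, ← Finset.mul_sum, ← Finset.mul_sum,
          ← Finset.mul_sum, Finset.sum_add_distrib, ← Finset.mul_sum, ← Finset.sum_mul,
          ← Finset.mul_sum]
  refine h1.trans ?_
  gcongr
  have hS : 0 ≤ ∑ i, lam i * m i :=
    Finset.sum_nonneg fun i _ => mul_nonneg (H.lam_pos i).le (H.m_nonneg i)
  have h5 := mul_le_mul_of_nonneg_right H.gain_le hN
  have h6 : H.noiseLevel = 2 * (200000 * ∑ i, lam i * m i + σ2) + σ2 := rfl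
  have := H.σ2_nonneg
  linarith

/-! ### Gaussian moments -/

theorem deriv_mul_exp_sq (v : ℝ) (P P' : ℝ → ℝ) (hP : ∀ t, HasDerivAt P (P' t) t) :
    deriv (fun t => P t * Real.exp (v * t ^ 2 / 2)) =
      fun t => (P' t + v * t * P t) * Real.exp (v * t ^ 2 / 2) := by
  funext t
  have h1 : HasDerivAt (fun t => v * t ^ 2 / 2) (v * t) t := by
    have := ((hasDerivAt_pow 2 t).const_mul v).div_const 2
    convert! this using 1; simp; ring
  have h2 := (hP t).mul h1.exp
  rw [show (fun t => P t * Real.exp (v * t ^ 2 / 2)) =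
    P * (fun t => Real.exp (v * t ^ 2 / 2)) from rfl, h2.deriv]
  ring

/-- By differentiating the moment generating function four times. -/
theorem integral_pow_four_gaussianReal (v : ℝ≥0) :
    ∫ x, x ^ 4 ∂(gaussianReal 0 v) = 3 * (v : ℝ) ^ 2 := by
  have h1 : ∫ x, x ^ 4 ∂(gaussianReal 0 v) =
      iteratedDeriv 4 (mgf (fun x => x) (gaussianReal 0 v)) 0 := by
    rw [iteratedDeriv_mgf_zero] <;> simp
  rw [h1, mgf_fun_id_gaussianReal]
  have e0 : (fun t : ℝ => Real.exp (0 * t + v * t ^ 2 / 2)) =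
      fun t => (fun _ => (1 : ℝ)) t * Real.exp (v * t ^ 2 / 2) := by simp
  rw [e0]
  simp only [iteratedDeriv_succ, iteratedDeriv_zero]
  rw [deriv_mul_exp_sq v _ (fun _ => 0) fun t => hasDerivAt_const _ _]
  rw [deriv_mul_exp_sq v (fun t => 0 + v * t * 1) (fun _ => v) fun t => by
    simpa using (hasDerivAt_id t).const_mul (v : ℝ)]
  rw [deriv_mul_exp_sq v (fun t => v + v * t * (0 + v * t * 1)) (fun t => 2 * v ^ 2 * t) fun t => by
    have := ((hasDerivAt_pow 2 t).const_mul ((v : ℝ) ^ 2)).const_add (v : ℝ)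
    convert! this using 1
    · funext t; simp; ring
    · simp; ring]
  rw [deriv_mul_exp_sq v (fun t => 2 * v ^ 2 * t + v * t * (v + v * t * (0 + v * t * 1)))
    (fun t => 3 * v ^ 2 + 3 * v ^ 3 * t ^ 2) fun t => by
    have := ((hasDerivAt_id t).const_mul (3 * (v : ℝ) ^ 2)).add
      ((hasDerivAt_pow 3 t).const_mul ((v : ℝ) ^ 3))
    convert! this using 1
    · funext t; simp; ring
    · simp; ring]
  simp

theorem integral_sq_gaussianReal (v : ℝ≥0) : ∫ x, x ^ 2 ∂(gaussianReal 0 v) = v := by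
  have h := variance_fun_id_gaussianReal (μ := 0) (v := v)
  rw [variance_eq_integral measurable_id'.aemeasurable] at h
  simpa using h

theorem integrable_pow_gaussianReal (v : ℝ≥0) (k : ℕ) :
    Integrable (fun x => x ^ k) (gaussianReal 0 v) := by
  rcases Nat.eq_zero_or_pos k with rfl | hk
  · simp
  have h := (memLp_id_gaussianReal (μ := 0) (v := v) k).integrable_norm_pow hk.ne'
  rw [← integrable_norm_iff (by fun_prop)]
  simpa using h

/-- `f` is integrable with integral `A`. -/
def HasMean {Ω : Type*} [MeasurableSpace Ω] (μ : Measure Ω) (f : Ω → ℝ) (A : ℝ) : Prop :=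
  Integrable f μ ∧ ∫ x, f x ∂μ = A

namespace HasMean
variable {Ω Ω' : Type*} [MeasurableSpace Ω] [MeasurableSpace Ω'] {μ : Measure Ω} {ν : Measure Ω'}
  {f g : Ω → ℝ} {A B : ℝ}

theorem add (hf : HasMean μ f A) (hg : HasMean μ g B) :
    HasMean μ (fun x => f x + g x) (A + B) :=
  ⟨hf.1.add hg.1, by rw [integral_add hf.1 hg.1, hf.2, hg.2]⟩

theorem sub (hf : HasMean μ f A) (hg : HasMean μ g B) :
    HasMean μ (fun x => f x - g x) (A - B) :=
  ⟨hf.1.sub hg.1, by rw [integral_sub hf.1 hg.1, hf.2, hg.2]⟩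

theorem const_mul (c : ℝ) (hf : HasMean μ f A) : HasMean μ (fun x => c * f x) (c * A) :=
  ⟨hf.1.const_mul c, by rw [integral_const_mul, hf.2]⟩

theorem const [IsProbabilityMeasure μ] (c : ℝ) : HasMean μ (fun _ => c) c :=
  ⟨integrable_const c, by simp⟩

theorem sum {ι : Type*} (s : Finset ι) {f : ι → Ω → ℝ} {A : ι → ℝ}
    (h : ∀ i ∈ s, HasMean μ (f i) (A i)) :
    HasMean μ (fun x => ∑ i ∈ s, f i x) (∑ i ∈ s, A i) :=
  ⟨integrable_finsetSum s fun i hi => (h i hi).1, by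
    rw [integral_finsetSum s fun i hi => (h i hi).1]
    exact Finset.sum_congr rfl fun i hi => (h i hi).2⟩

theorem mul_prod [SFinite μ] [SFinite ν] {g : Ω' → ℝ} (hf : HasMean μ f A) (hg : HasMean ν g B) :
    HasMean (μ.prod ν) (fun z => f z.1 * g z.2) (A * B) :=
  ⟨hf.1.mul_prod hg.1, by rw [integral_prod_mul, hf.2, hg.2]⟩

theorem congr (hf : HasMean μ f A) (h : ∀ x, g x = f x) (hAB : B = A) : HasMean μ g B := by
  rw [funext h, hAB]; exact hf

end HasMean

variable {d : ℕ} (a : ℝ)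

/-- The eigenvalue `(i + 1) ^ (-a)` of the covariance matrix. -/
def eig (a : ℝ) {d : ℕ} (i : Fin d) : ℝ := ((i : ℝ) + 1) ^ (-a)

theorem eig_pos (i : Fin d) : 0 < eig a i := Real.rpow_pos_of_pos (by positivity) _

/-- The covariance matrix as a bilinear form. -/
def covForm (v w : Param d) : ℝ := ∑ i, eig a i * v i * w i

theorem map_inner_multivariateGaussian (v : Param d) :
    (multivariateGaussian 0 (covariance a d)).map (fun x => inner ℝ v x) =
      gaussianReal 0 (covForm a v v).toNNReal := by
  have h : (fun x : Param d => inner ℝ v x) = innerSL ℝ v := by ext; simp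
  rw [h, IsGaussian.map_eq_gaussianReal, ContinuousLinearMap.integral_comp_id_comm, ← h,
    ← covarianceBilin_self, covarianceBilin_multivariateGaussian (covariance_posSemidef a d)]
  · congr 1
    · simp
    · congr 1
      simp [covForm, covariance, Matrix.mulVec_diagonal, dotProduct, eig]
      refine Finset.sum_congr rfl fun i _ => by ring
  · exact IsGaussian.memLp_two_id
  · exact IsGaussian.integrable_id

theorem covForm_self_nonneg (v : Param d) : 0 ≤ covForm a v v :=
  Finset.sum_nonneg fun i _ => by
    have := eig_pos a i
    rw [mul_assoc]; exact mul_nonneg this.le (mul_self_nonneg _)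

theorem integrable_inner_pow (v : Param d) (k : ℕ) :
    Integrable (fun x => (inner ℝ v x) ^ k) (multivariateGaussian 0 (covariance a d)) := by
  have h := integrable_pow_gaussianReal (covForm a v v).toNNReal k
  rw [← map_inner_multivariateGaussian] at h
  exact (integrable_map_measure (measurable_id.pow_const k).aestronglyMeasurable
    (by fun_prop)).mp h

theorem integral_inner_sq (v : Param d) :
    ∫ x, (inner ℝ v x) ^ 2 ∂(multivariateGaussian 0 (covariance a d)) = covForm a v v := by
  have h := integral_sq_gaussianReal (covForm a v v).toNNReal
  rw [← map_inner_multivariateGaussian, integral_map (by fun_prop) (by fun_prop)] at h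
  rw [h, Real.coe_toNNReal _ (covForm_self_nonneg a v)]

theorem integral_inner_pow_four (v : Param d) :
    ∫ x, (inner ℝ v x) ^ 4 ∂(multivariateGaussian 0 (covariance a d)) =
      3 * covForm a v v ^ 2 := by
  have h := integral_pow_four_gaussianReal (covForm a v v).toNNReal
  rw [← map_inner_multivariateGaussian, integral_map (by fun_prop) (by fun_prop)] at h
  rw [h, Real.coe_toNNReal _ (covForm_self_nonneg a v)]

theorem covForm_add_self (v w : Param d) :
    covForm a (v + w) (v + w) = covForm a v v + 2 * covForm a v w + covForm a w w := by
  simp only [covForm, PiLp.add_apply, Finset.mul_sum, ← Finset.sum_add_distrib]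
  exact Finset.sum_congr rfl fun i _ => by ring

theorem covForm_sub_self (v w : Param d) :
    covForm a (v - w) (v - w) = covForm a v v - 2 * covForm a v w + covForm a w w := by
  simp only [covForm, PiLp.sub_apply, Finset.mul_sum, ← Finset.sum_add_distrib,
    ← Finset.sum_sub_distrib]
  exact Finset.sum_congr rfl fun i _ => by ring

theorem hasMean_inner_sq (v : Param d) :
    HasMean (multivariateGaussian 0 (covariance a d)) (fun x => (inner ℝ v x) ^ 2)
      (covForm a v v) :=
  ⟨integrable_inner_pow a v 2, integral_inner_sq a v⟩

theorem hasMean_inner_pow_four (v : Param d) :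
    HasMean (multivariateGaussian 0 (covariance a d)) (fun x => (inner ℝ v x) ^ 4)
      (3 * covForm a v v ^ 2) :=
  ⟨integrable_inner_pow a v 4, integral_inner_pow_four a v⟩

theorem hasMean_inner_mul_inner (v w : Param d) :
    HasMean (multivariateGaussian 0 (covariance a d)) (fun x => inner ℝ v x * inner ℝ w x)
      (covForm a v w) := by
  refine ((((hasMean_inner_sq a (v + w)).sub (hasMean_inner_sq a v)).sub
    (hasMean_inner_sq a w)).const_mul (1 / 2)).congr (fun x => ?_) ?_
  · rw [inner_add_left]; ring
  · rw [covForm_add_self]; ring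

/-- Isserlis' formula for the fourth moments, from the univariate ones by polarization. -/
theorem hasMean_inner_sq_mul_inner_sq (v w : Param d) :
    HasMean (multivariateGaussian 0 (covariance a d))
      (fun x => (inner ℝ v x) ^ 2 * (inner ℝ w x) ^ 2)
      (covForm a v v * covForm a w w + 2 * covForm a v w ^ 2) := by
  refine (((((hasMean_inner_pow_four a (v + w)).add (hasMean_inner_pow_four a (v - w))).sub
    ((hasMean_inner_pow_four a v).const_mul 2)).sub
    ((hasMean_inner_pow_four a w).const_mul 2)).const_mul (1 / 12)).congr (fun x => ?_) ?_
  · rw [inner_add_left, inner_sub_left]; ring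
  · rw [covForm_add_self, covForm_sub_self]; ring

variable (σ : ℝ≥0) (Wstar : Param d)

theorem integral_dataLaw {f : Sample d → ℝ} (hf : Measurable f) :
    ∫ z, f z ∂(dataLaw a σ Wstar) = ∫ z, f (z.1, inner ℝ Wstar z.1 + z.2)
      ∂((multivariateGaussian 0 (covariance a d)).prod (gaussianReal 0 (σ ^ 2))) := by
  rw [dataLaw, integral_map (by fun_prop) hf.aestronglyMeasurable]

theorem integrable_dataLaw {f : Sample d → ℝ} (hf : Measurable f) :
    Integrable f (dataLaw a σ Wstar) ↔
      Integrable (fun z : Param d × ℝ => f (z.1, inner ℝ Wstar z.1 + z.2))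
        ((multivariateGaussian 0 (covariance a d)).prod (gaussianReal 0 (σ ^ 2))) := by
  rw [dataLaw, integrable_map_measure hf.aestronglyMeasurable (by fun_prop)]
  rfl

theorem hasMean_gaussianReal : HasMean (gaussianReal 0 (σ ^ 2)) (fun x => x) 0 :=
  ⟨by simpa using integrable_pow_gaussianReal (σ ^ 2) 1, integral_id_gaussianReal⟩

theorem hasMean_sq_gaussianReal :
    HasMean (gaussianReal 0 (σ ^ 2)) (fun x => x ^ 2) ((σ : ℝ) ^ 2) :=
  ⟨integrable_pow_gaussianReal (σ ^ 2) 2, by rw [integral_sq_gaussianReal]; simp⟩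

/-- The mean is `0`; since it only ever gets multiplied by the mean of the label noise, its value
does not matter. -/
theorem hasMean_inner (w : Param d) : HasMean (multivariateGaussian 0 (covariance a d))
    (fun x => inner ℝ w x) (∫ x, inner ℝ w x ∂(multivariateGaussian 0 (covariance a d))) :=
  ⟨by simpa using integrable_inner_pow a w 1, rfl⟩

theorem hasMean_residual_sq (w : Param d) :
    HasMean ((multivariateGaussian 0 (covariance a d)).prod (gaussianReal 0 (σ ^ 2)))
      (fun z => (inner ℝ w z.1 - z.2) ^ 2) (covForm a w w + (σ : ℝ) ^ 2) := by
  refine ((((hasMean_inner_sq a w).mul_prod (HasMean.const (μ := gaussianReal 0 (σ ^ 2)) 1)).sub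
    (((hasMean_inner a w).mul_prod (hasMean_gaussianReal σ)).const_mul 2)).add
    ((HasMean.const (μ := multivariateGaussian 0 (covariance a d)) 1).mul_prod
      (hasMean_sq_gaussianReal σ))).congr (fun z => ?_) ?_ <;> ring

theorem covForm_single_right (w : Param d) (i : Fin d) :
    covForm a w (EuclideanSpace.single i 1) = eig a i * w i := by
  simp [covForm]

/-- Mean and fluctuation of a gradient coordinate at a point with error `w`, for the second moment
of an affine function of it. -/
theorem hasMean_affine_grad_sq (w : Param d) (i : Fin d) (α c : ℝ) :
    HasMean ((multivariateGaussian 0 (covariance a d)).prod (gaussianReal 0 (σ ^ 2)))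
      (fun z => (α - c * ((inner ℝ w z.1 - z.2) * z.1 i)) ^ 2)
      ((α - c * (eig a i * w i)) ^ 2 +
        c ^ 2 * (eig a i * (covForm a w w + (σ : ℝ) ^ 2) + eig a i ^ 2 * w i ^ 2)) := by
  set b : Param d := EuclideanSpace.single i 1 with hb
  have hbx : ∀ x : Param d, x i = inner ℝ b x := fun x => by
    simp [hb, EuclideanSpace.inner_single_left]
  have hbb : covForm a b b = eig a i := by
    rw [hb, covForm_single_right]; simp
  have hwb : covForm a w b = eig a i * w i := covForm_single_right a w i
  -- the odd moment only has to be integrable: its factor `E ε` vanishes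
  have j3 : HasMean (multivariateGaussian 0 (covariance a d))
      (fun x => inner ℝ w x * (inner ℝ b x) ^ 2)
      (∫ x, inner ℝ w x * (inner ℝ b x) ^ 2 ∂(multivariateGaussian 0 (covariance a d))) := by
    refine ⟨((integrable_inner_pow a w 2).add (integrable_inner_pow a b 4)).mono'
      (by fun_prop) (ae_of_all _ fun x => ?_), rfl⟩
    simp only [Pi.add_apply, Real.norm_eq_abs, abs_mul, abs_of_nonneg (sq_nonneg (inner ℝ b x))]
    nlinarith [sq_nonneg (|inner ℝ w x| - (inner ℝ b x) ^ 2), sq_abs (inner ℝ w x),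
      sq_nonneg (|inner ℝ w x| + (inner ℝ b x) ^ 2)]
  refine ((((((HasMean.const (α ^ 2)).sub ((hasMean_inner_mul_inner a w b).const_mul
    (2 * α * c))).add ((hasMean_inner_sq_mul_inner_sq a w b).const_mul (c ^ 2))).mul_prod
    (HasMean.const (μ := gaussianReal 0 (σ ^ 2)) 1)).add
    ((((hasMean_inner a b).const_mul (2 * α * c)).sub (j3.const_mul (2 * c ^ 2))).mul_prod
      (hasMean_gaussianReal σ))).add
    (((hasMean_inner_sq a b).mul_prod (hasMean_sq_gaussianReal σ)).const_mul (c ^ 2))).congr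
    (fun z => ?_) ?_
  · rw [hbx]; ring
  · rw [hbb, hwb]; ring

theorem stochGrad_apply (U x : Param d) (ε : ℝ) (i : Fin d) :
    stochGrad U (x, inner ℝ Wstar x + ε) i = (inner ℝ (U - Wstar) x - ε) * x i := by
  simp only [stochGrad, PiLp.smul_apply, smul_eq_mul, inner_sub_left]
  rw [real_inner_comm]; ring

theorem HasMean.dataLaw {f : Sample d → ℝ} {A : ℝ} (hf : Measurable f)
    (h : HasMean ((multivariateGaussian 0 (covariance a d)).prod (gaussianReal 0 (σ ^ 2)))
      (fun z => f (z.1, inner ℝ Wstar z.1 + z.2)) A) : HasMean (dataLaw a σ Wstar) f A :=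
  ⟨(integrable_dataLaw a σ Wstar hf).mpr h.1, (integral_dataLaw a σ Wstar hf).trans h.2⟩

theorem validationLoss_eq (W : Param d) :
    validationLoss a σ Wstar W = covForm a (W - Wstar) (W - Wstar) + (σ : ℝ) ^ 2 := by
  refine (HasMean.dataLaw a σ Wstar (by fun_prop)
    ((hasMean_residual_sq a σ (W - Wstar)).congr (fun z => ?_) rfl)).2
  rw [inner_sub_left]; ring

theorem hasMean_sub_stochGrad_sq (U : Param d) (i : Fin d) (α c : ℝ) :
    HasMean (dataLaw a σ Wstar) (fun z => (α - c * stochGrad U z i) ^ 2)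
      ((α - c * (eig a i * (U i - Wstar i))) ^ 2 +
        c ^ 2 * (eig a i * (covForm a (U - Wstar) (U - Wstar) + (σ : ℝ) ^ 2) +
          eig a i ^ 2 * (U i - Wstar i) ^ 2)) := by
  have hm : Measurable fun z : Sample d => (α - c * stochGrad U z i) ^ 2 := by
    unfold stochGrad; fun_prop
  refine HasMean.dataLaw a σ Wstar hm
    ((hasMean_affine_grad_sq a σ (U - Wstar) i α c).congr (fun z => ?_) rfl)
  rw [stochGrad_apply]

/-! ### Second moments of the stochastic iteration -/

variable {d : ℕ}

/-- One step of accelerated SGD from the state `s` with sample `z`. -/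
def asgdStep (β δ γ : ℝ) (s : Param d × Param d) (z : Sample d) : Param d × Param d :=
  (midpointU β s - δ • stochGrad (midpointU β s) z,
    β • midpointU β s + (1 - β) • s.2 - γ • stochGrad (midpointU β s) z)

theorem asgdState_succ (β : ℝ) (δ γ : ℕ → ℝ) (ξ : ℕ → Sample d) (t : ℕ) :
    asgdState β δ γ ξ (t + 1) =
      asgdStep β (δ (t + 1)) (γ (t + 1)) (asgdState β δ γ ξ t) (ξ (t + 1)) := rfl

theorem measurable_midpointU (β : ℝ) : Measurable (midpointU (d := d) β) := by
  unfold midpointU; fun_prop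

theorem measurable_asgdStep (β δ γ : ℝ) :
    Measurable fun p : (Param d × Param d) × Sample d => asgdStep β δ γ p.1 p.2 := by
  unfold asgdStep stochGrad midpointU; fun_prop

theorem measurable_asgdState (β : ℝ) (δ γ : ℕ → ℝ) (t : ℕ) :
    Measurable fun ξ : ℕ → Sample d => asgdState β δ γ ξ t := by
  induction t with
  | zero => exact measurable_const
  | succ t ih =>
    have h := (measurable_asgdStep (d := d) β (δ (t + 1)) (γ (t + 1))).comp
      (ih.prodMk (measurable_pi_apply (t + 1)))
    exact h

theorem asgdState_congr (β : ℝ) (δ γ : ℕ → ℝ) {ξ ξ' : ℕ → Sample d} (t : ℕ)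
    (h : ∀ s ≤ t, ξ s = ξ' s) : asgdState β δ γ ξ t = asgdState β δ γ ξ' t := by
  induction t with
  | zero => rfl
  | succ t ih =>
    rw [asgdState_succ, asgdState_succ, ih fun s hs => h s (hs.trans t.le_succ), h (t + 1) le_rfl]

variable (a : ℝ) (σ : ℝ≥0) (Wstar : Param d)

instance : IsProbabilityMeasure (streamLaw a σ Wstar) := by
  unfold streamLaw; infer_instance

theorem map_asgdState_prod (β : ℝ) (δ γ : ℕ → ℝ) (t : ℕ) :
    (streamLaw a σ Wstar).map (fun ξ => (asgdState β δ γ ξ t, ξ (t + 1))) =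
      ((streamLaw a σ Wstar).map fun ξ => asgdState β δ γ ξ t).prod (dataLaw a σ Wstar) := by
  have hind : iIndepFun (fun i (ξ : ℕ → Sample d) => ξ i) (streamLaw a σ Wstar) :=
    iIndepFun_infinitePi (P := fun _ => dataLaw a σ Wstar) (X := fun _ x => x)
      (fun _ => measurable_id)
  have h1 := hind.indepFun_finset (Finset.range (t + 1)) {t + 1} (by simp)
    (fun i => measurable_pi_apply i)
  -- the past samples, extended by `0`, determine the state at time `t`
  let ext : ((Finset.range (t + 1) : Finset ℕ) → Sample d) → ℕ → Sample d :=
    fun η j => if h : j ∈ Finset.range (t + 1) then η ⟨j, h⟩ else 0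
  have hext : Measurable ext := by
    refine measurable_pi_lambda _ fun j => ?_
    by_cases h : j ∈ Finset.range (t + 1)
    · simp only [ext, dif_pos h]
      exact measurable_pi_apply (⟨j, h⟩ : (Finset.range (t + 1) : Finset ℕ))
    · simp only [ext, dif_neg h]
      exact measurable_const
  have h2 := h1.comp ((measurable_asgdState β δ γ t).comp hext)
    (measurable_pi_apply (⟨t + 1, by simp⟩ : ({t + 1} : Finset ℕ)))
  have h3 : IndepFun (fun ξ : ℕ → Sample d => asgdState β δ γ ξ t) (fun ξ => ξ (t + 1))
      (streamLaw a σ Wstar) := by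
    convert! h2 using 1
    funext ξ
    refine asgdState_congr β δ γ t fun s hs => ?_
    have : s ∈ Finset.range (t + 1) := by simp; omega
    simp only [ext, dif_pos this]
  rw [(indepFun_iff_map_prod_eq_prod_map_map (measurable_asgdState β δ γ t).aemeasurable
    (measurable_pi_apply _).aemeasurable).mp h3]
  congr 1
  exact Measure.infinitePi_map_eval _ _

/-- Since sample `t + 1` is independent of the state at time `t`, expectations can be taken first
over the sample. -/
theorem hasMean_next_sample (β : ℝ) (δ γ : ℕ → ℝ) (t : ℕ)
    {φ : (Param d × Param d) × Sample d → ℝ} (hφ : Measurable φ) (hφ0 : ∀ p, 0 ≤ φ p)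
    {Ψ : Param d × Param d → ℝ} (hΨ : Measurable Ψ)
    (h : ∀ s, HasMean (dataLaw a σ Wstar) (fun z => φ (s, z)) (Ψ s)) {A : ℝ}
    (hA : HasMean (streamLaw a σ Wstar) (fun ξ => Ψ (asgdState β δ γ ξ t)) A) :
    HasMean (streamLaw a σ Wstar) (fun ξ => φ (asgdState β δ γ ξ t, ξ (t + 1))) A := by
  have hs := measurable_asgdState (d := d) β δ γ t
  have hp : Measurable fun ξ : ℕ → Sample d => (asgdState β δ γ ξ t, ξ (t + 1)) :=
    hs.prodMk (measurable_pi_apply _)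
  have hmap := map_asgdState_prod a σ Wstar β δ γ t
  have : IsProbabilityMeasure ((streamLaw a σ Wstar).map fun ξ => asgdState β δ γ ξ t) :=
    Measure.isProbabilityMeasure_map hs.aemeasurable
  have hΨi : Integrable Ψ ((streamLaw a σ Wstar).map fun ξ => asgdState β δ γ ξ t) :=
    (integrable_map_measure hΨ.aestronglyMeasurable hs.aemeasurable).mpr hA.1
  have hint : Integrable φ (((streamLaw a σ Wstar).map fun ξ => asgdState β δ γ ξ t).prod
      (dataLaw a σ Wstar)) := by
    rw [integrable_prod_iff hφ.aestronglyMeasurable]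
    refine ⟨ae_of_all _ fun s => (h s).1, ?_⟩
    have : (fun s => ∫ z, ‖φ (s, z)‖ ∂(dataLaw a σ Wstar)) = Ψ := by
      funext s
      simp only [Real.norm_of_nonneg (hφ0 _)]
      exact (h s).2
    rw [this]; exact hΨi
  constructor
  · rw [← hmap] at hint
    exact (integrable_map_measure hφ.aestronglyMeasurable hp.aemeasurable).mp hint
  · have h1 : ∫ ξ, φ (asgdState β δ γ ξ t, ξ (t + 1)) ∂(streamLaw a σ Wstar) =
        ∫ p, φ p ∂((streamLaw a σ Wstar).map fun ξ => (asgdState β δ γ ξ t, ξ (t + 1))) :=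
      (integral_map hp.aemeasurable hφ.aestronglyMeasurable).symm
    rw [h1, hmap, integral_prod _ hint]
    have h2 : (fun s => ∫ z, φ (s, z) ∂(dataLaw a σ Wstar)) = Ψ := funext fun s => (h s).2
    rw [h2, integral_map hs.aemeasurable hΨ.aestronglyMeasurable, hA.2]

/-- The state `(q, p)` of mode `i`, in the coordinates of `modeStep`. -/
def modeCoord (β : ℝ) (Wstar : Param d) (i : Fin d) (s : Param d × Param d) : ℝ × ℝ :=
  ((s.1 i + s.2 i) / 2 - Wstar i, (1 - β) / (1 + β) / 2 * (s.2 i - s.1 i))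

theorem measurable_modeCoord (β : ℝ) (i : Fin d) : Measurable (modeCoord β Wstar i) := by
  unfold modeCoord; fun_prop

theorem modeCoord_sub {β : ℝ} (hβ : 0 < β) (i : Fin d) (s : Param d × Param d) :
    (modeCoord β Wstar i s).1 - (modeCoord β Wstar i s).2 = midpointU β s i - Wstar i := by
  have : 1 + β ≠ 0 := by positivity
  simp only [modeCoord, midpointU, PiLp.add_apply, PiLp.smul_apply, smul_eq_mul]
  field_simp
  ring

theorem modeCoord_asgdStep {β : ℝ} (hβ : 0 < β) (δ γ : ℝ) (i : Fin d) (s : Param d × Param d)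
    (z : Sample d) (b₁ b₂ : ℝ) :
    b₁ * (modeCoord β Wstar i (asgdStep β δ γ s z)).1 +
      b₂ * (modeCoord β Wstar i (asgdStep β δ γ s z)).2 =
    (b₁ * (modeCoord β Wstar i s).1 + b₂ * ((1 - β) / (1 + β) * (modeCoord β Wstar i s).2)) -
      (b₁ * ((δ + γ) / 2) + b₂ * ((1 - β) / (1 + β) * ((γ - δ) / 2))) *
        stochGrad (midpointU β s) z i := by
  have : 1 + β ≠ 0 := by positivity
  simp only [asgdStep, modeCoord, PiLp.add_apply, PiLp.sub_apply, PiLp.smul_apply, smul_eq_mul]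
  generalize stochGrad (midpointU β s) z i = G
  simp only [midpointU, PiLp.add_apply, PiLp.smul_apply, smul_eq_mul]
  field_simp
  ring

/-- The second moment of coordinate `i` of the midpoint error. -/
def expectedMidpointSq (β : ℝ) (δ γ : ℕ → ℝ) (t : ℕ) (i : Fin d) : ℝ :=
  ∫ ξ, (midpointU β (asgdState β δ γ ξ t) i - Wstar i) ^ 2 ∂(streamLaw a σ Wstar)

/-- The variance of the gradient noise of mode `i`, divided by the square of the eigenvalue. -/
def noiseIntensity (β : ℝ) (δ γ : ℕ → ℝ) (t : ℕ) (i : Fin d) : ℝ :=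
  (∑ j, eig a j * expectedMidpointSq a σ Wstar β δ γ t j + (σ : ℝ) ^ 2) / eig a i +
    expectedMidpointSq a σ Wstar β δ γ t i

/-- The second moments of mode `i` at time `t`, as the functional `modeMoment` with the noise
variance of the actual iteration. -/
def exactMoment (β : ℝ) (δ γ : ℕ → ℝ) (t : ℕ) (i : Fin d) : (ℝ × ℝ → ℝ) → ℝ :=
  modeMoment ((1 - β) / (1 + β)) (fun t => (δ (t + 1) + γ (t + 1)) / 2 * eig a i)
    (fun t => (γ (t + 1) - δ (t + 1)) / 2 * eig a i)
    (fun t => noiseIntensity a σ Wstar β δ γ t i) (Wstar i ^ 2) t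

theorem measurable_stochGrad_midpointU (β : ℝ) (i : Fin d) :
    Measurable fun p : (Param d × Param d) × Sample d => stochGrad (midpointU β p.1) p.2 i := by
  have h : Measurable fun p : (Param d × Param d) × Sample d =>
      stochGrad (midpointU β p.1) p.2 := by
    unfold stochGrad midpointU; fun_prop
  exact (by fun_prop : Measurable fun w : Param d => w i).comp h

theorem measurable_midpointU_apply (β : ℝ) (i : Fin d) :
    Measurable fun s : Param d × Param d => midpointU β s i :=
  (by fun_prop : Measurable fun w : Param d => w i).comp (measurable_midpointU β)

theorem measurable_covForm_midpointU (β : ℝ) :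
    Measurable fun s : Param d × Param d =>
      covForm a (midpointU β s - Wstar) (midpointU β s - Wstar) := by
  unfold covForm
  refine Finset.measurable_sum _ fun j _ => ?_
  have h := measurable_midpointU_apply (d := d) β j
  simp only [PiLp.sub_apply]
  exact ((h.sub_const _).const_mul _).mul (h.sub_const _)

theorem hasMean_noise_factor {β : ℝ} {δ γ : ℕ → ℝ} {t : ℕ}
    (h : ∀ i, Integrable (fun ξ => (midpointU β (asgdState β δ γ ξ t) i - Wstar i) ^ 2)
      (streamLaw a σ Wstar)) (i : Fin d) :
    HasMean (streamLaw a σ Wstar) (fun ξ =>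
      eig a i * (covForm a (midpointU β (asgdState β δ γ ξ t) - Wstar)
        (midpointU β (asgdState β δ γ ξ t) - Wstar) + (σ : ℝ) ^ 2) +
          eig a i ^ 2 * (midpointU β (asgdState β δ γ ξ t) i - Wstar i) ^ 2)
      (eig a i ^ 2 * noiseIntensity a σ Wstar β δ γ t i) := by
  have h1 : ∀ j, HasMean (streamLaw a σ Wstar)
      (fun ξ => (midpointU β (asgdState β δ γ ξ t) j - Wstar j) ^ 2)
      (expectedMidpointSq a σ Wstar β δ γ t j) := fun j => ⟨h j, rfl⟩
  refine (((((HasMean.sum Finset.univ fun j _ => (h1 j).const_mul (eig a j))).add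
    (HasMean.const ((σ : ℝ) ^ 2))).const_mul (eig a i)).add
    ((h1 i).const_mul (eig a i ^ 2))).congr (fun ξ => ?_) ?_
  · simp only [covForm, PiLp.sub_apply]
    congr 3
    exact Finset.sum_congr rfl fun j _ => by ring
  · have := (eig_pos a i).ne'
    unfold noiseIntensity; field_simp

/-- One stochastic gradient step along a coordinate: conditionally on the past, the gradient
coordinate has mean `λ_i (U_i - W*_i)` and its fluctuation adds the noise intensity. -/
theorem hasMean_gradient_step {β : ℝ} {δ γ : ℕ → ℝ} {t : ℕ}
    (hu : ∀ i, Integrable (fun ξ => (midpointU β (asgdState β δ γ ξ t) i - Wstar i) ^ 2)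
      (streamLaw a σ Wstar)) (i : Fin d) {α : Param d × Param d → ℝ} (hα : Measurable α) (c : ℝ)
    {A : ℝ} (hA : HasMean (streamLaw a σ Wstar) (fun ξ => (α (asgdState β δ γ ξ t) -
      c * (eig a i * (midpointU β (asgdState β δ γ ξ t) i - Wstar i))) ^ 2) A) :
    HasMean (streamLaw a σ Wstar) (fun ξ => (α (asgdState β δ γ ξ t) -
        c * stochGrad (midpointU β (asgdState β δ γ ξ t)) (ξ (t + 1)) i) ^ 2)
      (A + c ^ 2 * (eig a i ^ 2 * noiseIntensity a σ Wstar β δ γ t i)) := by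
  have hU := measurable_midpointU_apply (d := d) β i
  have hφ : Measurable fun p : (Param d × Param d) × Sample d =>
      (α p.1 - c * stochGrad (midpointU β p.1) p.2 i) ^ 2 :=
    ((hα.comp measurable_fst).sub ((measurable_stochGrad_midpointU β i).const_mul c)).pow_const 2
  have hΨ : Measurable fun s : Param d × Param d =>
      (α s - c * (eig a i * (midpointU β s i - Wstar i))) ^ 2 + c ^ 2 *
        (eig a i * (covForm a (midpointU β s - Wstar) (midpointU β s - Wstar) + (σ : ℝ) ^ 2) +
          eig a i ^ 2 * (midpointU β s i - Wstar i) ^ 2) :=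
    ((hα.sub (((hU.sub_const _).const_mul _).const_mul c)).pow_const 2).add
      (((((measurable_covForm_midpointU a Wstar β).add_const _).const_mul _).add
        (((hU.sub_const _).pow_const 2).const_mul _)).const_mul _)
  exact hasMean_next_sample a σ Wstar β δ γ t hφ (fun p => sq_nonneg _) hΨ
    (fun s => hasMean_sub_stochGrad_sq a σ Wstar (midpointU β s) i (α s) c)
    (hA.add ((hasMean_noise_factor a σ Wstar hu i).const_mul (c ^ 2)))

/-- The second moments of the iteration follow the recursion of `modeMoment`; the induction carries
integrability along. -/
theorem hasMean_modeCoord_sq {β : ℝ} (hβ : 0 < β) (δ γ : ℕ → ℝ) (t : ℕ) (i : Fin d) (b₁ b₂ : ℝ) :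
    HasMean (streamLaw a σ Wstar)
      (fun ξ => (b₁ * (modeCoord β Wstar i (asgdState β δ γ ξ t)).1 +
        b₂ * (modeCoord β Wstar i (asgdState β δ γ ξ t)).2) ^ 2)
      (exactMoment a σ Wstar β δ γ t i fun s => (b₁ * s.1 + b₂ * s.2) ^ 2) := by
  induction t generalizing i b₁ b₂ with
  | zero =>
    refine (HasMean.const ((b₁ * Wstar i) ^ 2)).congr (fun ξ => ?_) ?_
    · simp [asgdState, modeCoord]
    · simp [exactMoment, modeMoment]; ring
  | succ t ih =>
    have hu : ∀ j, Integrable (fun ξ => (midpointU β (asgdState β δ γ ξ t) j - Wstar j) ^ 2)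
        (streamLaw a σ Wstar) := by
      intro j
      have h1 := (ih j 1 (-1)).1
      convert! h1 using 2 with ξ
      rw [← modeCoord_sub Wstar hβ]; ring
    set c := b₁ * ((δ (t + 1) + γ (t + 1)) / 2) +
      b₂ * ((1 - β) / (1 + β) * ((γ (t + 1) - δ (t + 1)) / 2)) with hc
    have hmc := measurable_modeCoord Wstar β i
    have hα : Measurable fun s : Param d × Param d => b₁ * (modeCoord β Wstar i s).1 +
        b₂ * ((1 - β) / (1 + β) * (modeCoord β Wstar i s).2) :=
      (hmc.fst.const_mul b₁).add ((hmc.snd.const_mul _).const_mul b₂)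
    refine (hasMean_gradient_step a σ Wstar hu i hα c
      ((ih i (b₁ - c * eig a i) (b₂ * ((1 - β) / (1 + β)) + c * eig a i)).congr
        (fun ξ => ?_) rfl)).congr (fun ξ => ?_) ?_
    · rw [← modeCoord_sub Wstar hβ]; ring
    · rw [asgdState_succ, modeCoord_asgdStep Wstar hβ]
    · simp only [exactMoment, modeMoment, modeStep]
      congr 1
      · congr 1; funext s; rw [hc]; ring
      · rw [hc]; ring

theorem hasMean_midpoint_sq {β : ℝ} (hβ : 0 < β) (δ γ : ℕ → ℝ) (t : ℕ) (i : Fin d) :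
    HasMean (streamLaw a σ Wstar)
      (fun ξ => (midpointU β (asgdState β δ γ ξ t) i - Wstar i) ^ 2)
      (exactMoment a σ Wstar β δ γ t i midpointSq) := by
  refine (hasMean_modeCoord_sq a σ Wstar hβ δ γ t i 1 (-1)).congr (fun ξ => ?_) ?_
  · rw [← modeCoord_sub Wstar hβ]; ring
  · congr 1; funext s; simp only [midpointSq]; ring

theorem expectedMidpointSq_eq {β : ℝ} (hβ : 0 < β) (δ γ : ℕ → ℝ) (t : ℕ) (i : Fin d) :
    expectedMidpointSq a σ Wstar β δ γ t i = exactMoment a σ Wstar β δ γ t i midpointSq :=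
  (hasMean_midpoint_sq a σ Wstar hβ δ γ t i).2

theorem hasMean_validationLoss_asgd {β : ℝ} (hβ : 0 < β) (δ γ : ℕ → ℝ) (t : ℕ) :
    HasMean (streamLaw a σ Wstar)
      (fun ξ => validationLoss a σ Wstar (asgd β δ γ ξ (t + 1)))
      (∑ i, eig a i * ((1 - δ (t + 1) * eig a i) ^ 2 *
        exactMoment a σ Wstar β δ γ t i midpointSq +
          (δ (t + 1) * eig a i) ^ 2 * noiseIntensity a σ Wstar β δ γ t i) + (σ : ℝ) ^ 2) := by
  have key : ∀ i, HasMean (streamLaw a σ Wstar)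
      (fun ξ => (asgd β δ γ ξ (t + 1) i - Wstar i) ^ 2)
      ((1 - δ (t + 1) * eig a i) ^ 2 * exactMoment a σ Wstar β δ γ t i midpointSq +
          (δ (t + 1) * eig a i) ^ 2 * noiseIntensity a σ Wstar β δ γ t i) := by
    intro i
    have hα : Measurable fun s : Param d × Param d => midpointU β s i - Wstar i :=
      (measurable_midpointU_apply β i).sub_const _
    have h1 := hasMean_gradient_step a σ Wstar
      (fun j => (hasMean_midpoint_sq a σ Wstar hβ δ γ t j).1) i hα (δ (t + 1))
      (((hasMean_midpoint_sq a σ Wstar hβ δ γ t i).const_mul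
        ((1 - δ (t + 1) * eig a i) ^ 2)).congr (fun ξ => by ring) rfl)
    refine h1.congr (fun ξ => ?_) (by ring)
    simp only [asgd, asgdState_succ, asgdStep, PiLp.sub_apply, PiLp.smul_apply, smul_eq_mul]
    ring
  refine ((HasMean.sum Finset.univ fun i _ => (key i).const_mul (eig a i)).add
    (HasMean.const ((σ : ℝ) ^ 2))).congr (fun ξ => ?_) rfl
  rw [validationLoss_eq]
  simp only [covForm, PiLp.sub_apply]
  congr 1
  exact Finset.sum_congr rfl fun i _ => by ring

/-- Without momentum (`β = 1`) and with equal stepsizes, both sequences are vanilla SGD. -/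
theorem asgdState_one_eq (δ : ℕ → ℝ) (ξ : ℕ → Sample d) (t : ℕ) :
    asgdState 1 δ δ ξ t = (sgd δ ξ t, sgd δ ξ t) := by
  induction t with
  | zero => rfl
  | succ t ih =>
    have hU : midpointU 1 (sgd δ ξ t, sgd δ ξ t) = sgd δ ξ t := by
      simp only [midpointU]; rw [← add_smul]; norm_num
    rw [asgdState_succ, ih, asgdStep, hU]
    simp [sgd]

/-! ### Admissible stepsizes -/

/-- Parameters for which `γ` is comparable to `η β^{-1+1/a}` up to the factor `ρ`. -/
structure StepSizes (a ρ β η γ : ℝ) : Prop where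
  a_ge : 1 ≤ a
  ρ_ge : 1 ≤ ρ
  β_pos : 0 < β
  β_le : β ≤ 1
  η_pos : 0 < η
  le_γ : ρ⁻¹ * (η * β ^ (-1 + 1 / a)) ≤ γ
  γ_le : γ ≤ ρ * (η * β ^ (-1 + 1 / a))

/-- The `a`-th root of the bound imposed on `η tr Σ`; the power `a` is needed because the momentum
contributes `η ^ (1 / a)` to the total gain. -/
def stepRoot (a ρ : ℝ) : ℝ := 1 / (800000 * (truncConst a + 2) * ρ)

namespace StepSizes
variable {a ρ β η γ : ℝ} (S : StepSizes a ρ β η γ)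
include S

theorem inv_a_pos : 0 < 1 / a := by have := S.a_ge; positivity
theorem inv_a_le : 1 / a ≤ 1 := by
  rw [div_le_one (by linarith [S.a_ge])]; exact S.a_ge

theorem γ_pos : 0 < γ := by
  have := S.ρ_ge; have := S.η_pos; have := S.β_pos
  exact lt_of_lt_of_le (by positivity) S.le_γ

theorem one_le_β_rpow : 1 ≤ β ^ (-1 + 1 / a) :=
  Real.one_le_rpow_of_pos_of_le_one_of_nonpos S.β_pos S.β_le (by linarith [S.inv_a_le])

theorem mean_le : (η + γ) / 2 ≤ ρ * η * β ^ (-1 + 1 / a) := by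
  have h1 := S.one_le_β_rpow
  have h2 := S.ρ_ge
  have h3 := S.η_pos
  have h4 : 1 ≤ ρ * β ^ (-1 + 1 / a) := one_le_mul_of_one_le_of_one_le h2 h1
  have h5 := S.γ_le
  nlinarith

theorem le_mean : ρ⁻¹ * (η * β ^ (-1 + 1 / a)) / 2 ≤ (η + γ) / 2 := by
  have := S.le_γ; have := S.η_pos; linarith

theorem β_mul_rpow : β * β ^ (-1 + 1 / a) = β ^ (1 / a) := by
  rw [Real.rpow_add S.β_pos, Real.rpow_neg_one]
  field_simp [S.β_pos.ne']

theorem β_mul_mean_le : β * ((η + γ) / 2) ≤ ρ * β ^ (1 / a) * η := by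
  have h := mul_le_mul_of_nonneg_left S.mean_le S.β_pos.le
  rw [← S.β_mul_rpow]
  linarith

theorem β_rpow_le_one : β ^ (1 / a) ≤ 1 :=
  Real.rpow_le_one S.β_pos.le S.β_le S.inv_a_pos.le

theorem stepRoot_pos : 0 < stepRoot a ρ := by
  have := truncConst_nonneg S.a_ge; have := S.ρ_ge
  unfold stepRoot; positivity

theorem ρ_mul_stepRoot_le : (truncConst a + 2) * ρ * stepRoot a ρ = 1 / 800000 := by
  have := truncConst_nonneg S.a_ge; have := S.ρ_ge
  unfold stepRoot
  field_simp

theorem ρ_mul_stepRoot_le' : ρ * stepRoot a ρ ≤ 1 / 1600000 := by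
  have h1 := S.ρ_mul_stepRoot_le
  have h2 : 0 ≤ truncConst a * (ρ * stepRoot a ρ) := by
    have := truncConst_nonneg S.a_ge; have := S.ρ_ge; have := S.stepRoot_pos
    positivity
  linarith

theorem stepRoot_le : stepRoot a ρ ≤ 1 / 1600000 := by
  have h1 := S.ρ_mul_stepRoot_le'
  nlinarith [S.stepRoot_pos, S.ρ_ge]

theorem stepRoot_rpow_le : stepRoot a ρ ^ a ≤ stepRoot a ρ := by
  have h := Real.rpow_le_rpow_of_exponent_ge S.stepRoot_pos
    (S.stepRoot_le.trans (by norm_num)) S.a_ge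
  rwa [Real.rpow_one] at h

/-- The feedback of the multiplicative noise is small. The momentum part of the gain of mode `i`
is at most `min θ (D λ_i)` with `θ = ρ β^{1/a}` and `D = ρ η β^{-1+1/a}`, and in the sum `θ ^ (1 -
1 / a) * D ^ (1 / a)` the powers of `β` cancel: the scaling of `γ` is the largest for which this
happens. -/
theorem sum_gain_le {d : ℕ} (htr : η * ∑ i : Fin d, eig a i ≤ stepRoot a ρ ^ a)
    (hη : η ≤ stepRoot a ρ ^ a) :
    ∑ i : Fin d, gain β ((η + γ) / 2 * eig a i) ((γ - η) / 2 * eig a i) ≤ 1 / 400000 := by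
  have hβ := S.β_pos
  have hη0 := S.η_pos
  have hγ := S.γ_pos
  have hρ := S.ρ_ge
  have hv := S.stepRoot_rpow_le
  have hv0 := S.stepRoot_pos
  have hρv := S.ρ_mul_stepRoot_le
  have htc := truncConst_nonneg S.a_ge
  set θ := ρ * β ^ (1 / a) with hθ
  set D := ρ * η * β ^ (-1 + 1 / a) with hD
  have hθ0 : 0 < θ := by positivity
  have hD0 : 0 < D := by positivity
  have h1 : ∀ i : Fin d, gain β ((η + γ) / 2 * eig a i) ((γ - η) / 2 * eig a i) ≤
      η * eig a i + min θ (D * eig a i) := by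
    intro i
    have hl := eig_pos a i
    have hx : (η + γ) / 2 * eig a i - (γ - η) / 2 * eig a i = η * eig a i := by ring
    rw [gain, hx]
    refine add_le_add le_rfl (le_min ?_ ?_)
    · rw [div_le_iff₀ (by positivity)]
      have h2 := mul_le_mul_of_nonneg_right S.β_mul_mean_le hl.le
      have h3 : 0 ≤ θ * β := by positivity
      linarith
    · rw [div_le_iff₀ (by positivity)]
      have h2 := mul_le_mul_of_nonneg_right S.mean_le hl.le
      have h3 : 0 ≤ D * eig a i * (η * eig a i) := by positivity
      nlinarith
  have h2 : ∑ i : Fin d, min θ (D * eig a i) ≤ 1 / 800000 := by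
    -- for `a = 1` the truncated sum is not scale invariant, but `D λ_i` sums to `ρ η tr Σ`
    rcases S.a_ge.lt_or_eq with ha | ha
    · have h3 := sum_min_rpow_le ha hθ0 hD0 d
      have h4 : θ ^ (1 - 1 / a) * D ^ (1 / a) = ρ * η ^ (1 / a) := by
        rw [hθ, hD, Real.mul_rpow (by positivity) (by positivity),
          Real.mul_rpow (by positivity) (by positivity),
          Real.mul_rpow (by positivity) (by positivity), ← Real.rpow_mul hβ.le,
          ← Real.rpow_mul hβ.le]
        have h5 : ρ ^ (1 - 1 / a) * ρ ^ (1 / a) = ρ := by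
          rw [← Real.rpow_add (by positivity)]; simp
        have h6 : β ^ (1 / a * (1 - 1 / a)) * β ^ ((-1 + 1 / a) * (1 / a)) = 1 := by
          rw [← Real.rpow_add hβ]; ring_nf; simp
        calc _ = (ρ ^ (1 - 1 / a) * ρ ^ (1 / a)) * η ^ (1 / a) *
              (β ^ (1 / a * (1 - 1 / a)) * β ^ ((-1 + 1 / a) * (1 / a))) := by ring
          _ = _ := by rw [h5, h6, mul_one]
      have h5 : η ^ (1 / a) ≤ stepRoot a ρ := by
        have h6 := Real.rpow_le_rpow hη0.le hη S.inv_a_pos.le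
        rwa [← Real.rpow_mul hv0.le, mul_one_div_cancel (by linarith), Real.rpow_one] at h6
      rw [h4] at h3
      have h6 : truncConst a * (ρ * η ^ (1 / a)) ≤ truncConst a * (ρ * stepRoot a ρ) := by
        gcongr
      have h7 : 0 ≤ ρ * stepRoot a ρ := by positivity
      exact (h3.trans h6).trans (by linarith)
    · have h3 : D = ρ * η := by rw [hD, ← ha]; norm_num
      calc ∑ i : Fin d, min θ (D * eig a i) ≤ ∑ i : Fin d, D * eig a i :=
            Finset.sum_le_sum fun i _ => min_le_right _ _
        _ = ρ * (η * ∑ i : Fin d, eig a i) := by rw [← Finset.mul_sum, h3]; ring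
        _ ≤ ρ * stepRoot a ρ := by gcongr; exact htr.trans hv
        _ ≤ 1 / 800000 := S.ρ_mul_stepRoot_le'.trans (by norm_num)
  calc _ ≤ ∑ i : Fin d, (η * eig a i + min θ (D * eig a i)) :=
        Finset.sum_le_sum fun i _ => h1 i
    _ ≤ 1 / 1600000 + 1 / 800000 := by
        rw [Finset.sum_add_distrib, ← Finset.mul_sum]
        exact add_le_add ((htr.trans hv).trans S.stepRoot_le) h2
    _ ≤ _ := by norm_num

end StepSizes

theorem eig_le_one {a : ℝ} (ha : 1 ≤ a) {d : ℕ} (i : Fin d) : eig a i ≤ 1 := by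
  unfold eig
  exact Real.rpow_le_one_of_one_le_of_nonpos (by linarith [(Nat.cast_nonneg i.1 : (0:ℝ) ≤ i.1)])
    (by linarith)

theorem exactMoment_schedule (a : ℝ) (σ : ℝ≥0) {d : ℕ} (Wstar : Param d) (β η γ : ℝ) (T t : ℕ)
    (i : Fin d) :
    exactMoment a σ Wstar β (schedule η T) (schedule γ T) t i =
      scheduledMoment ((1 - β) / (1 + β)) ((η + γ) / 2 * eig a i) ((γ - η) / 2 * eig a i)
        (phaseLength T) (fun s => noiseIntensity a σ Wstar β (schedule η T) (schedule γ T) s i)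
        (Wstar i ^ 2) t := by
  unfold exactMoment scheduledMoment
  congr 1 <;>
  · funext s
    simp only [schedule, phased]
    ring

theorem StepSizes.coreSetup {a ρ β η γ : ℝ} (S : StepSizes a ρ β η γ) (σ : ℝ≥0) {d : ℕ}
    (Wstar : Param d) {T : ℕ} (hT : 2 ≤ T)
    (htr : η * ∑ i : Fin d, eig a i ≤ stepRoot a ρ ^ a) (hη : η ≤ stepRoot a ρ ^ a) :
    CoreSetup d β ((1 - β) / (1 + β)) ((η + γ) / 2) ((γ - η) / 2) ((σ : ℝ) ^ 2) (phaseLength T)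
      (fun i => eig a i) (fun i => Wstar i ^ 2)
      (fun t i => noiseIntensity a σ Wstar β (schedule η T) (schedule γ T) t i) where
  β_pos := S.β_pos
  β_le := S.β_le
  r_eq := by have := S.β_pos; field_simp
  D_pos := by have := S.η_pos; have := S.γ_pos; positivity
  abs_G_le := by
    have := S.η_pos; have := S.γ_pos
    rw [abs_le]; constructor <;> linarith
  lam_pos := fun i => eig_pos a i
  lam_le := fun i => eig_le_one S.a_ge i
  β_mul_D_le := by
    have h1 := S.β_mul_mean_le
    have h2 := S.ρ_mul_stepRoot_le'
    have h3 := S.stepRoot_rpow_le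
    have h4 := S.β_rpow_le_one
    have h5 := S.ρ_ge
    have h6 := S.η_pos
    have h7 : ρ * β ^ (1 / a) * η ≤ ρ * 1 * stepRoot a ρ := by gcongr; exact hη.trans h3
    linarith
  x_le := by
    have := hη.trans (S.stepRoot_rpow_le.trans S.stepRoot_le)
    linarith
  h_le := by
    have hβ := S.β_pos
    have h0 := hη.trans (S.stepRoot_rpow_le.trans S.stepRoot_le)
    have h1 := S.β_mul_mean_le
    have h2 := S.ρ_mul_stepRoot_le'
    have h3 := S.stepRoot_rpow_le
    have h4 := S.β_rpow_le_one
    have h5 := S.ρ_ge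
    have h6 := S.η_pos
    have h7 : ρ * β ^ (1 / a) * η ≤ ρ * 1 * stepRoot a ρ := by gcongr; exact hη.trans h3
    have h8 : (η + γ) / 2 - (1 - β) / (1 + β) * ((γ - η) / 2) = (η + β * γ) / (1 + β) := by
      field_simp; ring
    rw [h8, div_le_iff₀ (by positivity)]
    nlinarith
  K_pos := phaseLength_pos hT
  m_nonneg := fun i => sq_nonneg _
  σ2_nonneg := sq_nonneg _
  n_eq := fun t i => by
    rw [noiseIntensity]
    simp only [expectedMidpointSq_eq a σ Wstar S.β_pos, exactMoment_schedule]
  gain_le := S.sum_gain_le htr hη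

theorem validationLoss_self (a : ℝ) (σ : ℝ≥0) {d : ℕ} (Wstar : Param d) :
    validationLoss a σ Wstar Wstar = (σ : ℝ) ^ 2 := by
  rw [validationLoss_eq]; simp [covForm]

/-! ### Logarithms, variance and bias -/

section LogFactor
variable {a b : ℝ} {d T : ℕ}

theorem log_le_logFactor (hT : 2 ≤ T) : Real.log T ≤ logFactor a b d T := by
  have h1 := log_two_le_log hT
  have h2 : 0 ≤ Real.log d := Real.log_natCast_nonneg d
  unfold logFactor
  split_ifs
  · exact le_rfl
  · nlinarith

theorem one_le_two_mul_logFactor (hT : 2 ≤ T) : 1 ≤ 2 * logFactor a b d T := by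
  have h1 := log_two_le_log hT
  have h2 : Real.log T ≤ logFactor a b d T := log_le_logFactor hT
  linarith

/-- For `s = 1` the constant is `1`, because `1 / 0 = 0`, and the sum is absorbed by the factor
`1 + log d` of the logarithm. -/
theorem sum_rpow_neg_le_logFactor {s : ℝ} (hs : 1 ≤ s) (h : s = a ∨ s = b) (hT : 2 ≤ T) :
    ∑ i : Fin d, ((i : ℝ) + 1) ^ (-s) ≤ (1 + 1 / (s - 1)) * (2 * logFactor a b d T) := by
  rcases hs.lt_or_eq with h1 | h1
  · have h2 : 0 ≤ 1 + 1 / (s - 1) := by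
      have : 0 < s - 1 := by linarith
      positivity
    exact (sum_rpow_neg_le h1 d).trans
      (le_mul_of_one_le_right h2 (one_le_two_mul_logFactor hT))
  · have h2 : ¬(1 < a ∧ 1 < b) := by
      rintro ⟨ha, hb⟩
      rcases h with h | h <;> linarith
    have h3 := log_two_le_log hT
    have h4 : 0 ≤ Real.log d := Real.log_natCast_nonneg d
    rw [logFactor, if_neg h2, ← h1, sub_self, div_zero, add_zero, one_mul]
    have h5 := sum_rpow_neg_le_log le_rfl (a := 1) d
    nlinarith

end LogFactor

namespace StepSizes
variable {a ρ β η γ : ℝ} (S : StepSizes a ρ β η γ)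
include S

theorem one_le_variance_rpow : 1 ≤ β ^ (1 / a ^ 2 - 1 / a) := by
  refine Real.one_le_rpow_of_pos_of_le_one_of_nonpos S.β_pos S.β_le ?_
  have h1 := S.inv_a_pos
  have h2 := S.inv_a_le
  have h3 : 1 / a ^ 2 = 1 / a * (1 / a) := by field_simp
  rw [h3]; nlinarith

theorem inv_le_variance {T : ℕ} (hT : 2 ≤ T) :
    1 / (T : ℝ) ≤ (T : ℝ) ^ (1 / a - 1) * β ^ (1 / a ^ 2 - 1 / a) := by
  have hT1 : (1 : ℝ) ≤ T := by exact_mod_cast (by omega : 1 ≤ T)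
  have h1 : 1 / (T : ℝ) ≤ (T : ℝ) ^ (1 / a - 1) := by
    rw [one_div, ← Real.rpow_neg_one]
    exact Real.rpow_le_rpow_of_exponent_le hT1 (by linarith [S.inv_a_pos])
  exact h1.trans (le_mul_of_one_le_right (by positivity) S.one_le_variance_rpow)

/-- The accumulated noise: coordinates with `D λ_i ≥ ε` contribute `ε` each to the variance,
the others `T (D λ_i)²`. -/
theorem sum_min_sq_le {d T : ℕ} (hT : 2 ≤ T) {ε X : ℝ} (hε : 0 < ε) (hX : 1 ≤ X)
    (hεX : ε ≤ 16 * X ^ 2 / T) (hη : ρ * η ≤ 1) :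
    T * ∑ i : Fin d, min ε ((η + γ) / 2 * eig a i) ^ 2 ≤
      truncConst (2 * a) * (256 * X ^ 4) *
        ((T : ℝ) ^ (1 / a - 1) * β ^ (1 / a ^ 2 - 1 / a)) := by
  have hβ := S.β_pos
  have ha := S.a_ge
  have hη0 := S.η_pos
  have hγ := S.γ_pos
  have hT0 : (0 : ℝ) < T := by positivity
  set D := β ^ (-1 + 1 / a) with hD
  have hD0 : 0 < D := by positivity
  have hDle : (η + γ) / 2 ≤ D :=
    S.mean_le.trans (mul_le_of_le_one_left hD0.le hη)
  have h1 : ∀ i : Fin d, min ε ((η + γ) / 2 * eig a i) ^ 2 ≤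
      min (ε ^ 2) (D ^ 2 * ((i : ℝ) + 1) ^ (-(2 * a))) := by
    intro i
    have hl := eig_pos a i
    have h0 : 0 ≤ min ε ((η + γ) / 2 * eig a i) := le_min hε.le (by positivity)
    refine le_min (pow_le_pow_left₀ h0 (min_le_left _ _) 2) ?_
    have h2 : ((i : ℝ) + 1) ^ (-(2 * a)) = eig a i ^ 2 := by
      rw [eig, ← Real.rpow_natCast, ← Real.rpow_mul (by positivity)]
      congr 1; push_cast; ring
    rw [h2, ← mul_pow]
    exact pow_le_pow_left₀ h0 ((min_le_right _ _).trans (by gcongr)) 2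
  have h2 := (Finset.sum_le_sum fun i (_ : i ∈ Finset.univ) => h1 i).trans
    (sum_min_rpow_le (a := 2 * a) (by linarith) (pow_pos hε 2) (pow_pos hD0 2) d)
  have he : 0 ≤ 1 - 1 / (2 * a) := by
    rw [sub_nonneg, div_le_one (by linarith)]; linarith
  have h3 : (ε ^ 2) ^ (1 - 1 / (2 * a)) ≤ 256 * X ^ 4 * (T : ℝ) ^ (1 / a - 2) := by
    have h4 : ε ^ 2 ≤ 256 * X ^ 4 * (T : ℝ) ^ (-2 : ℝ) := by
      calc ε ^ 2 ≤ (16 * X ^ 2 / T) ^ 2 := by gcongr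
        _ = 256 * X ^ 4 * (T : ℝ) ^ (-2 : ℝ) := by
          rw [Real.rpow_neg hT0.le, Real.rpow_two]; field_simp; ring
    have h5 : 1 ≤ 256 * X ^ 4 := by
      have : 1 ≤ X ^ 4 := one_le_pow₀ hX
      linarith
    calc (ε ^ 2) ^ (1 - 1 / (2 * a))
        ≤ (256 * X ^ 4 * (T : ℝ) ^ (-2 : ℝ)) ^ (1 - 1 / (2 * a)) := by gcongr
      _ = (256 * X ^ 4) ^ (1 - 1 / (2 * a)) * (T : ℝ) ^ (1 / a - 2) := by
          rw [Real.mul_rpow (by positivity) (by positivity), ← Real.rpow_mul hT0.le]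
          congr 2; field_simp; ring
      _ ≤ (256 * X ^ 4) ^ (1 : ℝ) * (T : ℝ) ^ (1 / a - 2) := by
          have : 0 < 1 / (2 * a) := by positivity
          gcongr
          linarith
      _ = _ := by rw [Real.rpow_one]
  have h4 : (D ^ 2) ^ (1 / (2 * a)) = β ^ (1 / a ^ 2 - 1 / a) := by
    rw [hD, ← Real.rpow_natCast, ← Real.rpow_mul hβ.le, ← Real.rpow_mul hβ.le]
    congr 1; field_simp; push_cast; ring
  have h5 : (T : ℝ) * (T : ℝ) ^ (1 / a - 2) = (T : ℝ) ^ (1 / a - 1) := by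
    rw [show 1 / a - 1 = 1 + (1 / a - 2) by ring, Real.rpow_add hT0, Real.rpow_one]
  have htc := truncConst_nonneg (a := 2 * a) (by linarith)
  calc _ ≤ T * (truncConst (2 * a) * ((ε ^ 2) ^ (1 - 1 / (2 * a)) *
        (D ^ 2) ^ (1 / (2 * a)))) := by gcongr
    _ ≤ T * (truncConst (2 * a) * (256 * X ^ 4 * (T : ℝ) ^ (1 / a - 2) *
        β ^ (1 / a ^ 2 - 1 / a))) := by rw [h4]; gcongr
    _ = truncConst (2 * a) * (256 * X ^ 4) *
        ((T * (T : ℝ) ^ (1 / a - 2)) * β ^ (1 / a ^ 2 - 1 / a)) := by ring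
    _ = _ := by rw [h5]

/-- The bias: the initial error of the coordinates with `D λ_i < ε`, which the iteration does
not reach. -/
theorem sum_tail_le {b : ℝ} (hb : 1 ≤ b) {d T : ℕ} (hT : 2 ≤ T) {ε X Y : ℝ} (hε : 0 < ε)
    (hX : 1 ≤ X) (hY : 1 ≤ Y)
    (hsum : ∑ i : Fin d, ((i : ℝ) + 1) ^ (-b) ≤ (1 + 1 / (b - 1)) * X)
    (hεX : ε ≤ Y * X ^ 3 / T * ((η + γ) / 2 * β ^ (1 - 1 / a))) :
    ∑ i : Fin d, (if (η + γ) / 2 * eig a i < ε then ((i : ℝ) + 1) ^ (-b) else 0) ≤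
      (1 + 1 / (b - 1) + truncConst b) * Y ^ b * X ^ (⌈3 * b⌉₊ + 1) *
        ((T : ℝ) ^ (1 / a - b / a) * β ^ ((1 / a ^ 2 - 1 / a) * (1 - b))) := by
  have hβ := S.β_pos
  have ha := S.a_ge
  have hη0 := S.η_pos
  have hγ := S.γ_pos
  have hT0 : (0 : ℝ) < T := by positivity
  have htc := truncConst_nonneg hb
  have hb1 : 0 ≤ 1 / (b - 1) := by
    have : 0 ≤ b - 1 := by linarith
    positivity
  have hYb : 1 ≤ Y ^ b := Real.one_le_rpow hY (by linarith)
  set D := (η + γ) / 2 with hD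
  have hD0 : 0 < D := by positivity
  rcases hb.lt_or_eq with h1 | h1
  · set θ := (ε / D) ^ (b / a) with hθ
    have hθ0 : 0 < θ := by positivity
    have h2 : ∀ i : Fin d, (if D * eig a i < ε then ((i : ℝ) + 1) ^ (-b) else 0) ≤
        min θ (1 * ((i : ℝ) + 1) ^ (-b)) := by
      intro i
      have hl := eig_pos a i
      split_ifs with h
      · refine le_min ?_ (one_mul _).ge
        have h3 : ((i : ℝ) + 1) ^ (-b) = eig a i ^ (b / a) := by
          rw [eig, ← Real.rpow_mul (by positivity)]
          congr 1; field_simp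
        rw [h3, hθ]
        have h4 : eig a i ≤ ε / D := by rw [le_div_iff₀ hD0]; linarith
        gcongr
      · exact le_min hθ0.le (by positivity)
    have h3 := (Finset.sum_le_sum fun i (_ : i ∈ Finset.univ) => h2 i).trans
      (sum_min_rpow_le h1 hθ0 one_pos d)
    have h4 : θ ^ (1 - 1 / b) = (ε / D) ^ ((b - 1) / a) := by
      rw [hθ, ← Real.rpow_mul (by positivity)]
      congr 1; field_simp
    have he : 0 ≤ (b - 1) / a := div_nonneg (by linarith) (by linarith)
    have he' : (b - 1) / a ≤ b := by
      rw [div_le_iff₀ (by linarith)]; nlinarith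
    have h5 : ε / D ≤ Y * X ^ 3 * ((T : ℝ) ^ (-1 : ℝ) * β ^ (1 - 1 / a)) := by
      rw [div_le_iff₀ hD0, Real.rpow_neg_one]
      refine hεX.trans (le_of_eq ?_)
      field_simp
    have hYX : 1 ≤ Y * X ^ 3 := one_le_mul_of_one_le_of_one_le hY (one_le_pow₀ hX)
    have h6 : (Y * X ^ 3) ^ ((b - 1) / a) ≤ Y ^ b * X ^ (⌈3 * b⌉₊ + 1) := by
      calc (Y * X ^ 3) ^ ((b - 1) / a) ≤ (Y * X ^ 3) ^ b :=
            Real.rpow_le_rpow_of_exponent_le hYX he'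
        _ = Y ^ b * X ^ (3 * b) := by
            rw [Real.mul_rpow (by positivity) (by positivity), ← Real.rpow_natCast X 3,
              ← Real.rpow_mul (by positivity)]
            norm_num
        _ ≤ Y ^ b * X ^ ((⌈3 * b⌉₊ + 1 : ℕ) : ℝ) := by
            gcongr
            push_cast
            have := Nat.le_ceil (3 * b)
            linarith
        _ = _ := by rw [Real.rpow_natCast]
    have h7 : ((T : ℝ) ^ (-1 : ℝ) * β ^ (1 - 1 / a)) ^ ((b - 1) / a) =
        (T : ℝ) ^ (1 / a - b / a) * β ^ ((1 / a ^ 2 - 1 / a) * (1 - b)) := by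
      rw [Real.mul_rpow (by positivity) (by positivity), ← Real.rpow_mul hT0.le,
        ← Real.rpow_mul hβ.le]
      congr 2 <;> field_simp <;> ring
    rw [h4, Real.one_rpow, mul_one] at h3
    calc _ ≤ truncConst b * (ε / D) ^ ((b - 1) / a) := h3
      _ ≤ truncConst b * (Y * X ^ 3 * ((T : ℝ) ^ (-1 : ℝ) * β ^ (1 - 1 / a))) ^ ((b - 1) / a) := by
          gcongr
      _ = truncConst b * ((Y * X ^ 3) ^ ((b - 1) / a) *
          ((T : ℝ) ^ (1 / a - b / a) * β ^ ((1 / a ^ 2 - 1 / a) * (1 - b)))) := by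
          rw [Real.mul_rpow (by positivity) (by positivity), h7]
      _ ≤ (1 + 1 / (b - 1) + truncConst b) * ((Y ^ b * X ^ (⌈3 * b⌉₊ + 1)) *
          ((T : ℝ) ^ (1 / a - b / a) * β ^ ((1 / a ^ 2 - 1 / a) * (1 - b)))) := by
          gcongr
          linarith
      _ = _ := by ring
  -- for `b = 1` the bias term of the rate is `1`, and the whole sum is of order `log d`
  · have h2 : (T : ℝ) ^ (1 / a - b / a) * β ^ ((1 / a ^ 2 - 1 / a) * (1 - b)) = 1 := by
      rw [← h1]; simp
    rw [h2, mul_one]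
    calc _ ≤ ∑ i : Fin d, ((i : ℝ) + 1) ^ (-b) := by
          refine Finset.sum_le_sum fun i _ => ?_
          split_ifs
          · exact le_rfl
          · positivity
      _ ≤ (1 + 1 / (b - 1)) * X := hsum
      _ ≤ (1 + 1 / (b - 1) + truncConst b) * X :=
          mul_le_mul_of_nonneg_right (by linarith) (by linarith)
      _ = (1 + 1 / (b - 1) + truncConst b) * 1 * X ^ 1 := by ring
      _ ≤ _ := by
          gcongr
          omega

end StepSizes

/-! ### The excess loss -/

theorem trace_covariance (a : ℝ) (d : ℕ) : (covariance a d).trace = ∑ i : Fin d, eig a i :=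
  Matrix.trace_diagonal _

theorem one_le_sum_eig (a : ℝ) {d : ℕ} (hd : 0 < d) : 1 ≤ ∑ i : Fin d, eig a i := by
  have h := Finset.single_le_sum (f := fun i : Fin d => eig a i)
    (fun i _ => (eig_pos a i).le) (Finset.mem_univ ⟨0, hd⟩)
  simpa [eig] using h

theorem SourceCondition.eig_mul_sq {a b : ℝ} {d : ℕ} {Wstar : Param d}
    (h : SourceCondition a b Wstar) (i : Fin d) :
    eig a i * Wstar i ^ 2 = ((i : ℝ) + 1) ^ (-b) := by
  have := h i
  rwa [covariance, Matrix.diagonal_apply_eq] at this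

/-- The initial stepsize is positive and the dimension is not `0` as soon as `η tr Σ > 0`. -/
theorem pos_of_mul_sum_eig_pos {a η : ℝ} {d : ℕ} (h : 0 < η * ∑ i : Fin d, eig a i) :
    0 < d ∧ 0 < η ∧ η ≤ η * ∑ i : Fin d, eig a i := by
  have hd : 0 < d := by
    rcases Nat.eq_zero_or_pos d with rfl | hd
    · simp at h
    · exact hd
  have h1 := one_le_sum_eig a hd
  have hη : 0 < η := pos_of_mul_pos_left h (by linarith)
  exact ⟨hd, hη, le_mul_of_one_le_right hη.le h1⟩

/-- The last gradient step changes the excess loss by at most the noise of that step, which is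
negligible because the final stepsize is of order `T⁻²`. -/
theorem StepSizes.excess_le_risk {a ρ β η γ : ℝ} (S : StepSizes a ρ β η γ) (σ : ℝ≥0) {d : ℕ}
    (Wstar : Param d) {T : ℕ} (hT : 2 ≤ T)
    (htr : η * ∑ i : Fin d, eig a i ≤ stepRoot a ρ ^ a) (hη : η ≤ stepRoot a ρ ^ a)
    (hc : (∀ i : Fin d, (η + γ) / 2 * eig a i ≤ β / 16) ∨
      (1 - β / 5000) ^ (phaseLength T - 1) * (5000 / β) ≤ 1 / 8) :
    Integrable (fun ξ : ℕ → Sample d => validationLoss a σ Wstar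
        (asgd β (schedule η T) (schedule γ T) ξ T)) (streamLaw a σ Wstar) ∧
      (∫ ξ, validationLoss a σ Wstar (asgd β (schedule η T) (schedule γ T) ξ T)
          ∂(streamLaw a σ Wstar)) - validationLoss a σ Wstar Wstar ≤
        (S.coreSetup σ Wstar hT htr hη).risk (T - 1) +
          1 / T * (S.coreSetup σ Wstar hT htr hη).noiseLevel := by
  set H := S.coreSetup σ Wstar hT htr hη with hH
  have hmean := hasMean_validationLoss_asgd a σ Wstar S.β_pos (schedule η T) (schedule γ T) (T - 1)
  rw [Nat.sub_add_cancel (by omega : 1 ≤ T)] at hmean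
  refine ⟨hmean.1, ?_⟩
  have hT2 : (2 : ℝ) ≤ T := by exact_mod_cast hT
  have hT0 : (0 : ℝ) < T := by linarith
  have hη0 := S.η_pos
  have hN := H.noiseLevel_nonneg
  have hv : stepRoot a ρ ^ a ≤ 1 / 1600000 := S.stepRoot_rpow_le.trans S.stepRoot_le
  rw [hmean.2, validationLoss_self, add_sub_cancel_right]
  set δ := schedule η T T with hδ
  have hδ0 : 0 ≤ δ := by rw [hδ, schedule]; positivity
  have hδη : δ ≤ η := div_four_pow_le hη0.le _
  have hδT : δ * ∑ i : Fin d, eig a i ≤ 1 / T := by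
    have h1 := sq_le_four_pow_div_phaseLength hT
    have h2 : δ * ∑ i : Fin d, eig a i =
        (η * ∑ i : Fin d, eig a i) / 4 ^ (T / phaseLength T) := by
      rw [hδ, schedule]; ring
    rw [h2, div_le_div_iff₀ (by positivity) hT0]
    have h3 : (η * ∑ i : Fin d, eig a i) * T ≤ 1 / 1600000 * T := by
      gcongr; exact htr.trans hv
    nlinarith
  calc _ ≤ ∑ i : Fin d, (eig a i * H.modeRisk (T - 1) i + δ * eig a i * H.noiseLevel) := by
        refine Finset.sum_le_sum fun i _ => ?_
        have hl := eig_pos a i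
        have hM := H.modeRisk_nonneg (T - 1) i
        have hn := H.n_le hc (T - 1) i
        have hx0 : 0 ≤ δ * eig a i := by positivity
        have hx1 : δ * eig a i ≤ 1 := by
          have h1 := eig_le_one S.a_ge i
          have h2 : δ ≤ 1 := by linarith
          exact mul_le_one₀ h2 hl.le h1
        rw [exactMoment_schedule]
        change eig a i * ((1 - δ * eig a i) ^ 2 * H.modeRisk (T - 1) i + _) ≤ _
        rw [le_div_iff₀ hl] at hn
        have h3 : (1 - δ * eig a i) ^ 2 * (eig a i * H.modeRisk (T - 1) i) ≤
            1 * (eig a i * H.modeRisk (T - 1) i) := by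
          gcongr; nlinarith
        have h4 := mul_le_mul_of_nonneg_left hn (sq_nonneg (δ * eig a i))
        have h5 : (δ * eig a i) ^ 2 * H.noiseLevel ≤ δ * eig a i * H.noiseLevel := by
          gcongr; nlinarith
        linarith
    _ = H.risk (T - 1) + (δ * ∑ i : Fin d, eig a i) * H.noiseLevel := by
        rw [Finset.sum_add_distrib, ← Finset.sum_mul, ← Finset.mul_sum]; rfl
    _ ≤ _ := by gcongr

theorem noiseLevel_le_logFactor {a b ρ β η γ : ℝ} (hb : 1 ≤ b) (S : StepSizes a ρ β η γ) (σ : ℝ≥0)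
    {d : ℕ} {Wstar : Param d} (hW : SourceCondition a b Wstar) {T : ℕ} (hT : 2 ≤ T)
    (htr : η * ∑ i : Fin d, eig a i ≤ stepRoot a ρ ^ a) (hη : η ≤ stepRoot a ρ ^ a) :
    (S.coreSetup σ Wstar hT htr hη).noiseLevel ≤
      (400000 * (1 + 1 / (b - 1)) + 3 * (σ : ℝ) ^ 2) * (2 * logFactor a b d T) := by
  have h1 := sum_rpow_neg_le_logFactor (a := a) (d := d) hb (Or.inr rfl) hT
  have h2 := one_le_two_mul_logFactor (a := a) (b := b) (d := d) hT
  have h3 := sq_nonneg (σ : ℝ)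
  rw [CoreSetup.noiseLevel, Finset.sum_congr rfl fun i _ => hW.eig_mul_sq i]
  nlinarith

/-- The rate of accelerated SGD, provided a phase is long compared to `log T / β`. -/
theorem asgd_excess_le {a b ρ : ℝ} (ha : 1 ≤ a) (hb : 1 ≤ b) (hρ : 1 ≤ ρ) (σ : ℝ≥0) {η₀ : ℝ}
    (hη₀ : 0 < η₀) : ∃ C : ℝ, 0 < C ∧ ∃ p : ℕ, ∀ (d : ℕ) (Wstar : Param d),
      SourceCondition a b Wstar → ∀ T : ℕ, 2 ≤ T → ∀ β η γ : ℝ, StepSizes a ρ β η γ →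
      200000 * Real.log T ≤ β * phaseLength T → η₀ ≤ η * (covariance a d).trace →
      η * (covariance a d).trace ≤ stepRoot a ρ ^ a →
      Integrable (fun ξ : ℕ → Sample d => validationLoss a σ Wstar
          (asgd β (schedule η T) (schedule γ T) ξ T)) (streamLaw a σ Wstar) ∧
        (∫ ξ, validationLoss a σ Wstar (asgd β (schedule η T) (schedule γ T) ξ T)
            ∂(streamLaw a σ Wstar)) - validationLoss a σ Wstar Wstar ≤
          C * logFactor a b d T ^ p * asgdRate a b β T := by
  have hb1 : 0 ≤ 1 / (b - 1) := by
    have : 0 ≤ b - 1 := by linarith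
    positivity
  have ha1 : 0 ≤ 1 / (a - 1) := by
    have : 0 ≤ a - 1 := by linarith
    positivity
  have htb := truncConst_nonneg hb
  have hta := truncConst_nonneg (a := 2 * a) (by linarith)
  -- `Y` bounds the threshold `ε` relative to the stepsize, with `1 / η ≤ tr Σ / η₀`
  set Y := 1 + 32 * ρ * (1 + 1 / (a - 1)) / η₀ with hYdef
  have hY : 1 ≤ Y := by
    have : 0 ≤ 32 * ρ * (1 + 1 / (a - 1)) / η₀ := by positivity
    linarith
  set N₀ := 400000 * (1 + 1 / (b - 1)) + 3 * (σ : ℝ) ^ 2 with hN₀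
  have hN₀0 : 0 < N₀ := by positivity
  set c := (1 + 1 / (b - 1) + truncConst b) * Y ^ b with hc
  have hc0 : 0 ≤ c := by positivity
  set p := ⌈3 * b⌉₊ + 5 with hp
  set C₀ := 2 * c + 68 * 256 * truncConst (2 * a) * N₀ + 2 * N₀ with hC₀
  have hC₀0 : 0 < C₀ := by positivity
  refine ⟨C₀ * 2 ^ p, by positivity, p, ?_⟩
  intro d Wstar hW T hT β η γ S hK h₀ h₁
  rw [trace_covariance] at h₀ h₁
  obtain ⟨hd, hη0, hηle⟩ := pos_of_mul_sum_eig_pos (hη₀.trans_le h₀)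
  have hη := hηle.trans h₁
  obtain ⟨hint, hex⟩ := S.excess_le_risk σ Wstar hT h₁ hη
    (Or.inr (contraction_of_le S.β_pos S.β_le hT hK))
  refine ⟨hint, hex.trans ?_⟩
  have hlast := (S.coreSetup σ Wstar hT h₁ hη).risk_last_le hT hK rfl
  have hN := noiseLevel_le_logFactor hb S σ hW hT h₁ hη
  have hNn := (S.coreSetup σ Wstar hT h₁ hη).noiseLevel_nonneg
  set H := S.coreSetup σ Wstar hT h₁ hη with hH
  set ε := 4 * Real.log T / phaseLength T with hε
  set X := 2 * logFactor a b d T with hXdef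
  have hX : 1 ≤ X := one_le_two_mul_logFactor hT
  have hlogX : Real.log T ≤ X := by
    have h1 : Real.log T ≤ logFactor a b d T := log_le_logFactor hT
    linarith
  have hlog := log_two_le_log hT
  have hT0 : (0 : ℝ) < T := by positivity
  have hK0 : (0 : ℝ) < phaseLength T := by exact_mod_cast phaseLength_pos hT
  have hε0 : 0 < ε := by positivity
  have hεX : ε ≤ 16 * X ^ 2 / T := by
    have h1 := le_phaseLength hT
    rw [hε, div_le_div_iff₀ hK0 hT0]
    calc 4 * Real.log T * T ≤ 4 * Real.log T * (4 * Real.log T * phaseLength T) := by gcongr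
      _ = 16 * Real.log T ^ 2 * phaseLength T := by ring
      _ ≤ 16 * X ^ 2 * phaseLength T := by gcongr
  have hρη : ρ * η ≤ 1 := by
    have h1 := S.ρ_mul_stepRoot_le'
    have h2 := mul_le_mul_of_nonneg_left (hη.trans S.stepRoot_rpow_le)
      (by linarith : (0 : ℝ) ≤ ρ)
    linarith
  have hεY : ε ≤ Y * X ^ 3 / T * ((η + γ) / 2 * β ^ (1 - 1 / a)) := by
    have h1 : η / (2 * ρ) ≤ (η + γ) / 2 * β ^ (1 - 1 / a) := by
      have h2 := mul_le_mul_of_nonneg_right S.le_mean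
        (Real.rpow_nonneg S.β_pos.le (1 - 1 / a))
      refine le_trans (le_of_eq ?_) h2
      have h3 : β ^ (-1 + 1 / a) * β ^ (1 - 1 / a) = 1 := by
        rw [← Real.rpow_add S.β_pos]; ring_nf; simp
      calc η / (2 * ρ) = ρ⁻¹ * η / 2 * 1 := by field_simp
        _ = ρ⁻¹ * η / 2 * (β ^ (-1 + 1 / a) * β ^ (1 - 1 / a)) := by rw [h3]
        _ = _ := by ring
    have h2 : η₀ ≤ η * ((1 + 1 / (a - 1)) * X) :=
      h₀.trans (mul_le_mul_of_nonneg_left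
        (sum_rpow_neg_le_logFactor (b := b) ha (Or.inl rfl) hT) hη0.le)
    have h3 : 16 ≤ Y * X * (η / (2 * ρ)) := by
      have h4 : 32 * ρ * (1 + 1 / (a - 1)) / η₀ ≤ Y := by linarith
      have h5 : 32 * ρ * (1 + 1 / (a - 1)) / η₀ * (X * (η / (2 * ρ))) ≤
          Y * (X * (η / (2 * ρ))) := by gcongr
      have h6 : 32 * ρ * (1 + 1 / (a - 1)) / η₀ * (X * (η / (2 * ρ))) =
          16 * (η * ((1 + 1 / (a - 1)) * X) / η₀) := by field_simp; ring
      have h7 : 1 ≤ η * ((1 + 1 / (a - 1)) * X) / η₀ := by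
        rw [le_div_iff₀ hη₀]; linarith
      linarith
    calc ε ≤ 16 * X ^ 2 / T := hεX
      _ ≤ (Y * X * (η / (2 * ρ))) * X ^ 2 / T := by gcongr
      _ = Y * X ^ 3 / T * (η / (2 * ρ)) := by ring
      _ ≤ _ := by gcongr
  have hvar := S.sum_min_sq_le (d := d) hT hε0 hX hεX hρη
  have htail := S.sum_tail_le hb (d := d) hT hε0 hX hY
    (sum_rpow_neg_le_logFactor (a := a) hb (Or.inr rfl) hT) hεY
  have hinv := S.inv_le_variance hT
  rw [asgdRate]
  set V := (T : ℝ) ^ (1 / a - 1) * β ^ (1 / a ^ 2 - 1 / a) with hV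
  set B := (T : ℝ) ^ (1 / a - b / a) * β ^ ((1 / a ^ 2 - 1 / a) * (1 - b)) with hB
  have hV0 : 0 ≤ V := le_trans (by positivity) hinv
  have hB0 : 0 ≤ B := by have := S.β_pos; positivity
  have hX1 : X ≤ X ^ p := le_self_pow₀ hX (by omega)
  have hX5 : X ^ 5 ≤ X ^ p := pow_le_pow_right₀ hX (by omega)
  have hXq : X ^ (⌈3 * b⌉₊ + 1) ≤ X ^ p := pow_le_pow_right₀ hX (by omega)
  have h1 : ∑ i : Fin d, (if (η + γ) / 2 * eig a i < ε then eig a i * Wstar i ^ 2 else 0) ≤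
      c * X ^ p * B := by
    rw [Finset.sum_congr rfl fun i _ => by rw [hW.eig_mul_sq i]]
    refine htail.trans ?_
    gcongr
  have h2 : 68 * T * H.noiseLevel * ∑ i : Fin d, min ε ((η + γ) / 2 * eig a i) ^ 2 ≤
      68 * 256 * truncConst (2 * a) * N₀ * X ^ p * V := by
    calc _ = 68 * H.noiseLevel * (T * ∑ i : Fin d, min ε ((η + γ) / 2 * eig a i) ^ 2) := by ring
      _ ≤ 68 * (N₀ * X) * (truncConst (2 * a) * (256 * X ^ 4) * V) := by gcongr
      _ = 68 * 256 * truncConst (2 * a) * N₀ * X ^ 5 * V := by ring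
      _ ≤ _ := by gcongr
  have h3 : 1 / T * H.noiseLevel ≤ N₀ * X ^ p * V := by
    calc 1 / T * H.noiseLevel ≤ V * (N₀ * X) := by gcongr
      _ ≤ V * (N₀ * X ^ p) := by gcongr
      _ = _ := by ring
  have h4 : C₀ * 2 ^ p * logFactor a b d T ^ p = C₀ * X ^ p := by
    rw [hXdef, mul_pow]; ring
  rw [h4]
  have hXp : 0 ≤ X ^ p := by positivity
  have h5 : 0 ≤ c * X ^ p * V := by positivity
  have h6 : 0 ≤ (68 * 256 * truncConst (2 * a) * N₀ + 2 * N₀) * X ^ p * B := by positivity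
  calc _ ≤ 2 * (c * X ^ p * B) + 68 * 256 * truncConst (2 * a) * N₀ * X ^ p * V +
        N₀ * X ^ p * V + N₀ * X ^ p * V := by
        refine add_le_add (hlast.trans ?_) h3
        gcongr
    _ ≤ C₀ * X ^ p * (V + B) := by rw [hC₀]; linarith

/-! ### The rates -/

/-- `β T ≥ C (log T)^p` makes the phases long enough for the contraction. -/
theorem le_mul_phaseLength {β C : ℝ} {p T : ℕ} (hβ : 0 < β) (hT : 2 ≤ T)
    (hC : 800000 * 2 ^ p ≤ C) (h : C * Real.log T ^ (p + 2) ≤ β * T) :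
    200000 * Real.log T ≤ β * phaseLength T := by
  have h1 := le_phaseLength hT
  have h2 := log_two_le_log hT
  have h3 : 1 ≤ 2 ^ p * Real.log T ^ p := by
    rw [← mul_pow]; exact one_le_pow₀ (by linarith)
  have h4 : 800000 * Real.log T ^ 2 ≤ C * Real.log T ^ (p + 2) := by
    calc 800000 * Real.log T ^ 2 ≤ 800000 * Real.log T ^ 2 * (2 ^ p * Real.log T ^ p) :=
          le_mul_of_one_le_right (by positivity) h3
      _ = 800000 * 2 ^ p * Real.log T ^ (p + 2) := by ring
      _ ≤ _ := by gcongr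
  have h5 : β * T ≤ β * (4 * Real.log T * phaseLength T) := by gcongr
  have h6 : 4 * Real.log T * (200000 * Real.log T) ≤ 4 * Real.log T * (β * phaseLength T) := by
    linarith
  exact le_of_mul_le_mul_left h6 (by linarith)

theorem exists_le_phaseLength :
    ∃ T₀ : ℕ, 2 ≤ T₀ ∧ ∀ T ≥ T₀, 200000 * Real.log T ≤ phaseLength T := by
  have h := ((Real.isLittleO_pow_log_id_atTop (n := 2)).bound
    (by norm_num : (0 : ℝ) < 1 / 800000)).and (Filter.eventually_ge_atTop 2)
  obtain ⟨T₀, hT₀⟩ := Filter.eventually_atTop.mp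
    (tendsto_natCast_atTop_atTop (R := ℝ) |>.eventually h)
  refine ⟨max T₀ 2, le_max_right _ _, fun T hT => ?_⟩
  have hT2 : 2 ≤ T := (le_max_right _ _).trans hT
  have h1 := (hT₀ T ((le_max_left _ _).trans hT)).1
  simp only [id, Real.norm_eq_abs, abs_of_nonneg (sq_nonneg (Real.log T)), Nat.abs_cast] at h1
  have h2 := le_mul_phaseLength (β := 1) (C := 800000) (p := 0) one_pos hT2 (by norm_num)
    (by norm_num; linarith)
  linarith

theorem asgd_rate (a : ℝ) (ha : 1 ≤ a) (ρ : ℝ) (hρ : 1 ≤ ρ) :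
    ∃ η₁ : ℝ, 0 < η₁ ∧ ∀ b : ℝ, 1 ≤ b → ∀ σ : ℝ≥0, ∀ η₀ : ℝ, 0 < η₀ →
      ∃ C : ℝ, 0 < C ∧ ∃ p : ℕ, ∀ (d : ℕ) (Wstar : Param d), SourceCondition a b Wstar →
      ∀ T : ℕ, 2 ≤ T → ∀ β : ℝ, 0 < β → β ≤ 1 → C * Real.log T ^ p ≤ β * T →
      ∀ η : ℝ, η₀ ≤ η * (covariance a d).trace → η * (covariance a d).trace ≤ η₁ →
      ∀ γ : ℝ, ρ⁻¹ * (η * β ^ (-1 + 1 / a)) ≤ γ → γ ≤ ρ * (η * β ^ (-1 + 1 / a)) →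
        Integrable (fun ξ : ℕ → Sample d => validationLoss a σ Wstar
            (asgd β (schedule η T) (schedule γ T) ξ T)) (streamLaw a σ Wstar) ∧
          (∫ ξ, validationLoss a σ Wstar (asgd β (schedule η T) (schedule γ T) ξ T)
              ∂(streamLaw a σ Wstar)) - validationLoss a σ Wstar Wstar ≤
            C * logFactor a b d T ^ p * asgdRate a b β T := by
  have hv : 0 < stepRoot a ρ := by
    have := truncConst_nonneg ha
    unfold stepRoot; positivity
  refine ⟨stepRoot a ρ ^ a, by positivity, fun b hb σ η₀ hη₀ => ?_⟩
  obtain ⟨C, hC, p, h⟩ := asgd_excess_le ha hb hρ σ hη₀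
  refine ⟨800000 * 2 ^ p + 4 * C, by positivity, p + 2, ?_⟩
  intro d Wstar hW T hT β hβ hβ1 hβT η h₀ h₁ γ hγ hγ'
  have hη : 0 < η := by
    rw [trace_covariance] at h₀
    exact (pos_of_mul_sum_eig_pos (hη₀.trans_le h₀)).2.1
  have hK := le_mul_phaseLength hβ hT (by linarith) hβT
  obtain ⟨h1, h2⟩ := h d Wstar hW T hT β η γ ⟨ha, hρ, hβ, hβ1, hη, hγ, hγ'⟩ hK h₀ h₁
  refine ⟨h1, h2.trans ?_⟩
  have hX : 1 ≤ 2 * logFactor a b d T := one_le_two_mul_logFactor hT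
  have hR : 0 ≤ asgdRate a b β T := by unfold asgdRate; positivity
  have hl : 0 < logFactor a b d T := by linarith
  refine mul_le_mul_of_nonneg_right ?_ hR
  have h3 : 1 ≤ (2 * logFactor a b d T) ^ 2 := one_le_pow₀ hX
  have h4 : 0 ≤ C * logFactor a b d T ^ p := by positivity
  have h5 : 0 ≤ 800000 * 2 ^ p * logFactor a b d T ^ (p + 2) := by positivity
  calc C * logFactor a b d T ^ p ≤ C * logFactor a b d T ^ p * (2 * logFactor a b d T) ^ 2 :=
        le_mul_of_one_le_right h4 h3
    _ ≤ _ := by rw [add_mul]; linarith [show C * logFactor a b d T ^ p * (2 * logFactor a b d T) ^ 2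
        = 4 * C * logFactor a b d T ^ (p + 2) by ring]

theorem asgd_one_eq_sgd {d : ℕ} (δ : ℕ → ℝ) (ξ : ℕ → Sample d) (t : ℕ) :
    asgd 1 δ δ ξ t = sgd δ ξ t := by
  rw [asgd, asgdState_one_eq]

theorem asgdRate_one (a b : ℝ) (T : ℕ) : asgdRate a b 1 T = sgdRate a b T := by
  simp [asgdRate, sgdRate]

/-- Vanilla SGD is accelerated SGD with `β = 1` and `γ = η`. For the finitely many horizons below
`T₀` the rate is bounded below, and the uniform bound of the excess loss suffices. -/
theorem sgd_rate (a : ℝ) (ha : 1 ≤ a) :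
    ∃ η₁ : ℝ, 0 < η₁ ∧ ∀ b : ℝ, 1 ≤ b → ∀ σ : ℝ≥0, ∀ η₀ : ℝ, 0 < η₀ →
      ∃ C : ℝ, 0 < C ∧ ∃ p : ℕ, ∀ (d : ℕ) (Wstar : Param d), SourceCondition a b Wstar →
      ∀ T : ℕ, 2 ≤ T →
      ∀ η : ℝ, η₀ ≤ η * (covariance a d).trace → η * (covariance a d).trace ≤ η₁ →
        Integrable (fun ξ : ℕ → Sample d => validationLoss a σ Wstar
            (sgd (schedule η T) ξ T)) (streamLaw a σ Wstar) ∧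
          (∫ ξ, validationLoss a σ Wstar (sgd (schedule η T) ξ T)
              ∂(streamLaw a σ Wstar)) - validationLoss a σ Wstar Wstar ≤
            C * logFactor a b d T ^ p * sgdRate a b T := by
  have hv : 0 < stepRoot a 1 := by
    have := truncConst_nonneg ha
    unfold stepRoot; positivity
  refine ⟨stepRoot a 1 ^ a, by positivity, fun b hb σ η₀ hη₀ => ?_⟩
  obtain ⟨C, hC, p, h⟩ := asgd_excess_le ha hb le_rfl σ hη₀
  obtain ⟨T₀, hT₀2, hT₀⟩ := exists_le_phaseLength
  have hb1 : 0 ≤ 1 / (b - 1) := by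
    have : 0 ≤ b - 1 := by linarith
    positivity
  set N₀ := 400000 * (1 + 1 / (b - 1)) + 3 * (σ : ℝ) ^ 2 with hN₀
  have hN₀0 : 0 < N₀ := by positivity
  have hT₀0 : (0 : ℝ) < T₀ := by positivity
  refine ⟨2 * C + 2 ^ (p + 1) * (2 * N₀ * T₀), by positivity, p + 1, ?_⟩
  intro d Wstar hW T hT η h₀ h₁
  have hX : 1 ≤ 2 * logFactor a b d T := one_le_two_mul_logFactor hT
  have hl : 0 < logFactor a b d T := by linarith
  have hT0 : (0 : ℝ) < T := by positivity
  have h₀' := h₀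
  have h₁' := h₁
  rw [trace_covariance] at h₀' h₁'
  obtain ⟨-, hη0, hηle⟩ := pos_of_mul_sum_eig_pos (hη₀.trans_le h₀')
  have S : StepSizes a 1 1 η η := ⟨ha, le_rfl, one_pos, le_rfl, hη0, by simp, by simp⟩
  have hη := hηle.trans h₁'
  have hR : 0 ≤ sgdRate a b T := by unfold sgdRate; positivity
  simp only [← asgd_one_eq_sgd, ← asgdRate_one a b T] at hR ⊢
  rcases le_or_gt T₀ T with hTT | hTT
  · obtain ⟨h1, h2⟩ := h d Wstar hW T hT 1 η η S (by rw [one_mul]; exact hT₀ T hTT) h₀ h₁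
    refine ⟨h1, h2.trans ?_⟩
    refine mul_le_mul_of_nonneg_right ?_ hR
    have h3 : 0 ≤ 2 ^ (p + 1) * (2 * N₀ * T₀) * logFactor a b d T ^ (p + 1) := by positivity
    have h4 : 0 ≤ C * logFactor a b d T ^ p := by positivity
    calc C * logFactor a b d T ^ p ≤ C * logFactor a b d T ^ p * (2 * logFactor a b d T) :=
          le_mul_of_one_le_right h4 hX
      _ = 2 * C * logFactor a b d T ^ (p + 1) := by ring
      _ ≤ _ := by rw [add_mul]; linarith
  · have hc : ∀ i : Fin d, (η + η) / 2 * eig a i ≤ 1 / 16 := fun i => by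
      have h1 := eig_le_one ha i
      have h2 := hη.trans (S.stepRoot_rpow_le.trans S.stepRoot_le)
      have h3 := eig_pos a i
      nlinarith
    obtain ⟨h1, h2⟩ := S.excess_le_risk σ Wstar hT h₁' hη (Or.inl hc)
    refine ⟨h1, h2.trans ?_⟩
    have hN := noiseLevel_le_logFactor hb S σ hW hT h₁' hη
    have hNn := (S.coreSetup σ Wstar hT h₁' hη).noiseLevel_nonneg
    have hr := (S.coreSetup σ Wstar hT h₁' hη).risk_le (Or.inl hc) (T - 1)
    have hs0 := (S.coreSetup σ Wstar hT h₁' hη).risk_nonneg (T - 1)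
    have hrate : 1 ≤ T₀ * asgdRate a b 1 T := by
      have h3 := S.inv_le_variance hT
      have h4 : 0 ≤ (T : ℝ) ^ (1 / a - b / a) * (1 : ℝ) ^ ((1 / a ^ 2 - 1 / a) * (1 - b)) := by
        positivity
      have h5 : 1 / (T₀ : ℝ) ≤ 1 / T := by
        gcongr
      have h6 : 1 / (T₀ : ℝ) ≤ asgdRate a b 1 T := by rw [asgdRate]; linarith
      rwa [div_le_iff₀ hT₀0, mul_comm] at h6
    set H := S.coreSetup σ Wstar hT h₁' hη with hH
    have hrN : H.risk (T - 1) ≤ H.noiseLevel := by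
      rw [CoreSetup.noiseLevel]
      have := H.σ2_nonneg
      linarith
    have hT1 : 1 / (T : ℝ) * H.noiseLevel ≤ 1 * H.noiseLevel := by
      gcongr
      rw [div_le_one hT0]
      exact_mod_cast (by omega : 1 ≤ T)
    have hXp : 2 * logFactor a b d T ≤ (2 * logFactor a b d T) ^ (p + 1) :=
      le_self_pow₀ hX (by omega)
    have h7 : 0 ≤ 2 * C * logFactor a b d T ^ (p + 1) * asgdRate a b 1 T := by positivity
    calc _ ≤ 2 * (N₀ * (2 * logFactor a b d T)) := by linarith
      _ ≤ 2 * (N₀ * (2 * logFactor a b d T) ^ (p + 1)) := by gcongr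
      _ ≤ 2 * (N₀ * (2 * logFactor a b d T) ^ (p + 1)) * (T₀ * asgdRate a b 1 T) :=
          le_mul_of_one_le_right (by positivity) hrate
      _ = 2 ^ (p + 1) * (2 * N₀ * T₀) * logFactor a b d T ^ (p + 1) * asgdRate a b 1 T := by
          rw [mul_pow]; ring
      _ ≤ _ := by
          rw [add_mul, add_mul]; linarith

theorem rate_comparison {a b β : ℝ} (ha : 1 ≤ a) (hab : a ≤ b) {T : ℕ} (hT : 1 ≤ T) (hβ : 0 < β)
    (hβ1 : β ≤ 1) :
    (T : ℝ) ^ (1 / a - b / a) ≤ (T : ℝ) ^ (1 / a - 1) ∧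
      (T : ℝ) ^ (1 / a - b / a) * β ^ ((1 / a ^ 2 - 1 / a) * (1 - b)) ≤
        (T : ℝ) ^ (1 / a - 1) * β ^ (1 / a ^ 2 - 1 / a) ∧
      1 ≤ β ^ (1 / a ^ 2 - 1 / a) ∧
      (1 < a → β < 1 → 1 < β ^ (1 / a ^ 2 - 1 / a)) ∧
      β ^ (1 / a ^ 2 - 1 / a) * sgdRate a b T ≤ 2 * asgdRate a b β T := by
  have hT1 : (1 : ℝ) ≤ T := by exact_mod_cast hT
  have ha0 : 0 < a := by linarith
  have h1 : (T : ℝ) ^ (1 / a - b / a) ≤ (T : ℝ) ^ (1 / a - 1) := by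
    refine Real.rpow_le_rpow_of_exponent_le hT1 ?_
    have : 1 ≤ b / a := by rwa [le_div_iff₀ ha0, one_mul]
    linarith
  have he : 1 / a ^ 2 - 1 / a = (1 - a) / a ^ 2 := by field_simp
  have he0 : 1 / a ^ 2 - 1 / a ≤ 0 := by
    rw [he]; exact div_nonpos_of_nonpos_of_nonneg (by linarith) (by positivity)
  have h2 : 1 ≤ β ^ (1 / a ^ 2 - 1 / a) :=
    Real.one_le_rpow_of_pos_of_le_one_of_nonpos hβ hβ1 he0
  have h3 : β ^ ((1 / a ^ 2 - 1 / a) * (1 - b)) ≤ 1 :=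
    Real.rpow_le_one hβ.le hβ1 (mul_nonneg_of_nonpos_of_nonpos he0 (by linarith))
  have hT0 : (0 : ℝ) ≤ (T : ℝ) ^ (1 / a - b / a) := by positivity
  refine ⟨h1, ?_, h2, fun h h' => ?_, ?_⟩
  · exact mul_le_mul h1 (h3.trans h2) (by positivity) (by positivity)
  · refine Real.one_lt_rpow_of_pos_of_lt_one_of_neg hβ h' ?_
    rw [he]; exact div_neg_of_neg_of_pos (by linarith) (by positivity)
  · rw [sgdRate, asgdRate]
    have h4 : 0 ≤ (T : ℝ) ^ (1 / a - b / a) * β ^ ((1 / a ^ 2 - 1 / a) * (1 - b)) := by positivity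
    have h5 := mul_le_mul_of_nonneg_left h1 (by linarith : 0 ≤ β ^ (1 / a ^ 2 - 1 / a))
    linarith

end AccSGD

end

theorem theorem1 (a : ℝ) (ha : 1 ≤ a) :
    -- vanilla SGD
    (∃ η₁ : ℝ, 0 < η₁ ∧
      ∀ b : ℝ, 1 ≤ b → ∀ σ : ℝ≥0, ∀ η₀ : ℝ, 0 < η₀ →
      ∃ C : ℝ, 0 < C ∧ ∃ p : ℕ,
        ∀ (d : ℕ) (Wstar : AccSGD.Param d), AccSGD.SourceCondition a b Wstar →
        ∀ T : ℕ, 2 ≤ T →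
        ∀ η : ℝ, η₀ ≤ η * (AccSGD.covariance a d).trace → η * (AccSGD.covariance a d).trace ≤ η₁ →
          Integrable
            (fun ξ : ℕ → AccSGD.Sample d => AccSGD.validationLoss a σ Wstar
              (AccSGD.sgd (AccSGD.schedule η T) ξ T))
            (AccSGD.streamLaw a σ Wstar) ∧
          (∫ ξ, AccSGD.validationLoss a σ Wstar (AccSGD.sgd (AccSGD.schedule η T) ξ T)
              ∂(AccSGD.streamLaw a σ Wstar)) - AccSGD.validationLoss a σ Wstar Wstar
            ≤ C * AccSGD.logFactor a b d T ^ p * AccSGD.sgdRate a b T) ∧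
    -- accelerated SGD with momentum `1 - β`
    (∀ ρ : ℝ, 1 ≤ ρ →
      ∃ η₁ : ℝ, 0 < η₁ ∧
      ∀ b : ℝ, 1 ≤ b → ∀ σ : ℝ≥0, ∀ η₀ : ℝ, 0 < η₀ →
      ∃ C : ℝ, 0 < C ∧ ∃ p : ℕ,
        ∀ (d : ℕ) (Wstar : AccSGD.Param d), AccSGD.SourceCondition a b Wstar →
        ∀ T : ℕ, 2 ≤ T →
        ∀ β : ℝ, 0 < β → β ≤ 1 → C * Real.log T ^ p ≤ β * T →
        ∀ η : ℝ, η₀ ≤ η * (AccSGD.covariance a d).trace → η * (AccSGD.covariance a d).trace ≤ η₁ →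
        ∀ γ : ℝ, ρ⁻¹ * (η * β ^ (-1 + 1 / a)) ≤ γ → γ ≤ ρ * (η * β ^ (-1 + 1 / a)) →
          Integrable
            (fun ξ : ℕ → AccSGD.Sample d => AccSGD.validationLoss a σ Wstar
              (AccSGD.asgd β (AccSGD.schedule η T) (AccSGD.schedule γ T) ξ T))
            (AccSGD.streamLaw a σ Wstar) ∧
          (∫ ξ, AccSGD.validationLoss a σ Wstar
                (AccSGD.asgd β (AccSGD.schedule η T) (AccSGD.schedule γ T) ξ T)
              ∂(AccSGD.streamLaw a σ Wstar)) - AccSGD.validationLoss a σ Wstar Wstar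
            ≤ C * AccSGD.logFactor a b d T ^ p * AccSGD.asgdRate a b β T) ∧
    -- the regime `a ≤ b`: the variance terms dominate, and the bound for accelerated SGD is never
    -- better than the one for vanilla SGD (up to the factor 2), and worse by `β^{1/a²-1/a} ≥ 1`
    (∀ b : ℝ, a ≤ b → ∀ T : ℕ, 1 ≤ T → ∀ β : ℝ, 0 < β → β ≤ 1 →
      (T : ℝ) ^ (1 / a - b / a) ≤ (T : ℝ) ^ (1 / a - 1) ∧
      (T : ℝ) ^ (1 / a - b / a) * β ^ ((1 / a ^ 2 - 1 / a) * (1 - b)) ≤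
        (T : ℝ) ^ (1 / a - 1) * β ^ (1 / a ^ 2 - 1 / a) ∧
      1 ≤ β ^ (1 / a ^ 2 - 1 / a) ∧
      (1 < a → β < 1 → 1 < β ^ (1 / a ^ 2 - 1 / a)) ∧
      β ^ (1 / a ^ 2 - 1 / a) * AccSGD.sgdRate a b T ≤ 2 * AccSGD.asgdRate a b β T) := by
  exact ⟨AccSGD.sgd_rate a ha, fun ρ hρ => AccSGD.asgd_rate a ha ρ hρ,
    fun _ hab _ hT _ hβ hβ1 => AccSGD.rate_comparison ha hab hT hβ hβ1⟩
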